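/- Conventions. Algorithms are deterministic programs on a random access machine (with logarithmic cost). A path decomposition of a graph $G=(V,E)$ is a sequence of bags $B_1,\dots,B_t\subseteq V$ such that every vertex and every edge lies in some bag and the bags containing a given vertex are consecutive; its width is the maximum bag size minus one. Path decompositions are supplied with the input, and running times are expressed in the width $\mathrm{pw}$ of the supplied decomposition; consecutive bags of a supplied decomposition are assumed to be different (so that $t\le 2|V|+1$). The PP-SETH is the following hypothesis: for all $\varepsilon\in(0,2)$, there is no algorithm which takes as input a 3-SAT instance $\phi$ (a set of distinct clauses, each with at most three literals) on $n$ variables and a path decomposition of width $\mathrm{pw}$ of its primal graph (the variables of $\phi$, two of them adjacent if they appear together in a clause), and correctly decides whether $\phi$ is satisfiable in time $O\big((2-\varepsilon)^{\mathrm{pw}}(n+1)^{O(1)}\big)$. In Set Cover the input is a universe $U$ of $n$ elements, a collection $\mathcal C$ of $m$ subsets of $U$, and a path decomposition of width $\mathrm{pw}$ of the incidence graph of $(U,\mathcal C)$ (the bipartite graph on $U\cup\mathcal C$ with an edge $uC$ whenever $u\in C$); the task is to output a minimum cardinality subcollection of $\mathcal C$ whose union is $U$, or to report that there is none. In the decision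 version an integer $k\in\{0,\dots,m\}$ is also given, and the question is whether some subcollection of at most $k$ sets has union $U$. Statement. There exist $\varepsilon\in(0,2)$ and an algorithm solving Set Cover in time $O\big((2-\varepsilon)^{\mathrm{pw}}(n+m+1)^{O(1)}\big)$ if and only if the PP-SETH is false. The same equivalence holds for the decision version of Set Cover. -/

import Mathlib

/-! ## Random access machine with logarithmic cost

A program works on finitely many registers and finitely many arrays (those that it mentions),
each array being a memory with one cell for every natural number. Programs are structured; a
program with jumps is the same thing up to a constant factor (keep the program counter in a
register, inside one loop). Every elementary operation is charged the bit lengths of the numbers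
and addresses it touches, as in the usual logarithmic-cost random access machine. -/

namespace RAM

inductive Prog : Type
  | skip : Prog
  /-- `R x := v` -/
  | const (x v : ℕ) : Prog
  /-- `R x := R y + R z` -/
  | add (x y z : ℕ) : Prog
  /-- `R x := max (R y - R z) 0` -/
  | sub (x y z : ℕ) : Prog
  /-- `R x := A a [R y]` -/
  | load (x a y : ℕ) : Prog
  /-- `A a [R y] := R x` -/
  | store (a y x : ℕ) : Prog
  | seq (p q : Prog) : Prog
  /-- run `p` if `R x ≠ 0`, and `q` otherwise -/
  | branch (x : ℕ) (p q : Prog) : Prog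
  /-- while `R x ≠ 0`, run `p` -/
  | loop (x : ℕ) (p : Prog) : Prog

/-- A memory state: the registers, and the cells `mem a i` of the arrays. -/
structure State where
  reg : ℕ → ℕ
  mem : ℕ → ℕ → ℕ

def State.setReg (s : State) (x v : ℕ) : State :=
  { s with reg := Function.update s.reg x v }

def State.setMem (s : State) (a i v : ℕ) : State :=
  { s with mem := Function.update s.mem a (Function.update (s.mem a) i v) }

/-- `Exec p s s' t`: started in the state `s`, the program `p` halts in the state `s'` and its
running time is `t`. Here `Nat.size` is the length of the binary expansion. -/
inductive Exec : Prog → State → State → ℕ → Prop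
  | skip (s : State) : Exec Prog.skip s s 1
  | const (s : State) (x v : ℕ) :
      Exec (Prog.const x v) s (s.setReg x v) (1 + v.size)
  | add (s : State) (x y z : ℕ) :
      Exec (Prog.add x y z) s (s.setReg x (s.reg y + s.reg z))
        (1 + (s.reg y).size + (s.reg z).size)
  | sub (s : State) (x y z : ℕ) :
      Exec (Prog.sub x y z) s (s.setReg x (s.reg y - s.reg z))
        (1 + (s.reg y).size + (s.reg z).size)
  | load (s : State) (x a y : ℕ) :
      Exec (Prog.load x a y) s (s.setReg x (s.mem a (s.reg y)))
        (1 + (s.reg y).size + (s.mem a (s.reg y)).size)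
  | store (s : State) (a y x : ℕ) :
      Exec (Prog.store a y x) s (s.setMem a (s.reg y) (s.reg x))
        (1 + (s.reg y).size + (s.reg x).size)
  | seq {p q : Prog} {s s' s'' : State} {t t' : ℕ} :
      Exec p s s' t → Exec q s' s'' t' → Exec (Prog.seq p q) s s'' (t + t')
  | branch_true {x : ℕ} {p q : Prog} {s s' : State} {t : ℕ} :
      s.reg x ≠ 0 → Exec p s s' t →
        Exec (Prog.branch x p q) s s' (1 + (s.reg x).size + t)
  | branch_false {x : ℕ} {p q : Prog} {s s' : State} {t : ℕ} :
      s.reg x = 0 → Exec q s s' t →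
        Exec (Prog.branch x p q) s s' (1 + (s.reg x).size + t)
  | loop_true {x : ℕ} {p : Prog} {s s' s'' : State} {t t' : ℕ} :
      s.reg x ≠ 0 → Exec p s s' t → Exec (Prog.loop x p) s' s'' t' →
        Exec (Prog.loop x p) s s'' (1 + (s.reg x).size + t + t')
  | loop_false {x : ℕ} {p : Prog} {s : State} :
      s.reg x = 0 → Exec (Prog.loop x p) s s (1 + (s.reg x).size)

/-- The initial state: the input word is written in array `0`, everything else is `0`. -/
def init (w : List ℕ) : State where
  reg := fun _ => 0
  mem := fun a i => if a = 0 then w.getD i 0 else 0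

/-- There is one program that on every instance `x` of the problem, given through its encoding
`enc x`, halts within time `bound x` and leaves in array `1` a correct answer for `x`. -/
def SolvableInTime {X : Type} (enc : X → List ℕ) (correct : X → (ℕ → ℕ) → Prop)
    (bound : X → ℝ) : Prop :=
  ∃ p : Prog, ∀ x : X, ∃ (s : State) (t : ℕ),
    Exec p (init (enc x)) s t ∧ (t : ℝ) ≤ bound x ∧ correct x (s.mem 1)

end RAM

/-! ## Path decompositions -/

/-- The sequence of bags `B` is a path decomposition of the graph `G`. -/
structure IsPathDecomposition {V : Type} (G : SimpleGraph V) (B : List (Finset V)) : Prop where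
  vertex_mem : ∀ x : V, ∃ b ∈ B, x ∈ b
  edge_mem : ∀ x y : V, G.Adj x y → ∃ b ∈ B, x ∈ b ∧ y ∈ b
  interval : ∀ (x : V) (i j k : Fin B.length), i ≤ j → j ≤ k →
    x ∈ B.get i → x ∈ B.get k → x ∈ B.get j

/-- A path decomposition of `G` as it is supplied to an algorithm: every bag is a list of
vertices, in any order and without repetition, and two consecutive bags are different sets.
(Repeating a bag carries no information, and without such repetitions there are at most
`2 * |V| + 1` bags, so that the size of the input is polynomial in the number of vertices.) -/
structure PathDecomposition {V : Type} [DecidableEq V] (G : SimpleGraph V) where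
  bags : List (List V)
  nodup : ∀ b ∈ bags, b.Nodup
  isPathDecomposition : IsPathDecomposition G (bags.map List.toFinset)
  distinct : (bags.map List.toFinset).IsChain (fun b b' => b ≠ b')

/-- The maximum size of a bag, minus one. -/
def PathDecomposition.width {V : Type} [DecidableEq V] {G : SimpleGraph V}
    (D : PathDecomposition G) : ℕ :=
  (D.bags.map List.length).foldr max 0 - 1

/-- Encoding of a list of lists: the number of lists, and then for each of them its length and
its entries. -/
def encodeLists (L : List (List ℕ)) : List ℕ :=
  L.length :: L.flatMap (fun l => l.length :: l)

/-! ## 3-SAT and the hypothesis -/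

/-- A literal over the variables `0, …, n - 1`; the literal `(x, true)` is `x` and `(x, false)` is
the negation of `x`. -/
abbrev Literal (n : ℕ) : Type := Fin n × Bool

/-- A clause is the disjunction of its literals. -/
abbrev Clause (n : ℕ) : Type := List (Literal n)

/-- A CNF formula is the conjunction of its clauses. -/
abbrev CNF (n : ℕ) : Type := List (Clause n)

def CNF.Satisfiable {n : ℕ} (φ : CNF n) : Prop :=
  ∃ τ : Fin n → Bool, ∀ c ∈ φ, ∃ l ∈ c, τ l.1 = l.2

/-- Two distinct variables are adjacent if they appear together in some clause. -/
def CNF.primalGraph {n : ℕ} (φ : CNF n) : SimpleGraph (Fin n) :=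
  SimpleGraph.fromRel (fun x y => ∃ c ∈ φ, (∃ l ∈ c, l.1 = x) ∧ (∃ l ∈ c, l.1 = y))

/-- An instance of 3-SAT together with a path decomposition of its primal graph. -/
structure ThreeSatInstance where
  numVars : ℕ
  formula : CNF numVars
  formula_nodup : formula.Nodup
  arity_le : ∀ c ∈ formula, c.length ≤ 3
  decomp : PathDecomposition formula.primalGraph

def ThreeSatInstance.encode (I : ThreeSatInstance) : List ℕ :=
  I.numVars ::
    (encodeLists (I.formula.map (List.map (fun l => 2 * l.1.val + l.2.toNat))) ++
      encodeLists (I.decomp.bags.map (List.map (fun x => x.val))))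

/-- The first cell of the output is `1` if the formula is satisfiable, and `0` if it is not. -/
def ThreeSatInstance.Correct (I : ThreeSatInstance) (out : ℕ → ℕ) : Prop :=
  (I.formula.Satisfiable ∧ out 0 = 1) ∨ (¬ I.formula.Satisfiable ∧ out 0 = 0)

/-- 3-SAT can be solved in time `(2 - ε) ^ pw * n ^ O(1)`. -/
def ThreeSatSolvable (ε : ℝ) : Prop :=
  ∃ C c : ℕ, RAM.SolvableInTime ThreeSatInstance.encode ThreeSatInstance.Correct
    (fun I => C * (2 - ε) ^ I.decomp.width * ((I.numVars : ℝ) + 1) ^ c)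

/-- The Primal Pathwidth Strong Exponential Time Hypothesis. -/
def PPSETH : Prop :=
  ∀ ε : ℝ, 0 < ε → ε < 2 → ¬ ThreeSatSolvable ε

/-! ## Set Cover -/

/-- The incidence graph of a family of subsets of `{0, …, n - 1}`: the elements on one side, the
members of the family on the other. -/
def incidenceGraph {n : ℕ} (sets : List (List (Fin n))) :
    SimpleGraph (Fin n ⊕ Fin sets.length) :=
  SimpleGraph.fromRel (fun a b => ∃ (u : Fin n) (j : Fin sets.length),
    a = Sum.inl u ∧ b = Sum.inr j ∧ u ∈ sets.get j)

/-- A family of subsets of the universe `{0, …, numElements - 1}`, each of them listed without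
repetition, together with a path decomposition of the incidence graph. -/
structure SetCoverInstance where
  numElements : ℕ
  sets : List (List (Fin numElements))
  sets_nodup : ∀ S ∈ sets, S.Nodup
  decomp : PathDecomposition (incidenceGraph sets)

def SetCoverInstance.numSets (I : SetCoverInstance) : ℕ := I.sets.length

/-- The members of the family with indices in `T` cover the universe. -/
def SetCoverInstance.IsCover (I : SetCoverInstance) (T : Finset (Fin I.numSets)) : Prop :=
  ∀ u : Fin I.numElements, ∃ j ∈ T, u ∈ I.sets.get j

def SetCoverInstance.IsMinCover (I : SetCoverInstance) (T : Finset (Fin I.numSets)) : Prop :=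
  I.IsCover T ∧ ∀ T' : Finset (Fin I.numSets), I.IsCover T' → T.card ≤ T'.card

/-- In the bags, the element `u` is represented by the number `u`, and the `j`-th set by
`numElements + j`. -/
def SetCoverInstance.encode (I : SetCoverInstance) : List ℕ :=
  I.numElements ::
    (encodeLists (I.sets.map (List.map (fun u => u.val))) ++
      encodeLists (I.decomp.bags.map (List.map
        (Sum.elim (fun u => u.val) (fun j => I.numElements + j.val)))))

/-- The output is a cover of minimum cardinality, given as its cardinality plus one followed by the
indices of its members; it is `0` if there is no cover at all. -/
def SetCoverInstance.Correct (I : SetCoverInstance) (out : ℕ → ℕ) : Prop :=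
  ((¬ ∃ T, I.IsCover T) ∧ out 0 = 0) ∨
    ∃ l : List (Fin I.numSets), l.Nodup ∧ I.IsMinCover l.toFinset ∧
      out 0 = l.length + 1 ∧ ∀ i : Fin l.length, out (i.val + 1) = (l.get i).val

/-- A minimum cardinality cover can be found in time `(2 - ε) ^ pw * (n + m) ^ O(1)`. -/
def SetCoverSolvable (ε : ℝ) : Prop :=
  ∃ C c : ℕ, RAM.SolvableInTime SetCoverInstance.encode SetCoverInstance.Correct
    (fun I => C * (2 - ε) ^ I.decomp.width *
      ((I.numElements : ℝ) + (I.numSets : ℝ) + 1) ^ c)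

/-- An instance of the decision version: is there a cover with at most `target` members? -/
structure SetCoverDecisionInstance extends SetCoverInstance where
  target : ℕ
  target_le : target ≤ toSetCoverInstance.numSets

def SetCoverDecisionInstance.encode (I : SetCoverDecisionInstance) : List ℕ :=
  I.target :: I.toSetCoverInstance.encode

def SetCoverDecisionInstance.Yes (I : SetCoverDecisionInstance) : Prop :=
  ∃ T, I.toSetCoverInstance.IsCover T ∧ T.card ≤ I.target

def SetCoverDecisionInstance.Correct (I : SetCoverDecisionInstance) (out : ℕ → ℕ) : Prop :=
  (I.Yes ∧ out 0 = 1) ∨ (¬ I.Yes ∧ out 0 = 0)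

/-- The decision version can be solved in time `(2 - ε) ^ pw * (n + m) ^ O(1)`. -/
def SetCoverDecisionSolvable (ε : ℝ) : Prop :=
  ∃ C c : ℕ, RAM.SolvableInTime SetCoverDecisionInstance.encode SetCoverDecisionInstance.Correct
    (fun I => C * (2 - ε) ^ I.decomp.width *
      ((I.numElements : ℝ) + (I.toSetCoverInstance.numSets : ℝ) + 1) ^ c)

/-! Both equivalences follow from a cycle of reductions: a 3-SAT algorithm yields one for Set Cover
(`ThreeSatSolvable.setCover`), that one answers the decision version (`SetCoverSolvable.decision`),
and the decision version decides 3-SAT (`SetCoverDecisionSolvable.threeSat`). The width grows at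
most by an additive term logarithmic in the input size. Since `2 ^ O(log)` is polynomial, the base
`2 - ε` survives.

Both substantial reductions unroll the path decomposition in time (`Sweep`). A step visits a triple
(bag, item, element). The same element is visited again `X` steps later, and a link joins two
consecutive visits if the element lies in the bag at both. As an element occupies an interval of
bags, the links open at any time number at most one per element of the current bag, plus one
(`Sweep.Convex.card_links_le`). A `Counter` adds up one literal per step in binary, with `O(log)`
fresh variables in each step.

From Set Cover to 3-SAT: there is one variable for each set and, at each visit of an element, one
variable "covered so far", which is handed on along the links. The counter bounds the number of
chosen sets. A set or an element of the bag costs one variable, so the width is `pw + O(log)`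
(`CoverSweep.Valid.width_le`). A minimum cover is found by self-reduction: `m + 1` questions give
the optimum, and one more question per set builds the cover (`CoverSweep.Answers.output`).

From 3-SAT to Set Cover: the sets are the literals, the elements are the variables and the clauses,
and the budget is one set per variable. Done directly this puts three vertices per variable into a
bag. Instead every visit of a variable gets its own copy, which stays for two steps only.
Consecutive copies are tied by the single clause "old implies new", and this clause is the only
vertex kept during the link. The converse implication comes from the counter: a link contributes
[old false] + [new true], which is at least one because of the clause, and the total may not exceed
the number of links. So every contribution equals one and all copies agree
(`ClauseSweep.Valid.models_of_sat`).

The machine side is `RAM.SolvableInTime.of_queries`: a solver may be called polynomially often on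
words computed from the input and the earlier answers. -/

/-! ## Polynomial bounds -/

/-- The function `g` is bounded by a polynomial. -/
def PolyBounded (g : ℕ → ℕ) : Prop := ∃ c : ℕ, ∀ M, g M ≤ (M + 2) ^ c

namespace PolyBounded

theorem const (n : ℕ) : PolyBounded (fun _ => n) :=
  ⟨n, fun M => (Nat.lt_two_pow_self (n := n)).le.trans (Nat.pow_le_pow_left (by omega) n)⟩

theorem id : PolyBounded (fun M => M) := ⟨1, fun M => by simp⟩

theorem add {f g : ℕ → ℕ} (hf : PolyBounded f) (hg : PolyBounded g) :
    PolyBounded (fun M => f M + g M) := by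
  obtain ⟨a, ha⟩ := hf
  obtain ⟨b, hb⟩ := hg
  refine ⟨a + b + 1, fun M => ?_⟩
  have h1 : (M + 2) ^ a ≤ (M + 2) ^ (a + b) := Nat.pow_le_pow_right (by omega) (by omega)
  have h2 : (M + 2) ^ b ≤ (M + 2) ^ (a + b) := Nat.pow_le_pow_right (by omega) (by omega)
  calc f M + g M ≤ (M + 2) ^ (a + b) + (M + 2) ^ (a + b) :=
        add_le_add ((ha M).trans h1) ((hb M).trans h2)
    _ = (M + 2) ^ (a + b) * 2 := by ring
    _ ≤ (M + 2) ^ (a + b) * (M + 2) := Nat.mul_le_mul_left _ (by omega)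
    _ = (M + 2) ^ (a + b + 1) := by ring

theorem mul {f g : ℕ → ℕ} (hf : PolyBounded f) (hg : PolyBounded g) :
    PolyBounded (fun M => f M * g M) := by
  obtain ⟨a, ha⟩ := hf
  obtain ⟨b, hb⟩ := hg
  refine ⟨a + b, fun M => ?_⟩
  rw [pow_add]
  exact Nat.mul_le_mul (ha M) (hb M)

theorem comp {f g : ℕ → ℕ} (hf : PolyBounded f) (hg : PolyBounded g) :
    PolyBounded (fun M => f (g M)) := by
  obtain ⟨a, ha⟩ := hf
  obtain ⟨b, hb⟩ := hg
  refine ⟨(b + 2) * a, fun M => (ha _).trans ?_⟩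
  rw [pow_mul]
  refine Nat.pow_le_pow_left ?_ a
  have h1 : 1 ≤ (M + 2) ^ b := Nat.one_le_pow _ _ (by omega)
  calc g M + 2 ≤ (M + 2) ^ b + 2 := by have := hb M; omega
    _ ≤ (M + 2) ^ b * 4 := by omega
    _ ≤ (M + 2) ^ b * (M + 2) ^ 2 := Nat.mul_le_mul_left _ (Nat.pow_le_pow_left (show 2 ≤ M + 2 by omega) 2)
    _ = (M + 2) ^ (b + 2) := by ring

theorem pow {f : ℕ → ℕ} (hf : PolyBounded f) (k : ℕ) : PolyBounded (fun M => f M ^ k) := by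
  induction k with
  | zero => simpa using const 1
  | succ k ih => simpa [pow_succ] using ih.mul hf

end PolyBounded

/-! ### Functions computable in time polynomial in the largest number that occurs (not in its
length) -/

namespace RAM

theorem size_le_self (n : ℕ) : n.size ≤ n := Nat.size_le.2 Nat.lt_two_pow_self

@[simp] theorem setReg_reg (s : State) (x v y : ℕ) :
    (s.setReg x v).reg y = if y = x then v else s.reg y := by
  simp [State.setReg, Function.update_apply]

@[simp] theorem setReg_mem (s : State) (x v : ℕ) : (s.setReg x v).mem = s.mem := rfl

@[simp] theorem setMem_reg (s : State) (a i v : ℕ) : (s.setMem a i v).reg = s.reg := rfl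

theorem setMem_mem (s : State) (a i v a' i' : ℕ) :
    (s.setMem a i v).mem a' i' = if a' = a ∧ i' = i then v else s.mem a' i' := by
  by_cases h : a' = a
  · subst h; by_cases h' : i' = i <;> simp [State.setMem, h']
  · simp [State.setMem, h]

theorem setMem_mem_of_ne (s : State) {a a' : ℕ} (i v : ℕ) (h : a' ≠ a) :
    (s.setMem a i v).mem a' = s.mem a' := by
  simp [State.setMem, h]

/-- A loop whose counter register runs through `n, n - 1, …, 0`. -/
theorem exec_loop {x : ℕ} {p : Prog} {I : ℕ → State → Prop} {T n : ℕ}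
    (hx : ∀ i s, i ≤ n → I i s → s.reg x = n - i)
    (hstep : ∀ i s, i < n → I i s → ∃ s' t, Exec p s s' t ∧ I (i + 1) s' ∧ t ≤ T)
    (s : State) (hs : I 0 s) :
    ∃ s' t, Exec (Prog.loop x p) s s' t ∧ I n s' ∧ t ≤ (n + 1) * (1 + n + T) := by
  have key : ∀ d i s, i + d = n → I i s →
      ∃ s' t, Exec (Prog.loop x p) s s' t ∧ I n s' ∧ t ≤ (d + 1) * (1 + n + T) := by
    intro d
    induction d with
    | zero =>
      intro i s hi hI
      have h0 : s.reg x = 0 := by rw [hx i s (by omega) hI]; omega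
      refine ⟨s, _, Exec.loop_false h0, by simpa [← hi] using hI, ?_⟩
      simp [h0]; omega
    | succ d ih =>
      intro i s hi hI
      have h0 : s.reg x = n - i := hx i s (by omega) hI
      obtain ⟨s1, t1, he1, hI1, ht1⟩ := hstep i s (by omega) hI
      obtain ⟨s2, t2, he2, hI2, ht2⟩ := ih (i + 1) s1 (by omega) hI1
      refine ⟨s2, _, Exec.loop_true (by omega) he1 he2, hI2, ?_⟩
      have := size_le_self (s.reg x)
      have e : (d + 1 + 1) * (1 + n + T) = (1 + n + T) + (d + 1) * (1 + n + T) := by ring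
      omega
  exact key n 0 s (by omega) hs

/-- A function of the arrays `0` and `2` and of an environment of variables. -/
abbrev Fn : Type := (ℕ → ℕ) → (ℕ → ℕ) → (ℕ → ℕ) → ℕ

/-- All cells and variables are at most `M`. -/
def Below (M : ℕ) (w v e : ℕ → ℕ) : Prop := (∀ i, w i ≤ M) ∧ (∀ i, v i ≤ M) ∧ ∀ i, e i ≤ M

theorem Below.mono {M N : ℕ} {w v e : ℕ → ℕ} (h : Below M w v e) (hMN : M ≤ N) :
    Below N w v e :=
  ⟨fun i => (h.1 i).trans hMN, fun i => (h.2.1 i).trans hMN, fun i => (h.2.2 i).trans hMN⟩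

/-- The environment `e` extended by a new variable with number `0`. -/
def push (a : ℕ) (e : ℕ → ℕ) : ℕ → ℕ
  | 0 => a
  | k + 1 => e k

theorem Below.push {M : ℕ} {w v e : ℕ → ℕ} (h : Below M w v e) {a : ℕ} (ha : a ≤ M) :
    Below M w v (push a e) :=
  ⟨h.1, h.2.1, fun i => by cases i with
    | zero => exact ha
    | succ k => exact h.2.2 k⟩

/-- The program `p` evaluates `f` within time `B`: the variable `k` is kept in the register `ρ k`,
the result goes to the register `b`, registers below `b` and all arrays are preserved. -/
def Evaluates (f : Fn) (B : ℕ → ℕ) (ρ : ℕ → ℕ) (b : ℕ) (p : Prog) : Prop :=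
  ∀ (s : State) (M : ℕ), Below M (s.mem 0) (s.mem 2) (fun k => s.reg (ρ k)) →
    ∃ s' t, Exec p s s' t ∧ s'.mem = s.mem ∧ (∀ r < b, s'.reg r = s.reg r) ∧
      s'.reg b = f (s.mem 0) (s.mem 2) (fun k => s.reg (ρ k)) ∧ t ≤ B M

/-- Functions that are computed in polynomial time and have polynomially bounded values. -/
def PolyComputable (f : Fn) : Prop :=
  ∃ B, PolyBounded B ∧ (∀ M w v e, Below M w v e → f w v e ≤ B M) ∧
    ∀ ρ b, (∀ k, ρ k < b) → ∃ p, Evaluates f B ρ b p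

namespace PolyComputable

theorem var (k : ℕ) : PolyComputable (fun _ _ e => e k) := by
  refine ⟨fun M => M + 2, PolyBounded.id.add (.const 2), fun M w v e h => ?_, fun ρ b hρ => ?_⟩
  · have := h.2.2 k; beta_reduce; omega
  · have h2 := hρ k
    -- There is no copy instruction; a register is copied by adding it to zero.
    refine ⟨.seq (.const b 0) (.add b b (ρ k)), fun s M hM =>
      ⟨_, _, Exec.seq (.const ..) (.add ..), rfl, ?_, ?_, ?_⟩⟩
    · intro r hr; simp [hr.ne]
    · simp [h2.ne]
    · have h1 := hM.2.2 k
      have h3 := size_le_self (s.reg (ρ k))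
      simp [h2.ne] at h1 ⊢; omega

theorem const (n : ℕ) : PolyComputable (fun _ _ _ => n) := by
  refine ⟨fun M => n + 1, .const _, fun M w v e h => by simp, fun ρ b hρ => ?_⟩
  refine ⟨.const b n, fun s M hM => ⟨_, _, .const .., rfl, ?_, by simp, ?_⟩⟩
  · intro r hr; simp [hr.ne]
  · have := size_le_self n; beta_reduce; omega

theorem add {f g : Fn} (hf : PolyComputable f) (hg : PolyComputable g) :
    PolyComputable (fun w v e => f w v e + g w v e) := by
  obtain ⟨Bf, hBf, hfB, hf⟩ := hf
  obtain ⟨Bg, hBg, hgB, hg⟩ := hg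
  refine ⟨fun M => 2 * Bf M + 2 * Bg M + 1,
    (((PolyBounded.const 2).mul hBf).add ((PolyBounded.const 2).mul hBg)).add (.const 1),
    fun M w v e h => ?_, fun ρ b hρ => ?_⟩
  · have := hfB M w v e h; have := hgB M w v e h; beta_reduce; omega
  · obtain ⟨p, hp⟩ := hf ρ b hρ
    obtain ⟨p', hp'⟩ := hg ρ (b + 1) (fun k => (hρ k).trans (by omega))
    refine ⟨.seq p (.seq p' (.add b b (b + 1))), fun s M hM => ?_⟩
    obtain ⟨s1, t1, he1, hm1, hr1, hv1, ht1⟩ := hp s M hM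
    have henv : (fun k => s1.reg (ρ k)) = fun k => s.reg (ρ k) :=
      funext fun k => hr1 _ (hρ k)
    obtain ⟨s2, t2, he2, hm2, hr2, hv2, ht2⟩ := hp' s1 M (by rwa [henv, hm1])
    rw [henv, hm1] at hv2
    have hb := hr2 b (by omega)
    refine ⟨_, _, .seq he1 (.seq he2 (.add ..)), by simp [hm2, hm1], ?_, ?_, ?_⟩
    · intro r hr
      simp [hr.ne, hr2 r (by omega), hr1 r hr]
    · simp [hb, hv1, hv2]
    · have h3 := hfB M _ _ _ hM
      have h4 := hgB M _ _ _ hM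
      have h5 := size_le_self (s2.reg b)
      have h6 := size_le_self (s2.reg (b + 1))
      beta_reduce
      omega

theorem sub {f g : Fn} (hf : PolyComputable f) (hg : PolyComputable g) :
    PolyComputable (fun w v e => f w v e - g w v e) := by
  obtain ⟨Bf, hBf, hfB, hf⟩ := hf
  obtain ⟨Bg, hBg, hgB, hg⟩ := hg
  refine ⟨fun M => 2 * Bf M + 2 * Bg M + 1,
    (((PolyBounded.const 2).mul hBf).add ((PolyBounded.const 2).mul hBg)).add (.const 1),
    fun M w v e h => ?_, fun ρ b hρ => ?_⟩
  · have := hfB M w v e h; have := hgB M w v e h; beta_reduce; omega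
  · obtain ⟨p, hp⟩ := hf ρ b hρ
    obtain ⟨p', hp'⟩ := hg ρ (b + 1) (fun k => (hρ k).trans (by omega))
    refine ⟨.seq p (.seq p' (.sub b b (b + 1))), fun s M hM => ?_⟩
    obtain ⟨s1, t1, he1, hm1, hr1, hv1, ht1⟩ := hp s M hM
    have henv : (fun k => s1.reg (ρ k)) = fun k => s.reg (ρ k) :=
      funext fun k => hr1 _ (hρ k)
    obtain ⟨s2, t2, he2, hm2, hr2, hv2, ht2⟩ := hp' s1 M (by rwa [henv, hm1])
    rw [henv, hm1] at hv2
    have hb := hr2 b (by omega)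
    refine ⟨_, _, .seq he1 (.seq he2 (.sub ..)), by simp [hm2, hm1], ?_, ?_, ?_⟩
    · intro r hr
      simp [hr.ne, hr2 r (by omega), hr1 r hr]
    · simp [hb, hv1, hv2]
    · have h3 := hfB M _ _ _ hM
      have h4 := hgB M _ _ _ hM
      have h5 := size_le_self (s2.reg b)
      have h6 := size_le_self (s2.reg (b + 1))
      beta_reduce
      omega

theorem inp {f : Fn} (hf : PolyComputable f) : PolyComputable (fun w v e => w (f w v e)) := by
  obtain ⟨Bf, hBf, hfB, hf⟩ := hf
  refine ⟨fun M => 2 * Bf M + M + 1,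
    (((PolyBounded.const 2).mul hBf).add .id).add (.const 1),
    fun M w v e h => (h.1 _).trans (by beta_reduce; omega), fun ρ b hρ => ?_⟩
  obtain ⟨p, hp⟩ := hf ρ b hρ
  refine ⟨.seq p (.load b 0 b), fun s M hM => ?_⟩
  obtain ⟨s1, t1, he1, hm1, hr1, hv1, ht1⟩ := hp s M hM
  refine ⟨_, _, .seq he1 (.load ..), by simp [hm1], ?_, ?_, ?_⟩
  · intro r hr
    simp [hr.ne, hr1 r hr]
  · simp [hv1, hm1]
  · have h3 := hfB M _ _ _ hM
    have h4 := hM.1 (s1.reg b)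
    have h5 := size_le_self (s1.reg b)
    have h6 := size_le_self (s.mem 0 (s1.reg b))
    rw [hm1]
    beta_reduce
    omega

theorem ans {f : Fn} (hf : PolyComputable f) : PolyComputable (fun w v e => v (f w v e)) := by
  obtain ⟨Bf, hBf, hfB, hf⟩ := hf
  refine ⟨fun M => 2 * Bf M + M + 1,
    (((PolyBounded.const 2).mul hBf).add .id).add (.const 1),
    fun M w v e h => (h.2.1 _).trans (by beta_reduce; omega), fun ρ b hρ => ?_⟩
  obtain ⟨p, hp⟩ := hf ρ b hρ
  refine ⟨.seq p (.load b 2 b), fun s M hM => ?_⟩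
  obtain ⟨s1, t1, he1, hm1, hr1, hv1, ht1⟩ := hp s M hM
  refine ⟨_, _, .seq he1 (.load ..), by simp [hm1], ?_, ?_, ?_⟩
  · intro r hr
    simp [hr.ne, hr1 r hr]
  · simp [hv1, hm1]
  · have h3 := hfB M _ _ _ hM
    have h4 := hM.2.1 (s1.reg b)
    have h5 := size_le_self (s1.reg b)
    have h6 := size_le_self (s.mem 2 (s1.reg b))
    rw [hm1]
    beta_reduce
    omega

/-- A substitution of variables needs no code: it only changes the map from variables to registers.
-/
theorem rename {f : Fn} (hf : PolyComputable f) (σ : ℕ → ℕ) :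
    PolyComputable (fun w v e => f w v (fun k => e (σ k))) := by
  obtain ⟨Bf, hBf, hfB, hf⟩ := hf
  refine ⟨Bf, hBf, fun M w v e h => hfB M _ _ _ ⟨h.1, h.2.1, fun i => h.2.2 _⟩,
    fun ρ b hρ => ?_⟩
  obtain ⟨p, hp⟩ := hf (fun k => ρ (σ k)) b (fun k => hρ _)
  exact ⟨p, fun s M h => hp s M ⟨h.1, h.2.1, fun i => h.2.2 _⟩⟩

/-- Local definition: the value of `f` stays in the register `b`, which serves as variable `0` while
`g` is evaluated above it. -/
theorem bind {f g : Fn} (hf : PolyComputable f) (hg : PolyComputable g) :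
    PolyComputable (fun w v e => g w v (push (f w v e) e)) := by
  obtain ⟨Bf, hBf, hfB, hf⟩ := hf
  obtain ⟨Bg, hBg, hgB, hg⟩ := hg
  refine ⟨fun M => Bf M + 2 * Bg (M + Bf M) + 2,
    (hBf.add ((PolyBounded.const 2).mul (hBg.comp (PolyBounded.id.add hBf)))).add (.const 2),
    fun M w v e h => ?_, fun ρ b hρ => ?_⟩
  · have h1 := hfB M w v e h
    have := hgB (M + Bf M) w v (push (f w v e) e) ((h.mono (by omega)).push (by omega))
    beta_reduce
    omega
  · obtain ⟨p, hp⟩ := hf ρ b hρ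
    obtain ⟨p', hp'⟩ := hg (push b ρ) (b + 1) (fun k => by
      cases k with
      | zero => simp [push]
      | succ k => exact (hρ k).trans (by omega))
    refine ⟨.seq p (.seq p' (.seq (.const b 0) (.add b b (b + 1)))), fun s M hM => ?_⟩
    obtain ⟨s1, t1, he1, hm1, hr1, hv1, ht1⟩ := hp s M hM
    have h3 := hfB M _ _ _ hM
    have hM' : Below (M + Bf M) (s.mem 0) (s.mem 2) (push (f (s.mem 0) (s.mem 2)
      fun k => s.reg (ρ k)) fun k => s.reg (ρ k)) := (hM.mono (by omega)).push (by omega)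
    have henv : (fun k => s1.reg (push b ρ k)) = push (f (s.mem 0) (s.mem 2)
        fun k => s.reg (ρ k)) fun k => s.reg (ρ k) :=
      funext fun k => by cases k with
        | zero => exact hv1
        | succ k => exact hr1 _ (hρ k)
    obtain ⟨s2, t2, he2, hm2, hr2, hv2, ht2⟩ := hp' s1 _ (by rw [henv, hm1]; exact hM')
    rw [henv, hm1] at hv2
    refine ⟨_, _, .seq he1 (.seq he2 (.seq (.const ..) (.add ..))), by simp [hm2, hm1], ?_, ?_, ?_⟩
    · intro r hr
      simp [hr.ne, hr2 r (by omega), hr1 r hr]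
    · simp [hv2]
    · have h4 := hgB _ _ _ _ hM'
      have h6 := size_le_self (s2.reg (b + 1))
      simp
      omega

/-- Primitive recursion. The bound `hacc` on all intermediate values is indispensable, since
iterated doubling would leave the class. In `hg` the accumulator is variable `0` and the index is
variable `1`. -/
theorem iter {n a : Fn} {g : (ℕ → ℕ) → (ℕ → ℕ) → (ℕ → ℕ) → ℕ → ℕ → ℕ}
    (hn : PolyComputable n) (ha : PolyComputable a)
    (hg : PolyComputable (fun w v e => g w v (fun k => e (k + 2)) (e 1) (e 0)))
    {B : ℕ → ℕ} (hB : PolyBounded B)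
    (hacc : ∀ M w v e, Below M w v e → ∀ i ≤ n w v e,
      (Nat.rec (a w v e) (g w v e) i : ℕ) ≤ B M) :
    PolyComputable (fun w v e => (Nat.rec (a w v e) (g w v e) (n w v e) : ℕ)) := by
  obtain ⟨Bn, hBn, hnB, hn⟩ := hn
  obtain ⟨Ba, hBa, haB, ha⟩ := ha
  obtain ⟨Bg, hBg, hgB, hg⟩ := hg
  let N : ℕ → ℕ := fun M => M + Bn M + B M
  have hN : PolyBounded N := (PolyBounded.id.add hBn).add hB
  let T : ℕ → ℕ := fun M => 2 * Bg (N M) + 2 * B M + 2 * Bn M + 20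
  have hT : PolyBounded T := ((((PolyBounded.const 2).mul (hBg.comp hN)).add
    ((PolyBounded.const 2).mul hB)).add ((PolyBounded.const 2).mul hBn)).add (.const 20)
  refine ⟨fun M => Bn M + Ba M + B M + (Bn M + 1) * (1 + Bn M + T M) + 10,
    (((hBn.add hBa).add hB).add ((hBn.add (.const 1)).mul
      (((PolyBounded.const 1).add hBn).add hT))).add (.const 10),
    fun M w v e h => (hacc M w v e h _ le_rfl).trans (by beta_reduce; omega), fun ρ b hρ => ?_⟩
  obtain ⟨p, hp⟩ := hn ρ b hρ
  obtain ⟨p', hp'⟩ := ha ρ (b + 1) (fun k => (hρ k).trans (by omega))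
  obtain ⟨pg, hpg⟩ := hg (push (b + 1) (push (b + 2) ρ)) (b + 4) (fun k => by
    rcases k with _ | _ | k
    · simp [push]
    · simp [push]
    · exact (hρ k).trans (by omega))
  -- Register `b` counts down, `b + 1` holds the accumulator, `b + 2` the index and `b + 3` the
  -- constant one; `g` is evaluated from `b + 4` on. After the loop `b` is zero, so the last
  -- addition moves the accumulator there.
  refine ⟨.seq p (.seq p' (.seq (.const (b + 2) 0) (.seq (.const (b + 3) 1)
    (.seq (.loop b (.seq pg (.seq (.const (b + 1) 0) (.seq (.add (b + 1) (b + 1) (b + 4))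
      (.seq (.add (b + 2) (b + 2) (b + 3)) (.sub b b (b + 3)))))))
      (.add b b (b + 1)))))), fun s M hM => ?_⟩
  obtain ⟨s1, t1, he1, hm1, hr1, hv1, ht1⟩ := hp s M hM
  have henv : (fun k => s1.reg (ρ k)) = fun k => s.reg (ρ k) := funext fun k => hr1 _ (hρ k)
  obtain ⟨s2, t2, he2, hm2, hr2, hv2, ht2⟩ := hp' s1 M (by rwa [henv, hm1])
  rw [henv, hm1] at hv2
  set w := s.mem 0 with hw
  set v := s.mem 2 with hv
  set e : ℕ → ℕ := fun k => s.reg (ρ k) with he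
  have hnM := hnB M _ _ _ hM
  let acc : ℕ → ℕ := fun i => Nat.rec (a w v e) (g w v e) i
  have haccM : ∀ i ≤ n w v e, acc i ≤ B M := hacc M w v e hM
  have hb2 : s2.reg b = n w v e := by rw [hr2 b (by omega), hv1]
  let I : ℕ → State → Prop := fun i σ => σ.mem = s.mem ∧ (∀ r < b, σ.reg r = s.reg r) ∧
    σ.reg b = n w v e - i ∧ σ.reg (b + 1) = acc i ∧ σ.reg (b + 2) = i ∧ σ.reg (b + 3) = 1
  obtain ⟨s4, t4, he4, ⟨hm4, hr4, hb0, hb1, hb2', hb3⟩, ht4⟩ := exec_loop (x := b) (I := I)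
    (T := T M) (n := n w v e) (p := .seq pg (.seq (.const (b + 1) 0) (.seq (.add (b + 1) (b + 1)
      (b + 4)) (.seq (.add (b + 2) (b + 2) (b + 3)) (.sub b b (b + 3))))))
    (fun i σ _ h => h.2.2.1) (by
      intro i σ hi ⟨hm, hr, hb0, hb1, hb2, hb3⟩
      have ha1 := haccM i (by omega)
      have ha2 := haccM (i + 1) (by omega)
      have hM' : Below (N M) w v (push (acc i) (push i e)) := by
        refine ((hM.mono ?_).push ?_).push ?_ <;> simp only [N] <;> omega
      have henv : (fun k => σ.reg (push (b + 1) (push (b + 2) ρ) k)) =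
          push (acc i) (push i e) :=
        funext fun k => by
          rcases k with _ | _ | k
          · exact hb1
          · exact hb2
          · exact hr _ (hρ k)
      obtain ⟨s3, t3, he3, hm3, hr3, hv3, ht3⟩ := hpg σ (N M) (by rw [henv, hm]; exact hM')
      rw [henv, hm] at hv3
      have hv3' : s3.reg (b + 4) = acc (i + 1) := hv3
      have e0 := hr3 b (by omega)
      have e1 := hr3 (b + 1) (by omega)
      have e2 := hr3 (b + 2) (by omega)
      have e3 := hr3 (b + 3) (by omega)
      refine ⟨_, _, .seq he3 (.seq (.const ..) (.seq (.add ..) (.seq (.add ..) (.sub ..)))),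
        ⟨by simp [hm3, hm], fun r hr' => ?_, ?_, ?_, ?_, ?_⟩, ?_⟩
      · have h1 : r ≠ b := by omega
        have h2 : r ≠ b + 1 := by omega
        have h3 : r ≠ b + 2 := by omega
        simp [h1, h2, h3, hr3 r (by omega), hr r hr']
      · simp [e0, e3, hb0, hb3]; omega
      · simp [hv3']
      · simp [e2, e3, hb2, hb3]
      · simp [e3, hb3]
      · have h6 := size_le_self (acc (i + 1))
        have h7 := size_le_self i
        have h8 := size_le_self (n w v e - i)
        simp [e0, e2, e3, hb0, hb2, hb3, hv3', T]
        omega)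
    ((s2.setReg (b + 2) 0).setReg (b + 3) 1) (by
      refine ⟨by simp [hm2, hm1], fun r hr => ?_, ?_, ?_, ?_, ?_⟩
      · have h2 : r ≠ b + 2 := by omega
        have h3 : r ≠ b + 3 := by omega
        simp [h2, h3, hr2 r (by omega), hr1 r hr]
      all_goals simp [hb2, hv2, acc])
  refine ⟨_, _, .seq he1 (.seq he2 (.seq (.const ..) (.seq (.const ..) (.seq he4 (.add ..))))),
    by simp [hm4], ?_, ?_, ?_⟩
  · intro r hr
    simp [hr.ne, hr4 r hr]
  · simp [hb0, hb1, acc]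
  · have ha1 := haccM _ le_rfl
    have h5 : (n w v e + 1) * (1 + n w v e + T M) ≤ (Bn M + 1) * (1 + Bn M + T M) :=
      Nat.mul_le_mul (by omega) (by omega)
    have h6 := size_le_self (acc (n w v e))
    simp [hb0, hb1]
    omega

end PolyComputable

end RAM

/-! ### Arithmetic and decidable predicates -/

namespace RAM

namespace PolyComputable

theorem of_eq {f g : Fn} (hf : PolyComputable f) (h : ∀ w v e, f w v e = g w v e) :
    PolyComputable g := by
  have : f = g := by funext w v e; exact h w v e
  exact this ▸ hf

theorem tail {f : Fn} (hf : PolyComputable f) :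
    PolyComputable (fun w v e => f w v (fun k => e (k + 1))) :=
  hf.rename (fun k => k + 1)

theorem comp₂ {h : (ℕ → ℕ) → (ℕ → ℕ) → ℕ → ℕ → ℕ} {f g : Fn}
    (hh : PolyComputable (fun w v e => h w v (e 0) (e 1))) (hf : PolyComputable f)
    (hg : PolyComputable g) :
    PolyComputable (fun w v e => h w v (f w v e) (g w v e)) :=
  hg.bind (hf.tail.bind hh)

/-- The bound of the values of a polynomially computable function. -/
theorem exists_bound {f : Fn} (hf : PolyComputable f) :
    ∃ B, PolyBounded B ∧ ∀ M w v e, Below M w v e → f w v e ≤ B M := by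
  obtain ⟨B, h1, h2, -⟩ := hf
  exact ⟨B, h1, h2⟩

theorem sum {n : Fn} {g : (ℕ → ℕ) → (ℕ → ℕ) → (ℕ → ℕ) → ℕ → ℕ} (hn : PolyComputable n)
    (hg : PolyComputable (fun w v e => g w v (fun k => e (k + 1)) (e 0))) :
    PolyComputable (fun w v e => ∑ i ∈ Finset.range (n w v e), g w v e i) := by
  have hrec : ∀ (w v e : ℕ → ℕ) (m : ℕ),
      (Nat.rec 0 (fun i acc => acc + g w v e i) m : ℕ) = ∑ i ∈ Finset.range m, g w v e i := by
    intro w v e m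
    induction m with
    | zero => rfl
    | succ m ih => rw [Finset.sum_range_succ, ← ih]
  obtain ⟨Bn, hBn, hnB⟩ := hn.exists_bound
  obtain ⟨Bg, hBg, hgB⟩ := hg.exists_bound
  refine (iter (a := fun _ _ _ => 0) (g := fun w v e i acc => acc + g w v e i)
    (B := fun M => Bn M * Bg (M + Bn M)) hn (.const 0) ?_
    (hBn.mul (hBg.comp (PolyBounded.id.add hBn))) ?_).of_eq fun w v e => hrec ..
  · exact (var 0).add (hg.rename (fun k => k + 1))
  · intro M w v e h i hi
    rw [hrec]
    have h1 := hnB M w v e h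
    calc ∑ j ∈ Finset.range i, g w v e j ≤ ∑ j ∈ Finset.range i, Bg (M + Bn M) := by
          refine Finset.sum_le_sum fun j hj => ?_
          have hj := Finset.mem_range.1 hj
          exact hgB _ w v (push j e) ((h.mono (by omega)).push (by omega))
      _ = i * Bg (M + Bn M) := by simp
      _ ≤ _ := Nat.mul_le_mul_right _ (by omega)

theorem mul {f g : Fn} (hf : PolyComputable f) (hg : PolyComputable g) :
    PolyComputable (fun w v e => f w v e * g w v e) :=
  (sum (g := fun w v e _ => g w v e) hf hg.tail).of_eq fun w v e => by simp

end PolyComputable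

open Classical in
/-- Predicates that are decided in polynomial time. -/
def PolyDecidable (p : (ℕ → ℕ) → (ℕ → ℕ) → (ℕ → ℕ) → Prop) : Prop :=
  PolyComputable (fun w v e => if p w v e then 1 else 0)

/-- Both branches are evaluated and combined arithmetically, which is harmless because both are
total and polynomially bounded. -/
theorem PolyComputable.ite {p : (ℕ → ℕ) → (ℕ → ℕ) → (ℕ → ℕ) → Prop} {f g : Fn}
    [∀ w v e, Decidable (p w v e)]
    (hp : PolyDecidable p) (hf : PolyComputable f) (hg : PolyComputable g) :
    PolyComputable (fun w v e => if p w v e then f w v e else g w v e) :=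
  ((hp.mul hf).add (((PolyComputable.const 1).sub hp).mul hg)).of_eq fun w v e => by
    by_cases h : p w v e <;> simp [h]

namespace PolyDecidable

theorem of_iff {p q : (ℕ → ℕ) → (ℕ → ℕ) → (ℕ → ℕ) → Prop} (hp : PolyDecidable p)
    (h : ∀ w v e, p w v e ↔ q w v e) : PolyDecidable q := by
  have : p = q := by funext w v e; exact propext (h w v e)
  exact this ▸ hp

theorem lt {f g : Fn} (hf : PolyComputable f) (hg : PolyComputable g) :
    PolyDecidable (fun w v e => f w v e < g w v e) :=
  ((PolyComputable.const 1).sub ((PolyComputable.const 1).sub (hg.sub hf))).of_eq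
    fun w v e => by split_ifs <;> omega

theorem not {p : (ℕ → ℕ) → (ℕ → ℕ) → (ℕ → ℕ) → Prop} (hp : PolyDecidable p) :
    PolyDecidable (fun w v e => ¬ p w v e) :=
  ((PolyComputable.const 1).sub hp).of_eq fun w v e => by by_cases h : p w v e <;> simp [h]

theorem and {p q : (ℕ → ℕ) → (ℕ → ℕ) → (ℕ → ℕ) → Prop} (hp : PolyDecidable p)
    (hq : PolyDecidable q) : PolyDecidable (fun w v e => p w v e ∧ q w v e) :=
  (PolyComputable.mul hp hq).of_eq fun w v e => by split_ifs <;> simp_all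

theorem or {p q : (ℕ → ℕ) → (ℕ → ℕ) → (ℕ → ℕ) → Prop} (hp : PolyDecidable p)
    (hq : PolyDecidable q) : PolyDecidable (fun w v e => p w v e ∨ q w v e) :=
  (hp.not.and hq.not).not.of_iff fun w v e => by tauto

theorem le {f g : Fn} (hf : PolyComputable f) (hg : PolyComputable g) :
    PolyDecidable (fun w v e => f w v e ≤ g w v e) :=
  (lt hg hf).not.of_iff fun w v e => by omega

theorem eq {f g : Fn} (hf : PolyComputable f) (hg : PolyComputable g) :
    PolyDecidable (fun w v e => f w v e = g w v e) :=
  ((le hf hg).and (le hg hf)).of_iff fun w v e => by omega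

theorem exists_lt {n : Fn} {p : (ℕ → ℕ) → (ℕ → ℕ) → (ℕ → ℕ) → ℕ → Prop} (hn : PolyComputable n)
    (hp : PolyDecidable (fun w v e => p w v (fun k => e (k + 1)) (e 0))) :
    PolyDecidable (fun w v e => ∃ i < n w v e, p w v e i) := by
  classical
  refine (lt (.const 0) (PolyComputable.sum (g := fun w v e i => if p w v e i then 1 else 0) hn
    (PolyComputable.of_eq hp fun w v e => by congr))).of_iff fun w v e => ?_
  simp only [Finset.sum_pos_iff, Finset.mem_range]
  refine exists_congr fun i => and_congr_right fun _ => ?_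
  split_ifs <;> simp_all

theorem forall_lt {n : Fn} {p : (ℕ → ℕ) → (ℕ → ℕ) → (ℕ → ℕ) → ℕ → Prop} (hn : PolyComputable n)
    (hp : PolyDecidable (fun w v e => p w v (fun k => e (k + 1)) (e 0))) :
    PolyDecidable (fun w v e => ∀ i < n w v e, p w v e i) :=
  (exists_lt (p := fun w v e i => ¬ p w v e i) hn hp.not).not.of_iff fun w v e => by
    push Not; rfl

end PolyDecidable

namespace PolyComputable

/-- The quotient is a count: the number of positive multiples of the divisor that do not exceed the
dividend. -/
theorem div {f g : Fn} (hf : PolyComputable f) (hg : PolyComputable g) :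
    PolyComputable (fun w v e => f w v e / g w v e) := by
  classical
  refine (sum (g := fun w v e i => if 0 < g w v e ∧ (i + 1) * g w v e ≤ f w v e then 1 else 0) hf
    (ite ((PolyDecidable.lt (.const 0) hg.tail).and
      (.le (((var 0).add (.const 1)).mul hg.tail) hf.tail)) (.const 1) (.const 0))).of_eq
    fun w v e => ?_
  rcases Nat.eq_zero_or_pos (g w v e) with h0 | h0
  · simp [h0]
  · rw [Finset.sum_boole]
    have : {i ∈ Finset.range (f w v e) | 0 < g w v e ∧ (i + 1) * g w v e ≤ f w v e} =
        Finset.range (f w v e / g w v e) := by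
      ext i
      have := Nat.div_le_self (f w v e) (g w v e)
      simp only [Finset.mem_filter, Finset.mem_range, h0, true_and, ← Nat.le_div_iff_mul_le h0]
      omega
    simp [this]

theorem mod {f g : Fn} (hf : PolyComputable f) (hg : PolyComputable g) :
    PolyComputable (fun w v e => f w v e % g w v e) :=
  (hf.sub (hg.mul (hf.div hg))).of_eq fun w v e => by
    have := Nat.div_add_mod (f w v e) (g w v e); omega

/-- Powers of two are not polynomially bounded. Cut off at a computable bound they are reached by
doubling, with the cut-off applied after every doubling. -/
theorem min_two_pow {f g : Fn} (hf : PolyComputable f) (hg : PolyComputable g) :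
    PolyComputable (fun w v e => min (2 ^ f w v e) (g w v e)) := by
  have hrec : ∀ N m : ℕ, (Nat.rec (min 1 N) (fun _ acc => min (2 * acc) N) m : ℕ) =
      min (2 ^ m) N := by
    intro N m
    induction m with
    | zero => rfl
    | succ m ih => simp only [ih, pow_succ]; omega
  obtain ⟨B, hB, hgB⟩ := hg.exists_bound
  have hmin : ∀ {f g : Fn}, PolyComputable f → PolyComputable g →
      PolyComputable (fun w v e => min (f w v e) (g w v e)) := fun hf hg =>
    (hf.sub (hf.sub hg)).of_eq fun w v e => by omega
  refine (iter (a := fun w v e => min 1 (g w v e)) (g := fun w v e _ acc => min (2 * acc) (g w v e))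
    (B := B) hf (hmin (.const 1) hg) ?_ hB ?_).of_eq fun w v e => hrec ..
  · exact hmin ((const 2).mul (var 0)) (hg.rename (fun k => k + 2))
  · intro M w v e h i hi
    rw [hrec]
    have := hgB M w v e h
    omega

theorem size {f : Fn} (hf : PolyComputable f) : PolyComputable (fun w v e => (f w v e).size) := by
  classical
  refine (sum (g := fun w v e i => if min (2 ^ i) (f w v e + 1) ≤ f w v e then 1 else 0) hf
    (ite (PolyDecidable.le (min_two_pow (var 0) (hf.tail.add (.const 1))) hf.tail) (.const 1)
      (.const 0))).of_eq fun w v e => ?_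
  rw [Finset.sum_boole]
  have : {i ∈ Finset.range (f w v e) | min (2 ^ i) (f w v e + 1) ≤ f w v e} =
      Finset.range (f w v e).size := by
    ext i
    have h1 := size_le_self (f w v e)
    have h2 := Nat.lt_size (m := i) (n := f w v e)
    have h3 : min (2 ^ i) (f w v e + 1) ≤ f w v e ↔ 2 ^ i ≤ f w v e := by omega
    simp only [Finset.mem_filter, Finset.mem_range, h3, ← h2]
    omega
  rw [this]
  simp

/-- A positive number `f` has `2 ^ f.size ≤ 2 * f`, so cutting off at `2 * f + 1` changes nothing.
-/
theorem two_pow_size {f : Fn} (hf : PolyComputable f) :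
    PolyComputable (fun w v e => 2 ^ (f w v e).size) := by
  refine (min_two_pow hf.size (((const 2).mul hf).add (.const 1))).of_eq fun w v e => ?_
  rcases Nat.eq_zero_or_pos (f w v e) with h | h
  · simp [h, Nat.size_zero]
  · have h1 : 0 < (f w v e).size := Nat.size_pos.2 h
    have h2 := Nat.lt_size.1 (show (f w v e).size - 1 < (f w v e).size by omega)
    have h3 : 2 ^ (f w v e).size = 2 * 2 ^ ((f w v e).size - 1) := by
      rw [← pow_succ']; congr 1; omega
    omega

end PolyComputable

end RAM

/-! ### Computable lists -/

namespace RAM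

/-- Lists that are computed in polynomial time. -/
def PolyList (F : (ℕ → ℕ) → (ℕ → ℕ) → (ℕ → ℕ) → List ℕ) : Prop :=
  PolyComputable (fun w v e => (F w v e).length) ∧
    PolyComputable (fun w v e => (F w v (fun k => e (k + 1))).getD (e 0) 0)

namespace PolyList

variable {F G : (ℕ → ℕ) → (ℕ → ℕ) → (ℕ → ℕ) → List ℕ}

theorem of_eq (hF : PolyList F) (h : ∀ w v e, F w v e = G w v e) : PolyList G := by
  have : F = G := by funext w v e; exact h w v e
  exact this ▸ hF

theorem getD (hF : PolyList F) {f : Fn} (hf : PolyComputable f) :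
    PolyComputable (fun w v e => (F w v e).getD (f w v e) 0) :=
  hf.bind hF.2

theorem rename (hF : PolyList F) (σ : ℕ → ℕ) :
    PolyList (fun w v e => F w v (fun k => e (σ k))) :=
  ⟨hF.1.rename σ, PolyComputable.rename hF.2 (fun k => match k with
    | 0 => 0
    | k + 1 => σ k + 1)⟩

theorem nil : PolyList (fun _ _ _ => []) :=
  ⟨.const 0, (PolyComputable.const 0).of_eq fun w v e => by simp⟩

theorem append (hF : PolyList F) (hG : PolyList G) : PolyList (fun w v e => F w v e ++ G w v e) := by
  refine ⟨(hF.1.add hG.1).of_eq fun w v e => by simp, ?_⟩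
  have h1 := hF.rename (fun k => k + 1)
  have h2 := hG.rename (fun k => k + 1)
  refine (PolyComputable.ite (PolyDecidable.lt (.var 0) h1.1) (h1.getD (.var 0))
    (h2.getD ((PolyComputable.var 0).sub h1.1))).of_eq fun w v e => ?_
  split_ifs with h
  · rw [List.getD_append _ _ _ _ h]
  · rw [List.getD_append_right _ _ _ _ (not_lt.1 h)]

theorem ite {p : (ℕ → ℕ) → (ℕ → ℕ) → (ℕ → ℕ) → Prop} [∀ w v e, Decidable (p w v e)]
    (hp : PolyDecidable p) (hF : PolyList F) (hG : PolyList G) :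
    PolyList (fun w v e => if p w v e then F w v e else G w v e) := by
  refine ⟨(PolyComputable.ite hp hF.1 hG.1).of_eq fun w v e => by dsimp only; split_ifs <;> rfl, ?_⟩
  have hp' : PolyDecidable (fun w v e => p w v (fun k => e (k + 1))) := PolyComputable.tail hp
  exact (PolyComputable.ite hp' hF.2 hG.2).of_eq fun w v e => by dsimp only; split_ifs <;> rfl

theorem cons {f : Fn} (hf : PolyComputable f) (hF : PolyList F) :
    PolyList (fun w v e => f w v e :: F w v e) := by
  refine ⟨(hF.1.add (.const 1)).of_eq fun w v e => by simp, ?_⟩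
  refine (PolyComputable.ite (PolyDecidable.eq (.var 0) (.const 0)) hf.tail
    ((hF.rename (fun k => k + 1)).getD ((PolyComputable.var 0).sub (.const 1)))).of_eq
    fun w v e => ?_
  rcases h : e 0 with _ | k <;> simp

/-- An entry of a concatenation is found without searching for its block. For a block that ends too
early the index is out of range and gives the default `0`; a block that starts too late is removed
by the condition. At most one summand remains. -/
theorem getD_flatMap_range (f : ℕ → List ℕ) (n k : ℕ) :
    ((List.range n).flatMap f).getD k 0 = ∑ i ∈ Finset.range n,
      if ∑ j ∈ Finset.range i, (f j).length ≤ k then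
        (f i).getD (k - ∑ j ∈ Finset.range i, (f j).length) 0 else 0 := by
  have hlen : ∀ n, ((List.range n).flatMap f).length = ∑ j ∈ Finset.range n, (f j).length := by
    intro n
    induction n with
    | zero => simp
    | succ n ih => rw [List.range_succ, Finset.sum_range_succ, ← ih]; simp
  have hzero : ∀ n, ∑ j ∈ Finset.range n, (f j).length ≤ k →
      ((List.range n).flatMap f).getD k 0 = 0 := by
    intro n h
    rw [List.getD_eq_default]
    rw [hlen]; exact h
  induction n with
  | zero => simp
  | succ n ih =>
    rw [Finset.sum_range_succ, ← ih, List.range_succ, List.flatMap_append]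
    split_ifs with h
    · rw [List.getD_append_right _ _ _ _ (by rw [hlen]; exact h), hzero n h, hlen]
      simp
    · rw [List.getD_append _ _ _ _ (by rw [hlen]; omega)]
      simp

theorem flatMap {n : Fn} {H : (ℕ → ℕ) → (ℕ → ℕ) → (ℕ → ℕ) → ℕ → List ℕ} (hn : PolyComputable n)
    (hH : PolyList (fun w v e => H w v (fun k => e (k + 1)) (e 0))) :
    PolyList (fun w v e => (List.range (n w v e)).flatMap (H w v e)) := by
  refine ⟨(PolyComputable.sum (g := fun w v e i => (H w v e i).length) hn hH.1).of_eq
    fun w v e => ?_, ?_⟩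
  · beta_reduce
    generalize n w v e = m
    induction m with
    | zero => rfl
    | succ m ih => rw [Finset.sum_range_succ, ih, List.range_succ]; simp
  · have h1 : PolyComputable (fun w v e => ∑ j ∈ Finset.range (e 0),
        (H w v (fun k => e (k + 2)) j).length) :=
      PolyComputable.sum (g := fun w v e i => (H w v (fun k => e (k + 2)) i).length) (.var 0)
        (hH.1.rename (fun k => match k with
          | 0 => 0
          | k + 1 => k + 3))
    have h2 : PolyList (fun w v e => H w v (fun k => e (k + 2)) (e 0)) :=
      hH.rename (fun k => match k with
        | 0 => 0
        | k + 1 => k + 2)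
    refine (PolyComputable.sum (g := fun w v e i =>
      if ∑ j ∈ Finset.range i, (H w v (fun k => e (k + 1)) j).length ≤ e 0 then
        (H w v (fun k => e (k + 1)) i).getD
          (e 0 - ∑ j ∈ Finset.range i, (H w v (fun k => e (k + 1)) j).length) 0 else 0)
      hn.tail (PolyComputable.ite (.le h1 (.var 1)) (h2.getD ((PolyComputable.var 1).sub h1))
        (.const 0))).of_eq fun w v e => ?_
    rw [getD_flatMap_range]

theorem map_range {n : Fn} {g : (ℕ → ℕ) → (ℕ → ℕ) → (ℕ → ℕ) → ℕ → ℕ} (hn : PolyComputable n)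
    (hg : PolyComputable (fun w v e => g w v (fun k => e (k + 1)) (e 0))) :
    PolyList (fun w v e => (List.range (n w v e)).map (g w v e)) :=
  (flatMap (H := fun w v e i => [g w v e i]) hn (cons hg nil)).of_eq fun w v e => by
    exact List.map_eq_flatMap.symm

theorem filter_range {n : Fn} {p : (ℕ → ℕ) → (ℕ → ℕ) → (ℕ → ℕ) → ℕ → Prop}
    [∀ w v e i, Decidable (p w v e i)] (hn : PolyComputable n)
    (hp : PolyDecidable (fun w v e => p w v (fun k => e (k + 1)) (e 0))) :
    PolyList (fun w v e => (List.range (n w v e)).filter (p w v e ·)) :=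
  (flatMap (H := fun w v e i => if p w v e i then [i] else []) hn
    (ite hp (cons (.var 0) nil) nil)).of_eq fun w v e => by
    generalize List.range (n w v e) = l
    induction l with
    | nil => rfl
    | cons a l ih =>
      rw [List.flatMap_cons, ih, List.filter_cons]
      by_cases h : p w v e a <;> simp [h]

end PolyList

/-- The target differs from the arrays `0` and `2`, so entries computed while the list is being
written still refer to the original input and answers. -/
theorem exists_write {F : (ℕ → ℕ) → (ℕ → ℕ) → (ℕ → ℕ) → List ℕ} (hF : PolyList F) :
    ∃ B, PolyBounded B ∧ ∀ (a : ℕ) (ρ : ℕ → ℕ) (b : ℕ), a ≠ 0 → a ≠ 2 → (∀ k, ρ k < b) →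
      ∃ p, ∀ (s : State) (M : ℕ), Below M (s.mem 0) (s.mem 2) (fun k => s.reg (ρ k)) →
        ∃ s' t, Exec p s s' t ∧ (∀ r < b, s'.reg r = s.reg r) ∧
          (∀ a' ≠ a, s'.mem a' = s.mem a') ∧
          (∀ i, s'.mem a i = if i < (F (s.mem 0) (s.mem 2) (fun k => s.reg (ρ k))).length then
            (F (s.mem 0) (s.mem 2) (fun k => s.reg (ρ k))).getD i 0 else s.mem a i) ∧ t ≤ B M := by
  obtain ⟨⟨Bn, hBn, hnB, hn⟩, ⟨Bg, hBg, hgB, hg⟩⟩ := hF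
  let T : ℕ → ℕ := fun M => 2 * Bg (M + Bn M) + 4 * Bn M + 20
  have hT : PolyBounded T := (((PolyBounded.const 2).mul (hBg.comp (PolyBounded.id.add hBn))).add
    ((PolyBounded.const 4).mul hBn)).add (.const 20)
  refine ⟨fun M => Bn M + (Bn M + 1) * (1 + Bn M + T M) + 10,
    (hBn.add ((hBn.add (.const 1)).mul (((PolyBounded.const 1).add hBn).add hT))).add (.const 10),
    fun a ρ b ha0 ha2 hρ => ?_⟩
  obtain ⟨p, hp⟩ := hn ρ b hρ
  obtain ⟨pg, hpg⟩ := hg (push (b + 1) ρ) (b + 3) (fun k => by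
    rcases k with _ | k
    · simp [push]
    · exact (hρ k).trans (by omega))
  refine ⟨.seq p (.seq (.const (b + 1) 0) (.seq (.const (b + 2) 1) (.loop b (.seq pg
    (.seq (.store a (b + 1) (b + 3)) (.seq (.add (b + 1) (b + 1) (b + 2))
      (.sub b b (b + 2)))))))), fun s M hM => ?_⟩
  obtain ⟨s1, t1, he1, hm1, hr1, hv1, ht1⟩ := hp s M hM
  set w := s.mem 0 with hw
  set v := s.mem 2 with hv
  set e : ℕ → ℕ := fun k => s.reg (ρ k) with he
  set n := (F w v e).length with hndef
  have hnM : n ≤ Bn M := hnB M _ _ _ hM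
  have hv1' : s1.reg b = n := hv1
  let I : ℕ → State → Prop := fun i σ => (∀ a' ≠ a, σ.mem a' = s.mem a') ∧
    (∀ r < b, σ.reg r = s.reg r) ∧ σ.reg b = n - i ∧ σ.reg (b + 1) = i ∧ σ.reg (b + 2) = 1 ∧
    ∀ j, σ.mem a j = if j < i then (F w v e).getD j 0 else s.mem a j
  obtain ⟨s4, t4, he4, ⟨hm4, hr4, hb0, hb1, hb2, hb3⟩, ht4⟩ := exec_loop (x := b) (I := I)
    (T := T M) (n := n) (p := .seq pg
    (.seq (.store a (b + 1) (b + 3)) (.seq (.add (b + 1) (b + 1) (b + 2))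
      (.sub b b (b + 2)))))
    (fun i σ _ h => h.2.2.1) (by
      intro i σ hi ⟨hm, hr, hb0, hb1, hb2, hb3⟩
      have hM' : Below (M + Bn M) w v (push i e) := (hM.mono (by omega)).push (by omega)
      have henv : (fun k => σ.reg (push (b + 1) ρ k)) = push i e :=
        funext fun k => by
          rcases k with _ | k
          · exact hb1
          · exact hr _ (hρ k)
      obtain ⟨s3, t3, he3, hm3, hr3, hv3, ht3⟩ := hpg σ (M + Bn M) (by
        rw [henv, hm 0 ha0.symm, hm 2 ha2.symm]; exact hM')
      rw [henv, hm 0 ha0.symm, hm 2 ha2.symm] at hv3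
      have hv3' : s3.reg (b + 3) = (F w v e).getD i 0 := hv3
      have e0 := hr3 b (by omega)
      have e1 := hr3 (b + 1) (by omega)
      have e2 := hr3 (b + 2) (by omega)
      refine ⟨_, _, .seq he3 (.seq (.store ..) (.seq (.add ..) (.sub ..))),
        ⟨fun a' ha' => ?_, fun r hr' => ?_, ?_, ?_, ?_, fun j => ?_⟩, ?_⟩
      · simp [setMem_mem_of_ne _ _ _ ha', hm3, hm a' ha']
      · have h1 : r ≠ b := by omega
        have h2 : r ≠ b + 1 := by omega
        simp [h1, h2, hr3 r (by omega), hr r hr']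
      · simp [e0, e2, hb0, hb2]; omega
      · simp [e1, e2, hb1, hb2]
      · simp [e2, hb2]
      · simp only [setReg_mem, setMem_mem, hm3, e1, hb1, hb3, true_and, hv3']
        by_cases h : j = i
        · simp [h]
        · have : j < i + 1 ↔ j < i := by omega
          simp [h, this]
      · have h5 := hgB _ _ _ _ hM'
        have h4 : (F w v e).getD i 0 ≤ Bg (M + Bn M) := h5
        have h6 := size_le_self ((F w v e).getD i 0)
        have h7 := size_le_self i
        have h8 := size_le_self (n - i)
        simp only [setReg_reg, setMem_reg, e0, e1, e2, hb0, hb1, hb2, hv3', T, Nat.size_one,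
          if_neg (show b ≠ b + 1 by omega), if_neg (show b + 2 ≠ b + 1 by omega)]
        omega)
    ((s1.setReg (b + 1) 0).setReg (b + 2) 1) (by
      refine ⟨by simp [hm1], fun r hr => ?_, ?_, ?_, ?_, ?_⟩
      · have h2 : r ≠ b + 1 := by omega
        have h3 : r ≠ b + 2 := by omega
        simp [h2, h3, hr1 r hr]
      all_goals simp [hv1', hm1])
  refine ⟨_, _, .seq he1 (.seq (.const ..) (.seq (.const ..) he4)), hr4, hm4, hb3, ?_⟩
  have h5 : (n + 1) * (1 + n + T M) ≤ (Bn M + 1) * (1 + Bn M + T M) :=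
    Nat.mul_le_mul (by omega) (by omega)
  simp
  omega

end RAM

/-! ### Running a program again and again in a memory that is not cleared -/

namespace RAM

namespace Prog

/-- All registers of the program are smaller than this number. -/
def regBound : Prog → ℕ
  | skip => 0
  | const x _ => x + 1
  | add x y z => max (x + 1) (max (y + 1) (z + 1))
  | sub x y z => max (x + 1) (max (y + 1) (z + 1))
  | load x _ y => max (x + 1) (y + 1)
  | store _ y x => max (x + 1) (y + 1)
  | seq p q => max p.regBound q.regBound
  | branch x p q => max (x + 1) (max p.regBound q.regBound)
  | loop x p => max (x + 1) p.regBound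

/-- The program in shifted registers and arrays. Every cell is accompanied by a stamp, and the
cells whose stamp differs from the contents of register `4` are treated as empty. -/
def stamped : Prog → Prog
  | skip => skip
  | const x v => const (7 + x) v
  | add x y z => add (7 + x) (7 + y) (7 + z)
  | sub x y z => sub (7 + x) (7 + y) (7 + z)
  -- No stamp exceeds the current one, so the truncated difference vanishes exactly on cells written
  -- in the current run.
  | load x a y => seq (load 5 (4 + 2 * a) (7 + y)) (seq (sub 5 4 5)
      (branch 5 (const (7 + x) 0) (load (7 + x) (3 + 2 * a) (7 + y))))
  | store a y x => seq (store (3 + 2 * a) (7 + y) (7 + x)) (store (4 + 2 * a) (7 + y) 4)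
  | seq p q => seq p.stamped q.stamped
  | branch x p q => branch (7 + x) p.stamped q.stamped
  | loop x p => loop (7 + x) p.stamped

end Prog

/-- The state `σ` of a stamped program represents the state `s`. -/
structure Represents (κ X : ℕ) (s σ : State) : Prop where
  stamp : σ.reg 4 = κ
  reg : ∀ x < X, σ.reg (7 + x) = s.reg x
  stamp_le : ∀ a i, σ.mem (4 + 2 * a) i ≤ κ
  mem : ∀ a i, s.mem a i = if σ.mem (4 + 2 * a) i = κ then σ.mem (3 + 2 * a) i else 0

/-- The registers and arrays that stamped programs do not touch. -/
def SameOutside (σ σ' : State) : Prop :=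
  (∀ r < 4, σ'.reg r = σ.reg r) ∧ ∀ a < 3, σ'.mem a = σ.mem a

theorem SameOutside.trans {σ σ' σ'' : State} (h : SameOutside σ σ') (h' : SameOutside σ' σ'') :
    SameOutside σ σ'' :=
  ⟨fun r hr => (h'.1 r hr).trans (h.1 r hr), fun a ha => (h'.2 a ha).trans (h.2 a ha)⟩

theorem Represents.setReg {κ X : ℕ} {s σ : State} (h : Represents κ X s σ) (x v : ℕ) :
    Represents κ X (s.setReg x v) (σ.setReg (7 + x) v) := by
  refine ⟨?_, fun y hy => ?_, h.stamp_le, h.mem⟩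
  · rw [setReg_reg, if_neg (by omega), h.stamp]
  · simp [h.reg y hy]

theorem sameOutside_setReg (σ : State) (x v : ℕ) (hx : 4 ≤ x) : SameOutside σ (σ.setReg x v) :=
  ⟨fun r hr => by rw [setReg_reg, if_neg (by omega)], fun _ _ => rfl⟩

/-- Induction on the execution. Compared with the original instruction, the simulation handles only
a few additional numbers that are at most `κ`, hence of length at most `κ`. This explains the
slowdown by a constant times `κ + 1`. -/
theorem Exec.stamped {κ X : ℕ} {p : Prog} {s s' : State} {t : ℕ} (h : Exec p s s' t)
    (hp : p.regBound ≤ X) (σ : State) (hσ : Represents κ X s σ) :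
    ∃ σ' t', Exec p.stamped σ σ' t' ∧ Represents κ X s' σ' ∧ SameOutside σ σ' ∧
      t' ≤ 8 * (κ + 1) * t := by
  induction h generalizing σ with
  | skip s => exact ⟨σ, 1, .skip _, hσ, ⟨fun _ _ => rfl, fun _ _ => rfl⟩, by omega⟩
  | const s x v =>
    exact ⟨_, _, .const .., hσ.setReg x v, sameOutside_setReg _ _ _ (by omega),
      Nat.le_mul_of_pos_left _ (by omega)⟩
  | add s x y z =>
    simp only [Prog.regBound] at hp
    have hy := hσ.reg y (by omega)
    have hz := hσ.reg z (by omega)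
    refine ⟨_, _, .add .., ?_, sameOutside_setReg _ _ _ (by omega), ?_⟩
    · rw [hy, hz]; exact hσ.setReg _ _
    · rw [hy, hz]; exact Nat.le_mul_of_pos_left _ (by omega)
  | sub s x y z =>
    simp only [Prog.regBound] at hp
    have hy := hσ.reg y (by omega)
    have hz := hσ.reg z (by omega)
    refine ⟨_, _, .sub .., ?_, sameOutside_setReg _ _ _ (by omega), ?_⟩
    · rw [hy, hz]; exact hσ.setReg _ _
    · rw [hy, hz]; exact Nat.le_mul_of_pos_left _ (by omega)
  | load s x a y =>
    simp only [Prog.regBound] at hp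
    have hy := hσ.reg y (by omega)
    have hst := hσ.stamp_le a (s.reg y)
    have hmem := hσ.mem a (s.reg y)
    set st := σ.mem (4 + 2 * a) (s.reg y) with hst_def
    let σ1 := (σ.setReg 5 st).setReg 5 (κ - st)
    have he1 : Exec (.load 5 (4 + 2 * a) (7 + y)) σ (σ.setReg 5 st)
        (1 + (s.reg y).size + st.size) := by
      have := Exec.load σ 5 (4 + 2 * a) (7 + y)
      rwa [hy] at this
    have he2 : Exec (.sub 5 4 5) (σ.setReg 5 st) σ1 (1 + κ.size + st.size) := by
      have := Exec.sub (σ.setReg 5 st) 5 4 5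
      simpa [hσ.stamp, σ1] using this
    have hσ1 : Represents κ X s σ1 := by
      refine ⟨by simp [σ1, hσ.stamp], fun z hz => ?_, hσ.stamp_le, hσ.mem⟩
      simp only [σ1, setReg_reg, if_neg (show 7 + z ≠ 5 by omega)]
      exact hσ.reg z hz
    have hout : SameOutside σ σ1 :=
      (sameOutside_setReg _ _ _ (by omega)).trans (sameOutside_setReg _ _ _ (by omega))
    have h5 : σ1.reg 5 = κ - st := by simp [σ1]
    have b1 := size_le_self κ
    have b2 := size_le_self st
    have b3 := size_le_self (κ - st)
    by_cases hc : st = κ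
    · rw [if_pos hc] at hmem
      have h0 : σ1.reg 5 = 0 := by rw [h5]; omega
      have he3 := Exec.load σ1 (7 + x) (3 + 2 * a) (7 + y)
      have hv : σ1.mem (3 + 2 * a) (σ1.reg (7 + y)) = s.mem a (s.reg y) := by
        rw [hσ1.reg y (by omega), hmem]; rfl
      refine ⟨_, _, .seq he1 (.seq he2 (.branch_false h0 he3)), ?_,
        hout.trans (sameOutside_setReg _ _ _ (by omega)), ?_⟩
      · rw [hv]; exact hσ1.setReg _ _
      · rw [hv, hσ1.reg y (by omega), h0]
        simp only [Nat.size_zero]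
        nlinarith [Nat.zero_le (κ * (s.reg y).size), Nat.zero_le (κ * (s.mem a (s.reg y)).size)]
    · rw [if_neg hc] at hmem
      have h0 : σ1.reg 5 ≠ 0 := by rw [h5]; omega
      refine ⟨_, _, .seq he1 (.seq he2 (.branch_true h0 (.const ..))), ?_,
        hout.trans (sameOutside_setReg _ _ _ (by omega)), ?_⟩
      · rw [hmem]; exact hσ1.setReg _ _
      · rw [h5, hmem]
        simp only [Nat.size_zero]
        have b4 : 8 * (κ + 1) * (1 + (s.reg y).size + 0) =
            8 * κ + 8 + 8 * (s.reg y).size + 8 * (κ * (s.reg y).size) := by ring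
        omega
  | store s a y x =>
    simp only [Prog.regBound] at hp
    have hy := hσ.reg y (by omega)
    have hx := hσ.reg x (by omega)
    refine ⟨_, _, .seq (.store ..) (.store ..), ⟨hσ.stamp, hσ.reg, fun a' i => ?_,
      fun a' i => ?_⟩, ⟨fun _ _ => rfl, fun a' ha' => ?_⟩, ?_⟩
    · have := hσ.stamp_le a' i
      simp only [setMem_mem, setMem_reg]
      split_ifs
      · exact hσ.stamp.le
      · omega
      · exact this
    · have h1 := hσ.mem a' i
      have e1 : (4 + 2 * a' = 4 + 2 * a) = (a' = a) := by simp
      have e2 : (3 + 2 * a' = 3 + 2 * a) = (a' = a) := by simp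
      have e3 : (4 + 2 * a' = 3 + 2 * a) = False := by simp; omega
      have e4 : (3 + 2 * a' = 4 + 2 * a) = False := by simp; omega
      simp only [setMem_mem, setMem_reg, hy, hx, e1, e2, e3, e4, false_and, if_false]
      by_cases hc : a' = a ∧ i = s.reg y
      · simp [hc, hσ.stamp]
      · simp only [if_neg hc]; exact h1
    · rw [setMem_mem_of_ne _ _ _ (by omega), setMem_mem_of_ne _ _ _ (by omega)]
    · have b1 := size_le_self κ
      simp only [setMem_reg, hy, hx, hσ.stamp]
      nlinarith [Nat.zero_le (κ * (s.reg y).size), Nat.zero_le (κ * (s.reg x).size)]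
  | seq h1 h2 ih1 ih2 =>
    simp only [Prog.regBound] at hp
    obtain ⟨σ1, t1, he1, hr1, ho1, ht1⟩ := ih1 (by omega) σ hσ
    obtain ⟨σ2, t2, he2, hr2, ho2, ht2⟩ := ih2 (by omega) σ1 hr1
    exact ⟨σ2, _, .seq he1 he2, hr2, ho1.trans ho2, by rw [mul_add]; omega⟩
  | @branch_true x p q s s' t hx h ih =>
    simp only [Prog.regBound] at hp
    obtain ⟨σ1, t1, he1, hr1, ho1, ht1⟩ := ih (by omega) σ hσ
    have e := hσ.reg x (by omega)
    refine ⟨σ1, _, .branch_true (by rwa [e]) he1, hr1, ho1, ?_⟩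
    rw [e, mul_add]
    have := Nat.le_mul_of_pos_left (1 + (s.reg x).size) (show 0 < 8 * (κ + 1) by omega)
    exact add_le_add this ht1
  | @branch_false x p q s s' t hx h ih =>
    simp only [Prog.regBound] at hp
    obtain ⟨σ1, t1, he1, hr1, ho1, ht1⟩ := ih (by omega) σ hσ
    have e := hσ.reg x (by omega)
    refine ⟨σ1, _, .branch_false (by rwa [e]) he1, hr1, ho1, ?_⟩
    rw [e, mul_add]
    have := Nat.le_mul_of_pos_left (1 + (s.reg x).size) (show 0 < 8 * (κ + 1) by omega)
    exact add_le_add this ht1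
  | @loop_true x p s s' s'' t t' hx h1 h2 ih1 ih2 =>
    have hp' := hp
    simp only [Prog.regBound] at hp
    obtain ⟨σ1, t1, he1, hr1, ho1, ht1⟩ := ih1 (by omega) σ hσ
    obtain ⟨σ2, t2, he2, hr2, ho2, ht2⟩ := ih2 hp' σ1 hr1
    have e := hσ.reg x (by omega)
    refine ⟨σ2, _, .loop_true (by rwa [e]) he1 he2, hr2, ho1.trans ho2, ?_⟩
    rw [e, mul_add, mul_add]
    have := Nat.le_mul_of_pos_left (1 + (s.reg x).size) (show 0 < 8 * (κ + 1) by omega)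
    exact add_le_add (add_le_add this ht1) ht2
  | @loop_false x p s hx =>
    simp only [Prog.regBound] at hp
    have e := hσ.reg x (by omega)
    refine ⟨σ, _, .loop_false (by rwa [e]), hσ, ⟨fun _ _ => rfl, fun _ _ => rfl⟩, ?_⟩
    rw [e]
    exact Nat.le_mul_of_pos_left _ (by omega)

/-- Clear the registers `7, …, 7 + X - 1`. -/
def clear : ℕ → Prog
  | 0 => .skip
  | X + 1 => .seq (clear X) (.const (7 + X) 0)

theorem exec_clear (X : ℕ) (s : State) : ∃ s', Exec (clear X) s s' (X + 1) ∧ s'.mem = s.mem ∧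
    (∀ r < 7, s'.reg r = s.reg r) ∧ ∀ x < X, s'.reg (7 + x) = 0 := by
  induction X with
  | zero => exact ⟨s, .skip _, rfl, fun _ _ => rfl, fun _ h => absurd h (by omega)⟩
  | succ X ih =>
    obtain ⟨s', h1, h2, h3, h4⟩ := ih
    refine ⟨_, .seq h1 (.const ..), by simp [h2], fun r hr => ?_, fun x hx => ?_⟩
    · rw [setReg_reg, if_neg (by omega), h3 r hr]
    · rw [setReg_reg]
      split_ifs with h
      · rfl
      · exact h4 x (by omega)

end RAM

/-! ### Adaptive polynomial time reductions -/

namespace RAM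

/-- The memory function of a word. -/
def word (l : List ℕ) : ℕ → ℕ := fun i => l.getD i 0

/-- Adaptive polynomial time reductions. The `q`-th query is the word `F w v q`, where `w` is the
input and `v` the sequence of the first cells of the answers to the preceding queries; at the end
the word `G w v` is the output. -/
theorem SolvableInTime.of_queries {X Y : Type} {encX : X → List ℕ} {corrX : X → (ℕ → ℕ) → Prop}
    {encY : Y → List ℕ} {corrY : Y → (ℕ → ℕ) → Prop} {boundY : Y → ℝ}
    (hY : SolvableInTime encY corrY boundY) {n : Fn} (hn : PolyComputable n)
    {F G : (ℕ → ℕ) → (ℕ → ℕ) → (ℕ → ℕ) → List ℕ} (hF : PolyList F) (hG : PolyList G)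
    (M : X → ℕ) (T : X → ℝ) (hM : ∀ x i, word (encX x) i ≤ M x) (hT : ∀ x, 0 ≤ T x)
    (Hist : X → ℕ → (ℕ → ℕ) → Prop) (hist0 : ∀ x, Hist x 0 (fun _ => 0))
    (hquery : ∀ x v q, q < n (word (encX x)) (fun _ => 0) (fun _ => 0) → Hist x q v →
      ∃ y, boundY y ≤ T x ∧ word (F (word (encX x)) v (fun _ => q)) = word (encY y) ∧
        ∀ out, corrY y out → out 0 ≤ M x ∧ Hist x (q + 1) (Function.update v q (out 0)))
    (hfinal : ∀ x v, Hist x (n (word (encX x)) (fun _ => 0) (fun _ => 0)) v →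
      corrX x (word (G (word (encX x)) v (fun _ => 0)))) :
    ∃ c : ℕ, SolvableInTime encX corrX (fun x => (1 + T x) * ((M x : ℝ) + 2) ^ c) := by
  obtain ⟨p, hp⟩ := hY
  obtain ⟨Bn, hBn, hnB, hn⟩ := hn
  obtain ⟨BF, hBF, hFw⟩ := exists_write hF
  have hS : PolyList (fun w v e => (List.range (F w v e).length).map (fun _ => e 0 + 1)) :=
    .map_range hF.1 ((PolyComputable.var 1).add (.const 1))
  obtain ⟨BS, hBS, hSw⟩ := exists_write hS
  obtain ⟨BG, hBG, hGw⟩ := exists_write hG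
  -- The first cell of the answer is brought into register `0` of the solver, which is register `7`
  -- of the simulation.
  let call : Prog := .seq p (.seq (.const 0 0) (.load 0 1 0))
  let R : ℕ := call.regBound
  have hR : 0 < R := by simp [R, call, Prog.regBound]
  obtain ⟨pn, hpn⟩ := hn (fun _ => 0) (7 + R) (fun _ => by omega)
  -- All variables of the environment are read from register `1`, the number of the query. The
  -- arrays `3` and `4` hold the cells and the stamps of the solver's input array.
  obtain ⟨pF, hpF⟩ := hFw 3 (fun _ => 1) (7 + R) (by omega) (by omega) (fun _ => by omega)
  obtain ⟨pS, hpS⟩ := hSw 4 (fun _ => 1) (7 + R) (by omega) (by omega) (fun _ => by omega)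
  obtain ⟨pG, hpG⟩ := hGw 1 (fun _ => 0) (7 + R) (by omega) (by omega) (fun _ => by omega)
  let N : ℕ → ℕ := fun M => M + Bn M
  have hN : PolyBounded N := PolyBounded.id.add hBn
  let E : ℕ → ℕ := fun M => 8 * (N M + 2) * (M + 3)
  have hE : PolyBounded E := ((PolyBounded.const 8).mul (hN.add (.const 2))).mul
    (PolyBounded.id.add (.const 3))
  let U : ℕ → ℕ := fun M => BF (N M) + BS (N M) + R + 6 * N M + 20
  have hU : PolyBounded U := ((((hBF.comp hN).add (hBS.comp hN)).add (.const R)).add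
    ((PolyBounded.const 6).mul hN)).add (.const 20)
  let P : ℕ → ℕ := fun M => Bn M + BG M + 2 * Bn M + 20 + (Bn M + 1) * (1 + Bn M + U M + E M)
  have hP : PolyBounded P := (((hBn.add hBG).add ((PolyBounded.const 2).mul hBn)).add
    (.const 20)).add ((hBn.add (.const 1)).mul ((((PolyBounded.const 1).add hBn).add hU).add hE))
  obtain ⟨c, hc⟩ := hP
  -- Register `0` is always zero, `1` is the number of the query, `2` the number of remaining
  -- queries, `3` the constant one and `4` the stamp. The stamp of query `q` is `q + 1`: it exceeds
  -- the stamps of all earlier calls and also the zeros of the untouched memory, so the solver finds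
  -- an empty memory apart from its input.
  let body : Prog := .seq pF (.seq pS (.seq (clear R) (.seq call.stamped (.seq (.store 2 1 7)
    (.seq (.add 1 1 3) (.seq (.add 4 4 3) (.sub 2 2 3)))))))
  refine ⟨c, .seq pn (.seq (.const 2 0) (.seq (.add 2 2 (7 + R)) (.seq (.const 3 1)
    (.seq (.const 4 1) (.seq (.loop 2 body) pG))))), fun x => ?_⟩
  set w := word (encX x) with hw
  set m := n w (fun _ => 0) (fun _ => 0) with hm
  have hB0 : Below (M x) w (fun _ => 0) (fun _ => 0) :=
    ⟨hM x, fun _ => Nat.zero_le _, fun _ => Nat.zero_le _⟩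
  have hmB : m ≤ Bn (M x) := hnB _ _ _ _ hB0
  -- Running times are natural numbers, so the real bound may be rounded down.
  set τ : ℕ := ⌊T x⌋₊ with hτ
  have hi0 : (init (encX x)).mem 0 = w := by funext i; simp [init, hw, word]
  have hi2 : (init (encX x)).mem 2 = fun _ => 0 := by funext i; simp [init]
  obtain ⟨s1, t1, he1, hm1, hr1, hv1, ht1⟩ := hpn (init (encX x)) (M x) (by rw [hi0, hi2]; exact hB0)
  have hv1 : s1.reg (7 + R) = m := by rw [hv1, hi0, hi2]; rfl
  let s2 := (((s1.setReg 2 0).setReg 2 m).setReg 3 1).setReg 4 1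
  let I : ℕ → State → Prop := fun i σ => σ.mem 0 = w ∧ (∀ j, σ.mem 1 j = 0) ∧
    Hist x i (σ.mem 2) ∧ (∀ j, σ.mem 2 j ≤ M x) ∧ σ.reg 0 = 0 ∧ σ.reg 1 = i ∧
    σ.reg 2 = m - i ∧ σ.reg 3 = 1 ∧ σ.reg 4 = i + 1 ∧ ∀ a j, σ.mem (4 + 2 * a) j ≤ i
  obtain ⟨s3, t3, he3, ⟨hs0, hs1, hs2, hs3, hs4, -⟩, ht3⟩ := exec_loop (x := 2) (I := I)
    (T := U (M x) + (1 + τ) * E (M x)) (n := m) (p := body) (fun i σ _ h => h.2.2.2.2.2.2.1) (by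
    intro i σ hi ⟨h0, h1, h2, h2', r0, r1, r2, r3, r4, hst⟩
    have henv : (fun _ : ℕ => σ.reg 1) = fun _ => i := by rw [r1]
    have hBi : Below (N (M x)) w (σ.mem 2) (fun _ => i) :=
      ⟨fun j => (hM x j).trans (by simp only [N]; omega),
        fun j => (h2' j).trans (by simp only [N]; omega), fun j => by simp only [N]; omega⟩
    obtain ⟨y, hyT, hyF, hyc⟩ := hquery x (σ.mem 2) i hi h2
    set L := F w (σ.mem 2) (fun _ => i) with hL
    obtain ⟨a1, u1, ea1, ra1, ma1, la1, ta1⟩ := hpF σ (N (M x)) (by rw [henv, h0]; exact hBi)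
    rw [henv, h0, ← hL] at la1
    have henv1 : (fun _ : ℕ => a1.reg 1) = fun _ => i := by rw [ra1 1 (by omega), r1]
    obtain ⟨a2, u2, ea2, ra2, ma2, la2, ta2⟩ := hpS a1 (N (M x)) (by
      rw [henv1, ma1 0 (by omega), ma1 2 (by omega), h0]; exact hBi)
    rw [henv1, ma1 0 (by omega), ma1 2 (by omega), h0] at la2
    beta_reduce at la2
    rw [← hL] at la2
    simp only [List.length_map, List.length_range] at la2
    have hval : ∀ j < L.length, (List.map (fun _ => i + 1) (List.range L.length)).getD j 0 =
        i + 1 := fun j hj => by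
      rw [List.getD_eq_getElem _ _ (by simpa using hj), List.getElem_map]
    obtain ⟨a3, ea3, ma3, ra3, ra3'⟩ := exec_clear R a2
    obtain ⟨so, tp, eo, hto, hco⟩ := hp y
    have hcall : Exec call (init (encY y)) ((so.setReg 0 0).setReg 0 (so.mem 1 0))
        (tp + ((1 + Nat.size 0) + (1 + Nat.size 0 + (so.mem 1 0).size))) := by
      have := Exec.load (so.setReg 0 0) 0 1 0
      simp only [setReg_reg, if_true, setReg_mem] at this
      exact .seq eo (.seq (.const ..) this)
    have hrep : Represents (i + 1) R (init (encY y)) a3 := by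
      refine ⟨?_, fun z hz => by rw [ra3' z hz]; rfl, fun a j => ?_, fun a j => ?_⟩
      · rw [ra3 4 (by omega), ra2 4 (by omega), ra1 4 (by omega), r4]
      · rw [ma3]
        rcases Nat.eq_zero_or_pos a with rfl | ha
        · rw [la2]
          split_ifs with hj
          · rw [hval j hj]
          · rw [ma1 4 (by omega)]; exact (hst 0 j).trans (by omega)
        · rw [ma2 _ (by omega), ma1 _ (by omega)]; exact (hst a j).trans (by omega)
      · rw [ma3]
        rcases Nat.eq_zero_or_pos a with rfl | ha
        · have e : (init (encY y)).mem 0 j = L.getD j 0 := by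
            simp only [init, if_true]; exact (congrFun hyF j).symm
          rw [e, la2, ma2 (3 + 2 * 0) (by omega), la1]
          by_cases hj : j < L.length
          · rw [if_pos hj, if_pos hj, hval j hj, if_pos rfl]
          · have h4 : σ.mem 4 j ≤ i := hst 0 j
            rw [if_neg hj, ma1 4 (by omega), if_neg (by omega), List.getD_eq_default _ _ (by omega)]
        · have h4 := hst a j
          rw [ma2 (4 + 2 * a) (by omega), ma1 (4 + 2 * a) (by omega), if_neg (by omega)]
          simp [init, ha.ne']
    obtain ⟨a4, u4, ea4, ha4, oa4, ta4⟩ := hcall.stamped le_rfl a3 hrep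
    have hr7 : a4.reg 7 = so.mem 1 0 := by simpa using ha4.reg 0 hR
    have q1 : a4.reg 1 = i := by
      rw [oa4.1 1 (by omega), ra3 1 (by omega), ra2 1 (by omega), ra1 1 (by omega), r1]
    have q2 : a4.reg 2 = m - i := by
      rw [oa4.1 2 (by omega), ra3 2 (by omega), ra2 2 (by omega), ra1 2 (by omega), r2]
    have q3 : a4.reg 3 = 1 := by
      rw [oa4.1 3 (by omega), ra3 3 (by omega), ra2 3 (by omega), ra1 3 (by omega), r3]
    have q0 : a4.reg 0 = 0 := by
      rw [oa4.1 0 (by omega), ra3 0 (by omega), ra2 0 (by omega), ra1 0 (by omega), r0]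
    have q4 : a4.reg 4 = i + 1 := ha4.stamp
    have m4 : ∀ a < 3, a4.mem a = σ.mem a := fun a ha => by
      rw [oa4.2 a ha, ma3, ma2 a (by omega), ma1 a (by omega)]
    obtain ⟨hoM, hoH⟩ := hyc _ hco
    refine ⟨_, _, .seq ea1 (.seq ea2 (.seq ea3 (.seq ea4 (.seq (.store ..) (.seq (.add ..)
      (.seq (.add ..) (.sub ..))))))), ⟨?_, ?_, ?_, ?_, ?_, ?_, ?_, ?_, ?_, ?_⟩, ?_⟩
    · simp only [setReg_mem]
      rw [setMem_mem_of_ne _ _ _ (by omega), m4 0 (by omega), h0]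
    · simp only [setReg_mem]
      rw [setMem_mem_of_ne _ _ _ (by omega), m4 1 (by omega)]; exact h1
    · have : ((a4.setMem 2 i (so.mem 1 0)).mem 2) = Function.update (σ.mem 2) i (so.mem 1 0) := by
        funext j; rw [setMem_mem, m4 2 (by omega), Function.update_apply]; simp
      simp only [setReg_mem, q1, hr7, this]
      exact hoH
    · intro j
      simp only [setReg_mem, q1, hr7]
      rw [setMem_mem, m4 2 (by omega)]
      split_ifs
      · exact hoM
      · exact h2' j
    · simp [q0]
    · simp [q1, q3]
    · simp [q2, q3]; omega
    · simp [q3]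
    · simp [q4, q3]
    · intro a j
      simp only [setReg_mem]
      rw [setMem_mem_of_ne _ _ _ (by omega)]
      exact ha4.stamp_le a j
    · have htp : tp ≤ τ := Nat.le_floor (hto.trans hyT)
      have z1 := size_le_self (so.mem 1 0)
      have z2 := size_le_self i
      have z3 := size_le_self (i + 1)
      have z4 := size_le_self (m - i)
      have h8 : u4 ≤ 8 * (N (M x) + 2) * ((M x + 3) * (1 + τ)) := by
        refine ta4.trans (Nat.mul_le_mul ?_ ?_)
        · simp only [N]; omega
        · simp only [Nat.size_zero]; nlinarith [Nat.zero_le (M x * τ)]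
      have h9 : 8 * (N (M x) + 2) * ((M x + 3) * (1 + τ)) = (1 + τ) * E (M x) := by
        simp only [E]; ring
      simp only [setReg_reg, setMem_reg, q1, q2, q3, q4, hr7, Nat.size_one]
      simp only [U, N] at *
      simp
      omega)
    s2 (by
      have hz : ∀ r < 7 + R, s1.reg r = 0 := fun r hr => hr1 r hr
      refine ⟨?_, ?_, ?_, ?_, ?_, ?_, ?_, ?_, ?_, ?_⟩
      · simp [s2, hm1, hi0]
      · intro j; simp [s2, hm1, init]
      · simp only [s2, setReg_mem, hm1, hi2]; exact hist0 x
      · intro j; simp [s2, hm1, init]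
      · simp [s2, hz 0 (by omega)]
      · simp [s2, hz 1 (by omega)]
      · simp [s2]
      · simp [s2]
      · simp [s2]
      · intro a j; simp [s2, hm1, init])
  have henv3 : (fun _ : ℕ => s3.reg 0) = fun _ => 0 := by rw [hs4]
  obtain ⟨s4, t4, he4, hr4, hm4, hl4, ht4⟩ := hpG s3 (M x) (by
    rw [henv3, hs0]; exact ⟨hM x, hs3, fun _ => Nat.zero_le _⟩)
  rw [henv3, hs0] at hl4
  have hadd : Exec (.add 2 2 (7 + R)) (s1.setReg 2 0) ((s1.setReg 2 0).setReg 2 m)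
      (1 + Nat.size 0 + m.size) := by
    have := Exec.add (s1.setReg 2 0) 2 2 (7 + R)
    simpa [hv1, show 7 + R ≠ 2 by omega] using this
  refine ⟨s4, _, .seq he1 (.seq (.const ..) (.seq hadd (.seq (.const ..) (.seq (.const ..)
    (.seq he3 he4))))), ?_, ?_⟩
  · have z1 := size_le_self m
    have h5 : (m + 1) * (1 + m + (U (M x) + (1 + τ) * E (M x))) ≤
        (1 + τ) * ((Bn (M x) + 1) * (1 + Bn (M x) + U (M x) + E (M x))) := by
      calc _ ≤ (Bn (M x) + 1) * ((1 + τ) * (1 + Bn (M x) + U (M x) + E (M x))) := by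
            refine Nat.mul_le_mul (by omega) ?_
            have : (1 + τ) * (1 + Bn (M x) + U (M x) + E (M x)) = 1 + Bn (M x) + U (M x) +
              (1 + τ) * E (M x) + τ * (1 + Bn (M x) + U (M x)) := by ring
            omega
        _ = _ := by ring
    have h6 : t1 + (1 + Nat.size 0 + (1 + Nat.size 0 + m.size + (1 + Nat.size 1 +
        (1 + Nat.size 1 + (t3 + t4))))) ≤ (1 + τ) * P (M x) := by
      have : (1 + τ) * P (M x) = (Bn (M x) + BG (M x) + 2 * Bn (M x) + 20) +
          τ * (Bn (M x) + BG (M x) + 2 * Bn (M x) + 20) +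
          (1 + τ) * ((Bn (M x) + 1) * (1 + Bn (M x) + U (M x) + E (M x))) := by
        simp only [P]; ring
      simp only [Nat.size_zero, Nat.size_one]
      omega
    have h7 : (τ : ℝ) ≤ T x := Nat.floor_le (hT x)
    have h8 : ((P (M x) : ℕ) : ℝ) ≤ ((M x : ℝ) + 2) ^ c := by exact_mod_cast hc (M x)
    calc _ ≤ (((1 + τ) * P (M x) : ℕ) : ℝ) := Nat.cast_le.2 h6
      _ = (1 + (τ : ℝ)) * (P (M x) : ℝ) := by push_cast; ring
      _ ≤ _ := mul_le_mul (by linarith) h8 (by positivity) (by linarith [hT x])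
  · have hout : s4.mem 1 = word (G w (s3.mem 2) (fun _ => 0)) := by
      funext j
      rw [hl4, hs1]
      simp only [word]
      split_ifs with h
      · rfl
      · rw [List.getD_eq_default _ _ (by omega)]
    rw [hout]
    exact hfinal x _ hs2

end RAM

namespace RAM

/-! ## Reading encoded lists -/

/-- The cell in which the `i`-th list starts, if an encoded list of lists starts in the cell `p`. -/
def listPos (w : ℕ → ℕ) (p i : ℕ) : ℕ := Nat.rec (p + 1) (fun _ a => a + w a + 1) i

/-- `y` is a member of the `i`-th list. -/
def InList (w : ℕ → ℕ) (p i y : ℕ) : Prop :=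
  ∃ k < w (listPos w p i), w (listPos w p i + 1 + k) = y

theorem PolyComputable.listPos {f g : Fn} (hf : PolyComputable f) (hg : PolyComputable g) :
    PolyComputable (fun w v e => RAM.listPos w (f w v e) (g w v e)) := by
  refine PolyComputable.comp₂ (h := fun w _ p i => RAM.listPos w p i) ?_ hf hg
  refine PolyComputable.iter (n := fun w v e => e 1) (a := fun w v e => e 0 + 1)
    (g := fun w _ _ _ a => a + w a + 1) (B := fun M => M + 1 + M * (M + 1)) (.var 1)
    ((var 0).add (.const 1)) (((var 0).add (inp (.var 0))).add (.const 1))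
    ((PolyBounded.id.add (.const 1)).add (PolyBounded.id.mul (PolyBounded.id.add (.const 1)))) ?_
  intro M w v e h i hi
  have key : ∀ i : ℕ, (Nat.rec (e 0 + 1) (fun _ a => a + w a + 1) i : ℕ) ≤
      e 0 + 1 + i * (M + 1) := by
    intro i
    induction i with
    | zero => simp
    | succ i ih =>
      have := h.1 (Nat.rec (e 0 + 1) (fun _ a => a + w a + 1) i)
      simp only
      rw [Nat.succ_mul]
      omega
  have h0 := h.2.2 0
  have h1 := h.2.2 1
  exact (key i).trans (add_le_add (by omega) (Nat.mul_le_mul_right _ (by omega)))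

theorem PolyDecidable.inList {f g k : Fn} (hf : PolyComputable f) (hg : PolyComputable g)
    (hk : PolyComputable k) :
    PolyDecidable (fun w v e => InList w (f w v e) (g w v e) (k w v e)) :=
  .exists_lt (.inp (.listPos hf hg))
    (.eq (.inp ((PolyComputable.add (.listPos hf.tail hg.tail) (.const 1)).add (.var 0))) hk.tail)

/-- The words `pre` and `post` are arbitrary, so that either of the two lists of lists of an encoded
instance can be read in this way. -/
theorem listPos_eq {w : ℕ → ℕ} {pre post : List ℕ} {L : List (List ℕ)}
    (hw : w = word (pre ++ (encodeLists L ++ post))) (i : ℕ) (hi : i ≤ L.length) :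
    listPos w pre.length i =
      pre.length + 1 + ((L.take i).flatMap (fun l => l.length :: l)).length ∧
    ∀ h : i < L.length, w (listPos w pre.length i) = L[i].length ∧
      ∀ k (hk : k < L[i].length), w (listPos w pre.length i + 1 + k) = L[i][k] := by
  have key : ∀ i (h : i < L.length), w = word ((pre ++ L.length ::
      (L.take i).flatMap (fun l => l.length :: l)) ++ (L[i].length :: (L[i] ++
        ((L.drop (i + 1)).flatMap (fun l => l.length :: l) ++ post)))) := by
    intro i h
    rw [hw]
    congr 1
    have h1 : L = L.take i ++ L[i] :: L.drop (i + 1) := by simp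
    have h2 : L.flatMap (fun l => l.length :: l) = (L.take i).flatMap (fun l => l.length :: l) ++
        (L[i].length :: L[i] ++ (L.drop (i + 1)).flatMap (fun l => l.length :: l)) := by
      conv_lhs => rw [h1, List.flatMap_append, List.flatMap_cons]
    rw [encodeLists, h2]
    simp
  have hval : ∀ i (h : i < L.length),
      w (pre.length + 1 + ((L.take i).flatMap (fun l => l.length :: l)).length) = L[i].length ∧
      ∀ k (hk : k < L[i].length), w (pre.length + 1 +
        ((L.take i).flatMap (fun l => l.length :: l)).length + 1 + k) = L[i][k] := by
    intro i h
    have hl : (pre ++ L.length :: (L.take i).flatMap (fun l => l.length :: l)).length =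
        pre.length + 1 + ((L.take i).flatMap (fun l => l.length :: l)).length := by
      simp; omega
    refine ⟨?_, fun k hk => ?_⟩
    · conv_lhs => rw [key i h]
      rw [word, List.getD_append_right _ _ _ _ (by omega), hl]
      simp
    · conv_lhs => rw [key i h]
      rw [word, List.getD_append_right _ _ _ _ (by omega), hl,
        show ∀ a : ℕ, a + 1 + k - a = k + 1 by omega, List.getD_cons_succ,
        List.getD_append _ _ _ _ hk, List.getD_eq_getElem _ _ hk]
  have hpos : ∀ i ≤ L.length, listPos w pre.length i =
      pre.length + 1 + ((L.take i).flatMap (fun l => l.length :: l)).length := by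
    intro i
    induction i with
    | zero => intro _; simp [listPos]
    | succ i ih =>
      intro hi
      have h : listPos w pre.length (i + 1) =
        listPos w pre.length i + w (listPos w pre.length i) + 1 := rfl
      rw [h, ih (by omega), (hval i (by omega)).1, List.take_succ_eq_append_getElem (by omega)]
      simp only [List.flatMap_append, List.length_append, List.flatMap_cons, List.flatMap_nil,
        List.length_nil, List.length_cons]
      omega
  refine ⟨hpos i hi, fun h => ?_⟩
  rw [hpos i hi]
  exact hval i h

/-- The memory `w` starts with the encoding of a number and two lists of lists. -/
structure Encodes (w : ℕ → ℕ) (n : ℕ) (A B : List (List ℕ)) : Prop where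
  eq : w = word (n :: (encodeLists A ++ encodeLists B))

namespace Encodes

variable {w : ℕ → ℕ} {n : ℕ} {A B : List (List ℕ)}

theorem zero (h : Encodes w n A B) : w 0 = n := by rw [h.eq]; rfl

theorem one (h : Encodes w n A B) : w 1 = A.length := by rw [h.eq]; rfl

/-- One step beyond the last list of the first family is the place where the second family starts;
this is how the bags are located. -/
theorem bagPos (h : Encodes w n A B) : listPos w 1 (w 1) = 1 + (encodeLists A).length := by
  have := (listPos_eq (pre := [n]) (post := encodeLists B) (L := A) (w := w)
    (by rw [h.eq]; rfl) A.length le_rfl).1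
  rw [List.take_length] at this
  rw [h.one]
  refine this.trans ?_
  simp [encodeLists]; omega

theorem eq_append (h : Encodes w n A B) :
    w = word ((n :: encodeLists A) ++ (encodeLists B ++ [])) := by
  rw [h.eq]; simp

theorem numBags (h : Encodes w n A B) : w (listPos w 1 (w 1)) = B.length := by
  rw [h.bagPos, h.eq_append, word, List.getD_append_right _ _ _ _ (by simp [add_comm])]
  simp [encodeLists, add_comm]

theorem inList_iff_aux {w : ℕ → ℕ} {pre post : List ℕ} {L : List (List ℕ)}
    (hw : w = word (pre ++ (encodeLists L ++ post))) (i : ℕ) (hi : i < L.length) (y : ℕ) :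
    InList w pre.length i y ↔ y ∈ L[i] := by
  obtain ⟨h1, h2⟩ := (listPos_eq hw i hi.le).2 hi
  unfold InList
  rw [List.mem_iff_getElem, h1]
  exact ⟨fun ⟨k, hk, h⟩ => ⟨k, hk, (h2 k hk).symm.trans h⟩,
    fun ⟨k, hk, h⟩ => ⟨k, hk, (h2 k hk).trans h⟩⟩

theorem inList_fst (h : Encodes w n A B) (i : ℕ) (hi : i < A.length) (y : ℕ) :
    InList w 1 i y ↔ y ∈ A[i] :=
  inList_iff_aux (pre := [n]) (post := encodeLists B) (by rw [h.eq]; rfl) i hi y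

theorem inList_snd (h : Encodes w n A B) (i : ℕ) (hi : i < B.length) (y : ℕ) :
    InList w (listPos w 1 (w 1)) i y ↔ y ∈ B[i] := by
  have := inList_iff_aux h.eq_append i hi y
  rw [h.bagPos]
  simpa [add_comm] using this

theorem entry_fst (h : Encodes w n A B) (i : ℕ) (hi : i < A.length) :
    w (listPos w 1 i) = A[i].length ∧
      ∀ k (hk : k < A[i].length), w (listPos w 1 i + 1 + k) = A[i][k] :=
  (listPos_eq (pre := [n]) (post := encodeLists B) (by rw [h.eq]; rfl) i hi.le).2 hi

end Encodes

theorem PolyList.encodeLists {n : Fn} {H : (ℕ → ℕ) → (ℕ → ℕ) → (ℕ → ℕ) → ℕ → List ℕ}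
    (hn : PolyComputable n) (hH : PolyList (fun w v e => H w v (fun k => e (k + 1)) (e 0))) :
    PolyList (fun w v e => encodeLists ((List.range (n w v e)).map (H w v e))) :=
  (PolyList.cons hn (PolyList.flatMap
    (H := fun w v e i => (H w v e i).length :: H w v e i) hn (.cons hH.1 hH))).of_eq
    fun w v e => by simp [_root_.encodeLists, List.flatMap_map]

end RAM

/-! ## Sweeping over a path decomposition -/

/-- Every one of `t` bags is visited `m + 1` times, and at every visit `n + 1` elements are visited.
Here `B i y` means that the element `y` lies in the `i`-th bag. -/
structure Sweep where
  n : ℕ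
  m : ℕ
  t : ℕ
  B : ℕ → ℕ → Prop
  lt_of_mem : ∀ i y, B i y → i < t

namespace Sweep

variable (S : Sweep)

/-- Steps are numbered so that adding `X` keeps the element and advances the item, passing to the
next bag after the last item. There is one bag, one item and one element too many. The dummies keep
`Q` positive for empty data, and since the bag `t` is empty, no link leaves the range of the steps.
-/
def X : ℕ := S.n + 1
def Q : ℕ := (S.t + 1) * (S.m + 1) * S.X
def bag (q : ℕ) : ℕ := q / S.X / (S.m + 1)
def item (q : ℕ) : ℕ := q / S.X % (S.m + 1)
def elt (q : ℕ) : ℕ := q % S.X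
def pos (i j x : ℕ) : ℕ := (i * (S.m + 1) + j) * S.X + x
def Live (q : ℕ) : Prop := S.elt q < S.n ∧ S.B (S.bag q) (S.elt q)
def Link (q : ℕ) : Prop := S.Live q ∧ S.Live (q + S.X)
def Prev (q : ℕ) : Prop := S.X ≤ q ∧ S.Link (q - S.X)

def Convex : Prop := ∀ y i j k, i ≤ j → j ≤ k → S.B i y → S.B k y → S.B j y

theorem X_pos : 0 < S.X := Nat.succ_pos _

theorem item_le (q : ℕ) : S.item q ≤ S.m := Nat.lt_succ_iff.1 (Nat.mod_lt _ (Nat.succ_pos _))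

theorem elt_add (q : ℕ) : S.elt (q + S.X) = S.elt q := Nat.add_mod_right _ _

theorem bag_mono {q q' : ℕ} (h : q ≤ q') : S.bag q ≤ S.bag q' :=
  Nat.div_le_div_right (Nat.div_le_div_right h)

theorem bag_lt {q : ℕ} : S.bag q < S.t + 1 ↔ q < S.Q := by
  rw [bag, Q, Nat.div_lt_iff_lt_mul (Nat.succ_pos _), Nat.div_lt_iff_lt_mul S.X_pos]

theorem pos_div {i j x : ℕ} (hx : x ≤ S.n) : S.pos i j x / S.X = i * (S.m + 1) + j := by
  rw [pos, mul_comm, Nat.mul_add_div S.X_pos, Nat.div_eq_of_lt (show x < S.X from Nat.lt_succ_of_le hx), add_zero]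

theorem bag_pos {i j x : ℕ} (hj : j ≤ S.m) (hx : x ≤ S.n) : S.bag (S.pos i j x) = i := by
  rw [bag, S.pos_div hx, mul_comm, Nat.mul_add_div (Nat.succ_pos _),
    Nat.div_eq_of_lt (Nat.lt_succ_of_le hj), add_zero]

theorem item_pos {i j x : ℕ} (hj : j ≤ S.m) (hx : x ≤ S.n) : S.item (S.pos i j x) = j := by
  rw [item, S.pos_div hx, mul_comm, Nat.mul_add_mod, Nat.mod_eq_of_lt (Nat.lt_succ_of_le hj)]

theorem elt_pos {i j x : ℕ} (hx : x ≤ S.n) : S.elt (S.pos i j x) = x := by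
  rw [elt, pos, mul_comm, Nat.mul_add_mod, Nat.mod_eq_of_lt (show x < S.X from Nat.lt_succ_of_le hx)]

theorem pos_lt {i j x : ℕ} (hi : i ≤ S.t) (hj : j ≤ S.m) (hx : x ≤ S.n) : S.pos i j x < S.Q := by
  rw [← S.bag_lt, S.bag_pos hj hx]; omega

theorem Live.lt {q : ℕ} (h : S.Live q) : q < S.Q := by
  rw [← S.bag_lt]; exact (S.lt_of_mem _ _ h.2).trans (Nat.lt_succ_self _)

theorem Link.lt {q : ℕ} (h : S.Link q) : q + S.X < S.Q := Live.lt S h.2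

variable {S}

theorem Convex.live (hS : S.Convex) {q d d' : ℕ} (hd : d ≤ d') (h : S.Live q)
    (h' : S.Live (q + d' * S.X)) : S.Live (q + d * S.X) := by
  have e : ∀ d, S.elt (q + d * S.X) = S.elt q := fun d => Nat.add_mul_mod_self_right _ _ _
  refine ⟨by rw [e]; exact h.1, ?_⟩
  rw [e]
  have h2 := h'.2
  rw [e] at h2
  exact hS _ _ _ _ (S.bag_mono (Nat.le_add_right _ _))
    (S.bag_mono (Nat.add_le_add_left (Nat.mul_le_mul_right _ hd) _)) h.2 h2

theorem exists_eq_add {q q' : ℕ} (h : q ≤ q') (he : S.elt q = S.elt q') :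
    ∃ d, q' = q + d * S.X := by
  obtain ⟨d, hd⟩ := (Nat.modEq_iff_dvd' h).1 he
  exact ⟨d, by rw [mul_comm]; omega⟩

/-- What does not change along links is constant on the visits of an element. -/
theorem Convex.iff_of_link (hS : S.Convex) {o : ℕ → Prop}
    (ho : ∀ q, S.Link q → (o q ↔ o (q + S.X))) {q q' : ℕ} (hle : q ≤ q') (he : S.elt q = S.elt q')
    (h : S.Live q) (h' : S.Live q') : o q ↔ o q' := by
  obtain ⟨d, rfl⟩ := exists_eq_add hle he
  clear hle he
  induction d with
  | zero => simp
  | succ d ih =>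
    have h1 := hS.live (Nat.le_succ d) h h'
    have e : q + (d + 1) * S.X = q + d * S.X + S.X := by ring
    rw [ih h1, ho _ ⟨h1, by rwa [← e]⟩, e]

open Classical in
/-- The number of links that are open at a given time. -/
theorem Convex.card_links_le (hS : S.Convex) (q : ℕ) :
    ((Finset.range S.Q).filter (fun q' => S.Link q' ∧ q' ≤ q ∧ q ≤ q' + S.X)).card ≤
      ((Finset.range S.n).filter (S.B (S.bag q))).card + 1 := by
  set s := (Finset.range S.Q).filter (fun q' => S.Link q' ∧ q' ≤ q ∧ q ≤ q' + S.X)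
  -- At time `q` a link ending there and a link starting there are both open; the only link that can
  -- end exactly at `q` starts at `q - X`. It accounts for the additional one in the bound, and the
  -- other open links are counted by their elements.
  have h1 : s ⊆ insert (q - S.X) (s.filter (fun q' => q < q' + S.X)) := by
    intro q' hq'
    have h2 := hq'
    simp only [s, Finset.mem_filter] at h2
    rw [Finset.mem_insert, Finset.mem_filter]
    by_cases h : q < q' + S.X
    · exact Or.inr ⟨hq', h⟩
    · left; omega
  refine (Finset.card_le_card h1).trans ((Finset.card_insert_le _ _).trans
    (Nat.succ_le_succ ?_))
  refine Finset.card_le_card_of_injOn S.elt ?_ ?_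
  · intro q' hq'
    simp only [s, Finset.coe_filter, Finset.mem_filter, Finset.mem_range, Set.mem_ofPred_eq] at hq'
    obtain ⟨⟨_, ⟨hl, hl'⟩, h3, _⟩, h4⟩ := hq'
    have h5 := hl'.2
    rw [S.elt_add] at h5
    simp only [Finset.coe_filter, Finset.mem_range, Set.mem_ofPred_eq]
    exact ⟨hl.1, hS _ _ _ _ (S.bag_mono h3) (S.bag_mono h4.le) hl.2 h5⟩
  · have key : ∀ a b : ℕ, a ≤ b → S.elt a = S.elt b → b ≤ q → q < a + S.X → a = b := by
      intro a b hle hab hb ha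
      obtain ⟨d, rfl⟩ := exists_eq_add hle hab
      rcases d with _ | d
      · simp
      · have : (d + 1) * S.X = d * S.X + S.X := by ring
        have := Nat.zero_le (d * S.X)
        omega
    intro a ha b hb hab
    simp only [s, Finset.coe_filter, Finset.mem_filter, Set.mem_ofPred_eq] at ha hb
    rcases le_total a b with h | h
    · exact key a b h hab hb.1.2.2.1 ha.2
    · exact (key b a h hab.symm ha.1.2.2.1 hb.2).symm

end Sweep

/-! ## Formulas with a cardinality constraint -/

/-- The literal `2 * v + 1` is the variable `v`, and `2 * v` is its negation. -/
def LitTrue (α : ℕ → Bool) (c : ℕ) : Prop := α (c / 2) = true ↔ c % 2 = 1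

/-- The opposite literal. -/
def negLit (c : ℕ) : ℕ := if c % 2 = 0 then c + 1 else c - 1

theorem litTrue_pos {α : ℕ → Bool} {v : ℕ} : LitTrue α (2 * v + 1) ↔ α v = true := by
  have h1 : (2 * v + 1) / 2 = v := by omega
  have h2 : (2 * v + 1) % 2 = 1 := by omega
  simp [LitTrue, h1, h2]

theorem litTrue_neg {α : ℕ → Bool} {v : ℕ} : LitTrue α (2 * v) ↔ α v = false := by
  simp [LitTrue]

theorem litTrue_negLit {α : ℕ → Bool} {c : ℕ} : LitTrue α (negLit c) ↔ ¬ LitTrue α c := by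
  unfold negLit
  rcases Nat.even_or_odd' c with ⟨k, rfl | rfl⟩
  · rw [if_pos (by omega), litTrue_pos, litTrue_neg]; simp
  · rw [if_neg (by omega), Nat.add_sub_cancel, litTrue_pos, litTrue_neg]; simp

theorem negLit_div (c : ℕ) : negLit c / 2 = c / 2 := by
  unfold negLit; split_ifs <;> omega

theorem LitTrue.congr {α β : ℕ → Bool} {c : ℕ} (h : α (c / 2) = β (c / 2)) :
    LitTrue α c ↔ LitTrue β c := by
  simp [LitTrue, h]

def pick (r a b c : ℕ) : ℕ := if r = 0 then a else if r = 1 then b else c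

theorem exists_pick {P : ℕ → Prop} {a b c : ℕ} :
    (∃ r < 3, P (pick r a b c)) ↔ P a ∨ P b ∨ P c := by
  constructor
  · rintro ⟨r, hr, h⟩
    interval_cases r <;> simp [pick] at h <;> tauto
  · rintro (h | h | h)
    · exact ⟨0, by omega, by simpa [pick]⟩
    · exact ⟨1, by omega, by simpa [pick]⟩
    · exact ⟨2, by omega, by simpa [pick]⟩

/-- A formula that says: the variable `Z` is false, the clauses `c1 q` and `c2 q` hold for all
`q < Q`, and `init` plus the number of true literals among `z 0, …, z (Q - 1)` is less than `2 ^ L`.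
The binary digits of the partial sums and the carries are the variables `bit q l` and
`carry q l`. -/
structure Counter where
  L : ℕ
  Q : ℕ
  Z : ℕ
  init : ℕ
  z : ℕ → ℕ
  c1 : ℕ → ℕ → ℕ
  c2 : ℕ → ℕ → ℕ

namespace Counter

variable (G : Counter)

/-- In each block the places `1, …, L` are the digits and `L + 1, …, 2 * L + 1` the carries. Place
`0` is left free for the application. -/
def W : ℕ := 2 * G.L + 2
def numClauses : ℕ := 3 * G.L + 5
def bit (q l : ℕ) : ℕ := q * G.W + (1 + l)
def carry (q l : ℕ) : ℕ := q * G.W + (G.L + 1 + l)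

/-- The literal for the `l`-th digit before step `q`. -/
def prevBit (q l : ℕ) : ℕ :=
  if q = 0 then (if G.init / 2 ^ l % 2 = 1 then 2 * G.Z else 2 * G.Z + 1)
  else 2 * G.bit (q - 1) l + 1

/-- The `r`-th literal of the `s`-th clause of step `q`. -/
def clauseLit (q s r : ℕ) : ℕ :=
  -- Only lower bounds are expressed: a carry meeting the digit 1 forces a carry, and an odd sum of
  -- digit and carry forces the digit 1. No clause forces a digit to be 0, since larger digits only
  -- make it harder to avoid an overflow.
  if s < G.L then
    pick r (2 * G.carry q s) (negLit (G.prevBit q s)) (2 * G.carry q (s + 1) + 1)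
  else if s < 2 * G.L then
    pick r (2 * G.carry q (s - G.L)) (G.prevBit q (s - G.L)) (2 * G.bit q (s - G.L) + 1)
  else if s < 3 * G.L then
    pick r (2 * G.carry q (s - 2 * G.L) + 1) (negLit (G.prevBit q (s - 2 * G.L)))
      (2 * G.bit q (s - 2 * G.L) + 1)
  else if s = 3 * G.L then pick r (negLit (G.z q)) (2 * G.carry q 0 + 1) (2 * G.carry q 0 + 1)
  else if s = 3 * G.L + 1 then 2 * G.carry q G.L
  else if s = 3 * G.L + 2 then 2 * G.Z
  else if s = 3 * G.L + 3 then G.c1 q r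
  else G.c2 q r

def lit (p r : ℕ) : ℕ := G.clauseLit (p / G.numClauses) (p % G.numClauses) r

def Sat (α : ℕ → Bool) : Prop := ∀ p < G.Q * G.numClauses, ∃ r < 3, LitTrue α (G.lit p r)

variable {G}

theorem sat_iff {α : ℕ → Bool} :
    G.Sat α ↔ ∀ q < G.Q, ∀ s < G.numClauses, ∃ r < 3, LitTrue α (G.clauseLit q s r) := by
  have hP : 0 < G.numClauses := Nat.succ_pos _
  constructor
  · intro h q hq s hs
    have h1 : (q * G.numClauses + s) / G.numClauses = q := by
      rw [mul_comm, Nat.mul_add_div hP, Nat.div_eq_of_lt hs, add_zero]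
    have h2 : (q * G.numClauses + s) % G.numClauses = s := by
      rw [mul_comm, Nat.mul_add_mod, Nat.mod_eq_of_lt hs]
    have := h (q * G.numClauses + s) (by
      calc q * G.numClauses + s < q * G.numClauses + G.numClauses := by omega
        _ = (q + 1) * G.numClauses := by ring
        _ ≤ _ := Nat.mul_le_mul_right _ hq)
    simpa only [lit, h1, h2] using this
  · intro h p hp
    exact h _ ((Nat.div_lt_iff_lt_mul hP).2 hp) _ (Nat.mod_lt _ hP)

theorem sat_iff' {α : ℕ → Bool} : G.Sat α ↔ ∀ q < G.Q,
    (∀ l < G.L,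
      (α (G.carry q l) = false ∨ ¬ LitTrue α (G.prevBit q l) ∨ α (G.carry q (l + 1)) = true) ∧
      (α (G.carry q l) = false ∨ LitTrue α (G.prevBit q l) ∨ α (G.bit q l) = true) ∧
      (α (G.carry q l) = true ∨ ¬ LitTrue α (G.prevBit q l) ∨ α (G.bit q l) = true)) ∧
    (¬ LitTrue α (G.z q) ∨ α (G.carry q 0) = true) ∧ α (G.carry q G.L) = false ∧
    α G.Z = false ∧ (∃ r < 3, LitTrue α (G.c1 q r)) ∧ (∃ r < 3, LitTrue α (G.c2 q r)) := by
  have hr : ∀ {p : Prop}, (∃ r < 3, p) ↔ p := fun {p} =>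
    ⟨fun ⟨_, _, h⟩ => h, fun h => ⟨0, by omega, h⟩⟩
  rw [sat_iff]
  refine forall₂_congr fun q _ => ?_
  constructor
  · intro h
    refine ⟨fun l hl => ⟨?_, ?_, ?_⟩, ?_, ?_, ?_, ?_, ?_⟩
    · have := h l (by simp only [numClauses]; omega)
      simpa only [clauseLit, if_pos hl, exists_pick, litTrue_negLit, litTrue_pos, litTrue_neg] using this
    · have := h (G.L + l) (by simp only [numClauses]; omega)
      simp only [clauseLit, if_neg (show ¬ G.L + l < G.L by omega),
        if_pos (show G.L + l < 2 * G.L by omega), exists_pick, litTrue_pos,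
        litTrue_neg, Nat.add_sub_cancel_left] at this
      exact this
    · have := h (2 * G.L + l) (by simp only [numClauses]; omega)
      simp only [clauseLit, if_neg (show ¬ 2 * G.L + l < G.L by omega),
        if_neg (show ¬ 2 * G.L + l < 2 * G.L by omega),
        if_pos (show 2 * G.L + l < 3 * G.L by omega), exists_pick, litTrue_negLit, litTrue_pos,
        Nat.add_sub_cancel_left] at this
      exact this
    · have := h (3 * G.L) (by simp only [numClauses]; omega)
      simp only [clauseLit, if_neg (show ¬ 3 * G.L < G.L by omega),
        if_neg (show ¬ 3 * G.L < 2 * G.L by omega), lt_irrefl,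
        if_false, if_true, exists_pick, litTrue_negLit, litTrue_pos] at this
      tauto
    · have := h (3 * G.L + 1) (by simp only [numClauses]; omega)
      simp only [clauseLit, if_neg (show ¬ 3 * G.L + 1 < G.L by omega),
        if_neg (show ¬ 3 * G.L + 1 < 2 * G.L by omega),
        if_neg (show ¬ 3 * G.L + 1 < 3 * G.L by omega),
        if_neg (show ¬ 3 * G.L + 1 = 3 * G.L by omega), if_true, litTrue_neg, hr] at this
      exact this
    · have := h (3 * G.L + 2) (by simp only [numClauses]; omega)
      simp only [clauseLit, if_neg (show ¬ 3 * G.L + 2 < G.L by omega),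
        if_neg (show ¬ 3 * G.L + 2 < 2 * G.L by omega),
        if_neg (show ¬ 3 * G.L + 2 < 3 * G.L by omega),
        if_neg (show ¬ 3 * G.L + 2 = 3 * G.L by omega),
        if_neg (show ¬ 3 * G.L + 2 = 3 * G.L + 1 by omega), if_true, litTrue_neg, hr] at this
      exact this
    · have := h (3 * G.L + 3) (by simp only [numClauses]; omega)
      simpa only [clauseLit, if_neg (show ¬ 3 * G.L + 3 < G.L by omega),
        if_neg (show ¬ 3 * G.L + 3 < 2 * G.L by omega),
        if_neg (show ¬ 3 * G.L + 3 < 3 * G.L by omega),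
        if_neg (show ¬ 3 * G.L + 3 = 3 * G.L by omega),
        if_neg (show ¬ 3 * G.L + 3 = 3 * G.L + 1 by omega),
        if_neg (show ¬ 3 * G.L + 3 = 3 * G.L + 2 by omega), if_true] using this
    · have := h (3 * G.L + 4) (by simp only [numClauses]; omega)
      simpa only [clauseLit, if_neg (show ¬ 3 * G.L + 4 < G.L by omega),
        if_neg (show ¬ 3 * G.L + 4 < 2 * G.L by omega),
        if_neg (show ¬ 3 * G.L + 4 < 3 * G.L by omega),
        if_neg (show ¬ 3 * G.L + 4 = 3 * G.L by omega),
        if_neg (show ¬ 3 * G.L + 4 = 3 * G.L + 1 by omega),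
        if_neg (show ¬ 3 * G.L + 4 = 3 * G.L + 2 by omega),
        if_neg (show ¬ 3 * G.L + 4 = 3 * G.L + 3 by omega)] using this
  · rintro ⟨h1, h2, h3, h4, h5, h6⟩ s hs
    simp only [numClauses] at hs
    unfold clauseLit
    split_ifs with a1 a2 a3 a4 a5 a6 a7
    · simpa only [exists_pick, litTrue_negLit, litTrue_pos, litTrue_neg] using (h1 s a1).1
    · simpa only [exists_pick, litTrue_negLit, litTrue_pos, litTrue_neg] using
        (h1 (s - G.L) (by omega)).2.1
    · simpa only [exists_pick, litTrue_negLit, litTrue_pos, litTrue_neg] using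
        (h1 (s - 2 * G.L) (by omega)).2.2
    · simp only [exists_pick, litTrue_negLit, litTrue_pos]; tauto
    · simpa only [litTrue_neg, hr] using h3
    · simpa only [litTrue_neg, hr] using h4
    · exact h5
    · exact h6

theorem sum_bits (v L : ℕ) : ∑ l ∈ Finset.range L, 2 ^ l * (v / 2 ^ l % 2) = v % 2 ^ L := by
  induction L with
  | zero => simp [Nat.mod_one]
  | succ L ih => rw [Finset.sum_range_succ, ih, Nat.mod_pow_succ]

-- The number `val q` formed by the digits grows in each step at least by the counted literal. The
-- clauses yield inequalities only, but in the direction that matters, and `L` digits cannot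
-- represent `2 ^ L`.
open Classical in
theorem Sat.count_lt {α : ℕ → Bool} (h : G.Sat α) (hinit : G.init < 2 ^ G.L) :
    G.init + ((Finset.range G.Q).filter (fun q => LitTrue α (G.z q))).card < 2 ^ G.L := by
  rw [sat_iff'] at h
  let a : ℕ → ℕ → ℕ := fun q l => if LitTrue α (G.prevBit q l) then 1 else 0
  let val : ℕ → ℕ := fun q => ∑ l ∈ Finset.range G.L, 2 ^ l * a q l
  have hval : ∀ q, val q < 2 ^ G.L := by
    intro q
    have h1 : val q ≤ ∑ l ∈ Finset.range G.L, 2 ^ l :=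
      Finset.sum_le_sum fun l _ => by
        have : a q l ≤ 1 := by simp only [a]; split_ifs <;> omega
        calc 2 ^ l * a q l ≤ 2 ^ l * 1 := Nat.mul_le_mul_left _ this
          _ = 2 ^ l := mul_one _
    have h2 := Nat.geomSum_eq (le_refl 2) G.L
    have h3 : 0 < 2 ^ G.L := by positivity
    simp at h2
    omega
  rcases Nat.eq_zero_or_pos G.Q with hQ | hQ
  · simpa [hQ] using hinit
  have hZ := (h 0 hQ).2.2.2.1
  have h0 : val 0 = G.init := by
    have : ∀ l, a 0 l = G.init / 2 ^ l % 2 := by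
      intro l
      simp only [a, prevBit, if_true]
      by_cases h1 : G.init / 2 ^ l % 2 = 1
      · rw [if_pos h1, if_pos (litTrue_neg.2 hZ), h1]
      · rw [if_neg h1, if_neg (fun h2 => by rw [litTrue_pos, hZ] at h2; cases h2)]; omega
    simp only [val, this]
    rw [sum_bits, Nat.mod_eq_of_lt hinit]
  have hstep : ∀ q < G.Q, val q + (if LitTrue α (G.z q) then 1 else 0) ≤ val (q + 1) := by
    intro q hq
    obtain ⟨h1, h2, h3, -⟩ := h q hq
    let c : ℕ → ℕ := fun l => if α (G.carry q l) = true then 1 else 0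
    -- Addition up to place `l`: the carry into that place is worth `2 ^ l`. At `l = L` the carry is
    -- forbidden, so nothing is lost.
    have key : ∀ l ≤ G.L, ∑ i ∈ Finset.range l, 2 ^ i * a q i + c 0 ≤
        ∑ i ∈ Finset.range l, 2 ^ i * a (q + 1) i + 2 ^ l * c l := by
      intro l
      induction l with
      | zero => simp
      | succ l ih =>
        intro hl
        have ih := ih (by omega)
        obtain ⟨e1, e2, e3⟩ := h1 l (by omega)
        have hb : a (q + 1) l = if α (G.bit q l) = true then 1 else 0 := by
          simp only [a, prevBit, Nat.succ_ne_zero, if_false, Nat.add_sub_cancel, litTrue_pos]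
        have h4 : c l + a q l ≤ a (q + 1) l + 2 * c (l + 1) := by
          rw [hb]
          simp only [c, a]
          rcases hx : α (G.carry q l) <;> rcases hy : α (G.bit q l) <;>
            rcases hw : α (G.carry q (l + 1)) <;> by_cases hp : LitTrue α (G.prevBit q l) <;>
            simp [hx, hy, hw, hp] at e1 e2 e3 ⊢
        have h5 := Nat.mul_le_mul_left (2 ^ l) h4
        rw [Finset.sum_range_succ, Finset.sum_range_succ, pow_succ]
        nlinarith
    have h4 := key G.L le_rfl
    have h5 : c G.L = 0 := by simp [c, h3]
    have h6 : (if LitTrue α (G.z q) then 1 else 0) ≤ c 0 := by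
      simp only [c]
      rcases h2 with h2 | h2 <;> simp [h2]
      split_ifs <;> omega
    rw [h5, mul_zero, add_zero] at h4
    simp only [val]
    omega
  have hsum : ∀ k ≤ G.Q, G.init +
      ((Finset.range k).filter (fun q => LitTrue α (G.z q))).card ≤ val k := by
    intro k
    induction k with
    | zero => simp [h0]
    | succ k ih =>
      intro hk
      have := ih (by omega)
      have h7 := hstep k (by omega)
      rw [Finset.range_add_one, Finset.filter_insert]
      split_ifs with hc
      · rw [Finset.card_insert_of_notMem (by simp)]
        rw [if_pos hc] at h7; omega
      · rw [if_neg hc] at h7; omega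
  exact (hsum G.Q le_rfl).trans_lt (hval _)

/-- The variables that are not used for digits and carries. -/
def Free (G : Counter) (v : ℕ) : Prop := ¬ (v < G.Q * G.W ∧ v % G.W ≠ 0)

-- Digits and carries are overwritten by those of the true partial sums. The literals supplied by
-- the application that are needed here involve free variables only, hence keep the values given by
-- `α₀`.
open Classical in
theorem exists_sat {α₀ : ℕ → Bool} (hZ : G.Q * G.W ≤ G.Z) (hZ' : α₀ G.Z = false)
    (hz : ∀ q < G.Q, G.Free (G.z q / 2))
    (h1 : ∀ q < G.Q, ∃ r < 3, G.Free (G.c1 q r / 2) ∧ LitTrue α₀ (G.c1 q r))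
    (h2 : ∀ q < G.Q, ∃ r < 3, G.Free (G.c2 q r / 2) ∧ LitTrue α₀ (G.c2 q r))
    (hcount : G.init + ((Finset.range G.Q).filter (fun q => LitTrue α₀ (G.z q))).card < 2 ^ G.L) :
    ∃ α, G.Sat α := by
  let run : ℕ → ℕ := fun q =>
    G.init + ((Finset.range q).filter (fun q => LitTrue α₀ (G.z q))).card
  have hrun : ∀ q, run (q + 1) = run q + if LitTrue α₀ (G.z q) then 1 else 0 := by
    intro q
    simp only [run, Finset.range_add_one, Finset.filter_insert]
    split_ifs with hc
    · rw [Finset.card_insert_of_notMem (by simp), add_assoc]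
    · rfl
  have hmono : ∀ q ≤ G.Q, run q < 2 ^ G.L := fun q hq =>
    (Nat.add_le_add_left (Finset.card_le_card (Finset.filter_subset_filter _
      (Finset.range_subset_range.2 hq))) _).trans_lt hcount
  -- A carry enters place `l` exactly when the quotient of the partial sum by `2 ^ l` increases; the
  -- quotient by `2 ^ (l + 1)` is obtained from it by one more halving, which reduces all clauses to
  -- statements about one digit.
  let α : ℕ → Bool := fun v => if v < G.Q * G.W ∧ v % G.W ≠ 0 then
    (if v % G.W ≤ G.L then decide (run (v / G.W + 1) / 2 ^ (v % G.W - 1) % 2 = 1)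
    else decide (run (v / G.W + 1) / 2 ^ (v % G.W - (G.L + 1)) =
      run (v / G.W) / 2 ^ (v % G.W - (G.L + 1)) + 1)) else α₀ v
  have hfree : ∀ v, G.Free v → α v = α₀ v := fun v hv => if_neg hv
  have hW : 0 < G.W := Nat.succ_pos _
  have hblock : ∀ q < G.Q, ∀ w < G.W, (q * G.W + w) / G.W = q ∧ (q * G.W + w) % G.W = w ∧
      q * G.W + w < G.Q * G.W := by
    intro q hq w hw
    refine ⟨by rw [mul_comm, Nat.mul_add_div hW, Nat.div_eq_of_lt hw, add_zero],
      by rw [mul_comm, Nat.mul_add_mod, Nat.mod_eq_of_lt hw], ?_⟩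
    calc q * G.W + w < q * G.W + G.W := by omega
      _ = (q + 1) * G.W := by ring
      _ ≤ _ := Nat.mul_le_mul_right _ hq
  have hbit : ∀ q < G.Q, ∀ l < G.L,
      α (G.bit q l) = decide (run (q + 1) / 2 ^ l % 2 = 1) := by
    intro q hq l hl
    obtain ⟨e1, e2, e3⟩ := hblock q hq (1 + l) (by simp only [W]; omega)
    simp only [α, bit, e1, e2, e3, true_and]
    rw [if_pos (by omega), if_pos (by omega), Nat.add_sub_cancel_left]
  have hcarry : ∀ q < G.Q, ∀ l ≤ G.L,
      α (G.carry q l) = decide (run (q + 1) / 2 ^ l = run q / 2 ^ l + 1) := by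
    intro q hq l hl
    obtain ⟨e1, e2, e3⟩ := hblock q hq (G.L + 1 + l) (by simp only [W]; omega)
    simp only [α, carry, e1, e2, e3, true_and]
    rw [if_pos (by omega), if_neg (by omega), Nat.add_sub_cancel_left]
  have hαZ : α G.Z = false := by
    rw [hfree _ (fun h => by omega), hZ']
  have hprev : ∀ q < G.Q, ∀ l < G.L, LitTrue α (G.prevBit q l) ↔ run q / 2 ^ l % 2 = 1 := by
    intro q hq l hl
    rcases q with _ | q
    · have : run 0 = G.init := by simp [run]
      simp only [prevBit, if_true, this]
      split_ifs with h
      · simp [litTrue_neg, hαZ, h]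
      · simp [litTrue_pos, hαZ, h]
    · simp only [prevBit, Nat.succ_ne_zero, if_false, Nat.add_sub_cancel, litTrue_pos]
      rw [hbit q (by omega) l hl]; simp
  have hdiv : ∀ q l, run q / 2 ^ l ≤ run (q + 1) / 2 ^ l ∧
      run (q + 1) / 2 ^ l ≤ run q / 2 ^ l + 1 := by
    intro q l
    have h3 := hrun q
    have h4 : run q ≤ run (q + 1) ∧ run (q + 1) ≤ run q + 1 := by split_ifs at h3 <;> omega
    refine ⟨Nat.div_le_div_right h4.1, (Nat.div_le_div_right h4.2).trans ?_⟩
    have hp : 0 < 2 ^ l := by positivity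
    rw [← Nat.add_div_right _ hp]
    exact Nat.div_le_div_right (by omega)
  refine ⟨α, sat_iff'.2 fun q hq => ⟨fun l hl => ?_, ?_, ?_, hαZ, ?_, ?_⟩⟩
  · rw [hprev q hq l hl, hbit q hq l hl, hcarry q hq l hl.le, hcarry q hq (l + 1) hl]
    simp only [decide_eq_true_eq, decide_eq_false_iff_not, pow_succ, ← Nat.div_div_eq_div_mul]
    have := hdiv q l
    refine ⟨?_, ?_, ?_⟩ <;> omega
  · rw [hcarry q hq 0 (Nat.zero_le _)]
    by_cases hc : LitTrue α₀ (G.z q)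
    · right; simp [hrun, hc]
    · left; rwa [LitTrue.congr (hfree _ (hz q hq))]
  · rw [hcarry q hq G.L le_rfl, Nat.div_eq_of_lt (hmono q hq.le), Nat.div_eq_of_lt (hmono _ hq)]
    simp
  · obtain ⟨r, hr, hf, h⟩ := h1 q hq
    exact ⟨r, hr, (LitTrue.congr (hfree _ hf)).2 h⟩
  · obtain ⟨r, hr, hf, h⟩ := h2 q hq
    exact ⟨r, hr, (LitTrue.congr (hfree _ hf)).2 h⟩

end Counter

/-! ### Computability of the counter formula and of the sweep -/

namespace RAM

theorem PolyComputable.bind₁ {h : (ℕ → ℕ) → (ℕ → ℕ) → (ℕ → ℕ) → ℕ → ℕ} {f : Fn}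
    (hh : PolyComputable (fun w v e => h w v (fun k => e (k + 1)) (e 0))) (hf : PolyComputable f) :
    PolyComputable (fun w v e => h w v e (f w v e)) :=
  hf.bind hh

theorem PolyComputable.bind₂ {h : (ℕ → ℕ) → (ℕ → ℕ) → (ℕ → ℕ) → ℕ → ℕ → ℕ} {f g : Fn}
    (hh : PolyComputable (fun w v e => h w v (fun k => e (k + 2)) (e 0) (e 1)))
    (hf : PolyComputable f) (hg : PolyComputable g) :
    PolyComputable (fun w v e => h w v e (f w v e) (g w v e)) :=
  hg.bind (hf.tail.bind hh)

theorem PolyDecidable.bind₁ {h : (ℕ → ℕ) → (ℕ → ℕ) → (ℕ → ℕ) → ℕ → Prop} {f : Fn}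
    (hh : PolyDecidable (fun w v e => h w v (fun k => e (k + 1)) (e 0))) (hf : PolyComputable f) :
    PolyDecidable (fun w v e => h w v e (f w v e)) :=
  hf.bind hh

theorem PolyDecidable.bind₂ {h : (ℕ → ℕ) → (ℕ → ℕ) → (ℕ → ℕ) → ℕ → ℕ → Prop} {f g : Fn}
    (hh : PolyDecidable (fun w v e => h w v (fun k => e (k + 2)) (e 0) (e 1)))
    (hf : PolyComputable f) (hg : PolyComputable g) :
    PolyDecidable (fun w v e => h w v e (f w v e) (g w v e)) :=
  hg.bind (hf.tail.bind hh)

theorem PolyDecidable.rename {p : (ℕ → ℕ) → (ℕ → ℕ) → (ℕ → ℕ) → Prop} (hp : PolyDecidable p)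
    (σ : ℕ → ℕ) : PolyDecidable (fun w v e => p w v (fun k => e (σ k))) :=
  PolyComputable.rename hp σ

namespace PolyComputable

theorem negLit {f : Fn} (hf : PolyComputable f) :
    PolyComputable (fun w v e => _root_.negLit (f w v e)) :=
  ite (.eq (hf.mod (.const 2)) (.const 0)) (hf.add (.const 1)) (hf.sub (.const 1))

theorem pick {r f g h : Fn} (hr : PolyComputable r) (hf : PolyComputable f)
    (hg : PolyComputable g) (hh : PolyComputable h) :
    PolyComputable (fun w v e => _root_.pick (r w v e) (f w v e) (g w v e) (h w v e)) :=
  ite (.eq hr (.const 0)) hf (ite (.eq hr (.const 1)) hg hh)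

theorem div_two_pow {f g : Fn} (hf : PolyComputable f) (hg : PolyComputable g) :
    PolyComputable (fun w v e => f w v e / 2 ^ g w v e) :=
  (hf.div (min_two_pow hg (hf.add (.const 1)))).of_eq fun w v e => by
    rcases le_total (2 ^ g w v e) (f w v e + 1) with h | h
    · rw [min_eq_left h]
    · rw [min_eq_right h, Nat.div_eq_of_lt (Nat.lt_succ_self _), Nat.div_eq_of_lt (by omega)]

theorem two_mul {f : Fn} (hf : PolyComputable f) : PolyComputable (fun w v e => 2 * f w v e) :=
  (const 2).mul hf

theorem succ {f : Fn} (hf : PolyComputable f) : PolyComputable (fun w v e => f w v e + 1) :=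
  hf.add (.const 1)

end PolyComputable

/-- A family of counters that can be computed in polynomial time. -/
structure PolyCounter (G : (ℕ → ℕ) → (ℕ → ℕ) → (ℕ → ℕ) → Counter) : Prop where
  L : PolyComputable (fun w v e => (G w v e).L)
  Q : PolyComputable (fun w v e => (G w v e).Q)
  Z : PolyComputable (fun w v e => (G w v e).Z)
  init : PolyComputable (fun w v e => (G w v e).init)
  z : PolyComputable (fun w v e => (G w v (fun k => e (k + 1))).z (e 0))
  c1 : PolyComputable (fun w v e => (G w v (fun k => e (k + 2))).c1 (e 0) (e 1))
  c2 : PolyComputable (fun w v e => (G w v (fun k => e (k + 2))).c2 (e 0) (e 1))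

namespace PolyCounter

variable {G : (ℕ → ℕ) → (ℕ → ℕ) → (ℕ → ℕ) → Counter} (hG : PolyCounter G) {f g k : Fn}
include hG

theorem W : PolyComputable (fun w v e => (G w v e).W) := hG.L.two_mul.add (.const 2)

theorem numClauses : PolyComputable (fun w v e => (G w v e).numClauses) :=
  ((PolyComputable.const 3).mul hG.L).add (.const 5)

theorem bit (hf : PolyComputable f) (hg : PolyComputable g) :
    PolyComputable (fun w v e => (G w v e).bit (f w v e) (g w v e)) :=
  (hf.mul hG.W).add ((PolyComputable.const 1).add hg)

theorem carry (hf : PolyComputable f) (hg : PolyComputable g) :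
    PolyComputable (fun w v e => (G w v e).carry (f w v e) (g w v e)) :=
  (hf.mul hG.W).add (hG.L.succ.add hg)

theorem prevBit (hf : PolyComputable f) (hg : PolyComputable g) :
    PolyComputable (fun w v e => (G w v e).prevBit (f w v e) (g w v e)) :=
  .ite (.eq hf (.const 0))
    (.ite (.eq ((hG.init.div_two_pow hg).mod (.const 2)) (.const 1)) hG.Z.two_mul hG.Z.two_mul.succ)
    (hG.bit (hf.sub (.const 1)) hg).two_mul.succ

theorem clauseLit (hf : PolyComputable f) (hg : PolyComputable g) (hk : PolyComputable k) :
    PolyComputable (fun w v e => (G w v e).clauseLit (f w v e) (g w v e) (k w v e)) := by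
  have h3 := (PolyComputable.const 3).mul hG.L
  have h1 := hg.sub hG.L
  have h2 := hg.sub hG.L.two_mul
  refine .ite (.lt hg hG.L) (.pick hk (hG.carry hf hg).two_mul (hG.prevBit hf hg).negLit
    (hG.carry hf hg.succ).two_mul.succ) (.ite (.lt hg hG.L.two_mul) (.pick hk
    (hG.carry hf h1).two_mul (hG.prevBit hf h1) (hG.bit hf h1).two_mul.succ) (.ite (.lt hg h3)
    (.pick hk (hG.carry hf h2).two_mul.succ (hG.prevBit hf h2).negLit
      (hG.bit hf h2).two_mul.succ) (.ite (.eq hg h3) (.pick hk ?_ ?_ ?_)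
    (.ite (.eq hg h3.succ) (hG.carry hf hG.L).two_mul (.ite (.eq hg (h3.add (.const 2)))
    hG.Z.two_mul (.ite (.eq hg (h3.add (.const 3))) ?_ ?_))))))
  · exact (PolyComputable.bind₁ (h := fun w v e q => (G w v e).z q) hG.z hf).negLit
  · exact (hG.carry hf (.const 0)).two_mul.succ
  · exact (hG.carry hf (.const 0)).two_mul.succ
  · exact .bind₂ (h := fun w v e q r => (G w v e).c1 q r) hG.c1 hf hk
  · exact .bind₂ (h := fun w v e q r => (G w v e).c2 q r) hG.c2 hf hk

theorem lit (hf : PolyComputable f) (hg : PolyComputable g) :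
    PolyComputable (fun w v e => (G w v e).lit (f w v e) (g w v e)) :=
  hG.clauseLit (hf.div hG.numClauses) (hf.mod hG.numClauses) hg

theorem rename (σ : ℕ → ℕ) : PolyCounter (fun w v e => G w v (fun k => e (σ k))) where
  L := hG.L.rename σ
  Q := hG.Q.rename σ
  Z := hG.Z.rename σ
  init := hG.init.rename σ
  z := hG.z.rename (fun k => match k with
    | 0 => 0
    | k + 1 => σ k + 1)
  c1 := hG.c1.rename (fun k => match k with
    | 0 => 0
    | 1 => 1
    | k + 2 => σ k + 2)
  c2 := hG.c2.rename (fun k => match k with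
    | 0 => 0
    | 1 => 1
    | k + 2 => σ k + 2)

end PolyCounter

/-- The sweep over the second list of lists in the memory. -/
def sweepOf (w : ℕ → ℕ) : Sweep where
  n := w 0
  m := w 1
  t := w (listPos w 1 (w 1))
  B i y := i < w (listPos w 1 (w 1)) ∧ InList w (listPos w 1 (w 1)) i y
  lt_of_mem _ _ h := h.1

namespace PolySweep

variable {f g k : Fn}

theorem n : PolyComputable (fun w _ _ => (sweepOf w).n) := .inp (.const 0)
theorem m : PolyComputable (fun w _ _ => (sweepOf w).m) := .inp (.const 1)
theorem t : PolyComputable (fun w _ _ => (sweepOf w).t) :=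
  .inp (.listPos (.const 1) (.inp (.const 1)))
theorem X : PolyComputable (fun w _ _ => (sweepOf w).X) := n.succ
theorem Q : PolyComputable (fun w _ _ => (sweepOf w).Q) := (t.succ.mul m.succ).mul X
theorem bag (hf : PolyComputable f) : PolyComputable (fun w v e => (sweepOf w).bag (f w v e)) :=
  (hf.div X).div m.succ
theorem item (hf : PolyComputable f) : PolyComputable (fun w v e => (sweepOf w).item (f w v e)) :=
  (hf.div X).mod m.succ
theorem elt (hf : PolyComputable f) : PolyComputable (fun w v e => (sweepOf w).elt (f w v e)) :=
  hf.mod X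
theorem B (hf : PolyComputable f) (hg : PolyComputable g) :
    PolyDecidable (fun w v e => (sweepOf w).B (f w v e) (g w v e)) :=
  (PolyDecidable.lt hf t).and (.inList (.listPos (.const 1) (.inp (.const 1))) hf hg)
theorem live (hf : PolyComputable f) : PolyDecidable (fun w v e => (sweepOf w).Live (f w v e)) :=
  (PolyDecidable.lt (elt hf) n).and (B (bag hf) (elt hf))
theorem link (hf : PolyComputable f) : PolyDecidable (fun w v e => (sweepOf w).Link (f w v e)) :=
  (live hf).and (live (hf.add X))
theorem prev (hf : PolyComputable f) : PolyDecidable (fun w v e => (sweepOf w).Prev (f w v e)) :=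
  (PolyDecidable.le X hf).and (link (hf.sub X))

end PolySweep

theorem PolyList.encodeLists_filter {n : Fn} {p : (ℕ → ℕ) → (ℕ → ℕ) → (ℕ → ℕ) → ℕ → Prop}
    [∀ w v e i, Decidable (p w v e i)]
    {H : (ℕ → ℕ) → (ℕ → ℕ) → (ℕ → ℕ) → ℕ → List ℕ} (hn : PolyComputable n)
    (hp : PolyDecidable (fun w v e => p w v (fun k => e (k + 1)) (e 0)))
    (hH : PolyList (fun w v e => H w v (fun k => e (k + 1)) (e 0))) :
    PolyList (fun w v e => _root_.encodeLists
      (((List.range (n w v e)).filter (p w v e ·)).map (H w v e))) := by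
  refine (PolyList.cons (PolyList.filter_range hn hp).1 (PolyList.flatMap
    (H := fun w v e i => if p w v e i then (H w v e i).length :: H w v e i else []) hn
      (PolyList.ite hp (.cons hH.1 hH) .nil))).of_eq fun w v e => ?_
  simp only [_root_.encodeLists, List.length_map]
  congr 1
  generalize List.range (n w v e) = l
  induction l with
  | nil => rfl
  | cons a l ih =>
    rw [List.flatMap_cons, ih, List.filter_cons]
    by_cases h : p w v e a <;> simp [h]

end RAM

/-! ### Path decompositions given by the lifetimes of the vertices -/

theorem foldr_max_le_iff {l : List ℕ} {K : ℕ} : l.foldr max 0 ≤ K ↔ ∀ a ∈ l, a ≤ K := by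
  induction l with
  | nil => simp
  | cons a l ih => simp [ih]

namespace PathDecomposition

variable {V : Type} [DecidableEq V] {G : SimpleGraph V}

/-- The path decomposition in which the vertex `v` lies in the `q`-th bag if `alive q v`. -/
def ofAlive (G : SimpleGraph V) (N : ℕ) (bag : ℕ → List V) (alive : ℕ → V → Prop)
    (hmem : ∀ q v, v ∈ bag q ↔ alive q v) (hnodup : ∀ q, (bag q).Nodup)
    (hconv : ∀ v a b c, a ≤ b → b ≤ c → alive a v → alive c v → alive b v)
    (hvertex : ∀ v, ∃ q < N, alive q v)
    (hedge : ∀ v v', G.Adj v v' → ∃ q < N, alive q v ∧ alive q v')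
    (hnew : ∀ q, q + 1 < N → ∃ v, alive (q + 1) v ∧ ¬ alive q v) : PathDecomposition G where
  bags := (List.range N).map bag
  nodup := by simpa using fun q _ => hnodup q
  isPathDecomposition :=
    { vertex_mem := fun v => by
        obtain ⟨q, hq, h⟩ := hvertex v
        exact ⟨(bag q).toFinset, by simpa using ⟨q, hq, rfl⟩, by simpa [hmem] using h⟩
      edge_mem := fun v v' hv => by
        obtain ⟨q, hq, h, h'⟩ := hedge v v' hv
        exact ⟨(bag q).toFinset, by simpa using ⟨q, hq, rfl⟩, by simpa [hmem] using h,
          by simpa [hmem] using h'⟩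
      interval := fun v i j k hij hjk hi hk => by
        simp only [List.get_eq_getElem, List.getElem_map, List.getElem_range, List.mem_toFinset,
          hmem] at hi hk ⊢
        exact hconv v _ _ _ hij hjk hi hk }
  distinct := by
    rw [List.isChain_iff_getElem]
    intro i hi
    obtain ⟨v, h1, h2⟩ := hnew i (by simpa using hi)
    simp only [List.getElem_map, List.getElem_range]
    intro h
    have h3 : v ∈ (bag (i + 1)).toFinset := by simpa [hmem] using h1
    rw [← h] at h3
    exact h2 (by simpa [hmem] using h3)

theorem width_le_iff {D : PathDecomposition G} {K : ℕ} :
    D.width ≤ K ↔ ∀ b ∈ D.bags, b.length ≤ K + 1 := by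
  rw [width, Nat.sub_le_iff_le_add, foldr_max_le_iff]
  simp

/-- Every bag is left or entered, so there are at most two bags per vertex, and one more. -/
theorem length_bags_le [Fintype V] (D : PathDecomposition G) :
    D.bags.length ≤ 2 * Fintype.card V + 1 := by
  classical
  set B := D.bags.map List.toFinset with hB
  have hlen : B.length = D.bags.length := by simp [hB]
  have hint := D.isPathDecomposition.interval
  rw [← hB] at hint
  have hint' : ∀ (x : V) (i j k : ℕ) (hi : i ≤ j) (hj : j ≤ k) (hk : k < B.length),
      x ∈ B[i] → x ∈ B[k] → x ∈ B[j] := fun x i j k hi hj hk h1 h2 =>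
    hint x ⟨i, by omega⟩ ⟨j, by omega⟩ ⟨k, hk⟩ hi hj h1 h2
  -- Two consecutive bags are told apart by a vertex that leaves (left summand) or enters (right
  -- summand). By the interval condition no vertex leaves twice or enters twice, so this choice is
  -- injective.
  have hne : ∀ i : Fin (B.length - 1), ∃ v : V ⊕ V, v.elim
      (fun x => x ∈ B[i.1]'(by omega) ∧ x ∉ B[i.1 + 1]'(by omega))
      (fun x => x ∈ B[i.1 + 1]'(by omega) ∧ x ∉ B[i.1]'(by omega)) := by
    intro i
    have h := List.isChain_iff_getElem.1 D.distinct i.1 (by have := i.2; rw [← hB]; omega)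
    by_contra hcon
    push Not at hcon
    refine h ?_
    ext x
    have h1 := hcon (Sum.inl x)
    have h2 := hcon (Sum.inr x)
    simp only [Sum.elim_inl, Sum.elim_inr, not_and, not_not] at h1 h2
    exact ⟨h1, h2⟩
  choose f hf using hne
  have hinj : Function.Injective f := by
    have key : ∀ i j : Fin (B.length - 1), i < j → f i ≠ f j := by
      intro i j hij he
      have hij' : i.1 < j.1 := hij
      have h1 := hf i
      have h2 := hf j
      rw [← he] at h2
      cases hfi : f i with
      | inl x =>
        simp only [hfi, Sum.elim_inl] at h1 h2
        exact h1.2 (hint' x i.1 (i.1 + 1) j.1 (by omega) (by omega) (by omega) h1.1 h2.1)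
      | inr x =>
        simp only [hfi, Sum.elim_inr] at h1 h2
        exact h2.2 (hint' x (i.1 + 1) j.1 (j.1 + 1) (by omega) (by omega) (by omega) h1.1 h2.1)
    intro i j he
    rcases lt_trichotomy i j with h | h | h
    · exact (key i j h he).elim
    · exact h
    · exact (key j i h he.symm).elim
  have := Fintype.card_le_of_injective f hinj
  simp only [Fintype.card_fin, Fintype.card_sum] at this
  omega

end PathDecomposition

/-! ## Instances given by numerical data -/

open Classical in
theorem map_val_filter_finRange (n : ℕ) (p : ℕ → Prop) :
    ((List.finRange n).filter (fun i => p i.val)).map (fun i => i.val) =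
      (List.range n).filter (fun i => p i) := by
  rw [← List.map_coe_finRange_eq_range, List.filter_map]
  rfl

open Classical in
theorem length_filter_range (n : ℕ) (p : ℕ → Prop) :
    ((List.range n).filter (fun i => p i)).length = ((Finset.range n).filter p).card := by
  rw [← List.toFinset_card_of_nodup (List.nodup_range.filter _)]
  congr 1
  ext i; simp

/-- A formula in which all clauses have three literals, with a path decomposition. -/
structure SatData where
  V : ℕ
  P : ℕ
  N : ℕ
  lit : ℕ → ℕ → ℕ
  alive : ℕ → ℕ → Prop
  lit_lt : ∀ p < P, ∀ r, lit p r < 2 * V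
  convex : ∀ v a b c, a ≤ b → b ≤ c → alive a v → alive c v → alive b v
  vertex : ∀ v < V, ∃ q < N, alive q v
  clause : ∀ p < P, ∃ q < N, ∀ r, alive q (lit p r / 2)
  new : ∀ q, q + 1 < N → ∃ v < V, alive (q + 1) v ∧ ¬ alive q v

namespace SatData

variable (D : SatData)

/-- Instances have to consist of distinct clauses, whereas a generated formula repeats some. Only
the first of equal clauses is kept, which does not affect satisfiability by `exists_fresh`. -/
def SameClause (p p' : ℕ) : Prop :=
  D.lit p 0 = D.lit p' 0 ∧ D.lit p 1 = D.lit p' 1 ∧ D.lit p 2 = D.lit p' 2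

/-- No earlier clause is the same. -/
def Fresh (p : ℕ) : Prop := ∀ p' < p, ¬ D.SameClause p' p

open Classical in
noncomputable def indices : List ℕ := (List.range D.P).filter (fun p => D.Fresh p)

theorem mem_indices {p : ℕ} : p ∈ D.indices ↔ p < D.P ∧ D.Fresh p := by
  simp [indices]

def toLiteral (c : ℕ) (hc : c < 2 * D.V) : Literal D.V := (⟨c / 2, by omega⟩, decide (c % 2 = 1))

noncomputable def formula : CNF D.V := D.indices.attach.map (fun p =>
  (List.range 3).map (fun r => D.toLiteral (D.lit p.1 r)
    (D.lit_lt p.1 (D.mem_indices.1 p.2).1 r)))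

theorem toLiteral_inj {c c' : ℕ} {hc : c < 2 * D.V} {hc' : c' < 2 * D.V}
    (h : D.toLiteral c hc = D.toLiteral c' hc') : c = c' := by
  simp only [toLiteral, Prod.mk.injEq, Fin.mk.injEq, decide_eq_decide] at h
  omega

theorem formula_nodup : D.formula.Nodup := by
  classical
  refine List.Nodup.map_on ?_ (List.nodup_attach.2 (List.nodup_range.filter _))
  intro a _ b _ hab
  have h : ∀ r < 3, D.lit a.1 r = D.lit b.1 r := by
    intro r hr
    have := congrArg (fun l => l[r]?) hab
    simp only [List.getElem?_map, List.getElem?_range hr, Option.map_some, Option.some.injEq] at this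
    exact D.toLiteral_inj this
  have hs : D.SameClause a.1 b.1 := ⟨h 0 (by omega), h 1 (by omega), h 2 (by omega)⟩
  have hs' : D.SameClause b.1 a.1 := ⟨hs.1.symm, hs.2.1.symm, hs.2.2.symm⟩
  refine Subtype.ext ?_
  rcases lt_trichotomy a.1 b.1 with h | h | h
  · exact ((D.mem_indices.1 b.2).2 _ h hs).elim
  · exact h
  · exact ((D.mem_indices.1 a.2).2 _ h hs').elim

theorem exists_fresh (p : ℕ) : ∃ p' ≤ p, D.Fresh p' ∧ D.SameClause p' p := by
  induction p using Nat.strong_induction_on with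
  | _ p ih =>
    by_cases h : D.Fresh p
    · exact ⟨p, le_rfl, h, rfl, rfl, rfl⟩
    · simp only [Fresh, not_forall, not_not] at h
      obtain ⟨p1, h1, h2⟩ := h
      obtain ⟨p2, h3, h4, h5⟩ := ih p1 h1
      exact ⟨p2, by omega, h4, h5.1.trans h2.1, h5.2.1.trans h2.2.1, h5.2.2.trans h2.2.2⟩

theorem satisfiable_iff :
    D.formula.Satisfiable ↔ ∃ α : ℕ → Bool, ∀ p < D.P, ∃ r < 3, LitTrue α (D.lit p r) := by
  have key : ∀ (α : ℕ → Bool) (c : ℕ) (hc : c < 2 * D.V),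
      α (D.toLiteral c hc).1.val = (D.toLiteral c hc).2 ↔ LitTrue α c := by
    intro α c hc
    simp only [toLiteral, LitTrue]
    rw [Bool.eq_iff_iff]; simp
  constructor
  · rintro ⟨τ, h⟩
    refine ⟨fun v => if hv : v < D.V then τ ⟨v, hv⟩ else false, fun p hp => ?_⟩
    obtain ⟨p', h1, h2, h3⟩ := D.exists_fresh p
    have hp' : p' < D.P := by omega
    obtain ⟨l, hl, hl'⟩ := h _ (List.mem_map.2 ⟨⟨p', D.mem_indices.2 ⟨hp', h2⟩⟩,
      List.mem_attach _ _, rfl⟩)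
    obtain ⟨r, hr, rfl⟩ := List.mem_map.1 hl
    have hr := List.mem_range.1 hr
    have he : D.lit p r = D.lit p' r := by
      interval_cases r
      exacts [h3.1.symm, h3.2.1.symm, h3.2.2.symm]
    refine ⟨r, hr, ?_⟩
    rw [he, ← key _ _ (D.lit_lt p' hp' r)]
    simpa [toLiteral, show D.lit p' r / 2 < D.V by have := D.lit_lt p' hp' r; omega] using hl'
  · rintro ⟨α, h⟩
    refine ⟨fun v => α v.val, fun c hc => ?_⟩
    obtain ⟨p, -, rfl⟩ := List.mem_map.1 hc
    obtain ⟨r, hr, h⟩ := h p.1 (D.mem_indices.1 p.2).1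
    exact ⟨_, List.mem_map.2 ⟨r, List.mem_range.2 hr, rfl⟩, (key _ _ _).2 h⟩

open Classical in
noncomputable def decomp : PathDecomposition D.formula.primalGraph :=
  .ofAlive _ D.N (fun q => (List.finRange D.V).filter (fun v => D.alive q v.val))
    (fun q v => D.alive q v.val) (fun q v => by simp)
    (fun q => (List.nodup_finRange _).filter _) (fun v => D.convex v.val)
    (fun v => D.vertex v.val v.2)
    (fun x y hxy => by
      have key : ∀ x y : Fin D.V, (∃ c ∈ D.formula, (∃ l ∈ c, l.1 = x) ∧ (∃ l ∈ c, l.1 = y)) →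
          ∃ q < D.N, D.alive q x.val ∧ D.alive q y.val := by
        rintro x y ⟨c, hc, ⟨l, hl, rfl⟩, ⟨l', hl', rfl⟩⟩
        obtain ⟨p, -, rfl⟩ := List.mem_map.1 hc
        obtain ⟨r, -, rfl⟩ := List.mem_map.1 hl
        obtain ⟨r', -, rfl⟩ := List.mem_map.1 hl'
        obtain ⟨q, hq, h⟩ := D.clause p.1 (D.mem_indices.1 p.2).1
        exact ⟨q, hq, h r, h r'⟩
      rcases (SimpleGraph.fromRel_adj _ _ _).1 hxy |>.2 with h | h
      · exact key x y h
      · obtain ⟨q, hq, h1, h2⟩ := key y x h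
        exact ⟨q, hq, h2, h1⟩)
    (fun q hq => by
      obtain ⟨v, hv, h⟩ := D.new q hq
      exact ⟨⟨v, hv⟩, h⟩)

noncomputable def toInstance : ThreeSatInstance where
  numVars := D.V
  formula := D.formula
  formula_nodup := D.formula_nodup
  arity_le c hc := by
    obtain ⟨p, -, rfl⟩ := List.mem_map.1 hc
    simp
  decomp := D.decomp

open Classical in
theorem encode_toInstance : D.toInstance.encode = D.V ::
    (encodeLists (((List.range D.P).filter (fun p => D.Fresh p)).map (fun p =>
      [D.lit p 0, D.lit p 1, D.lit p 2])) ++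
    encodeLists ((List.range D.N).map (fun q => (List.range D.V).filter (fun v => D.alive q v)))) := by
  have h1 : D.formula.map (List.map (fun l => 2 * l.1.val + l.2.toNat)) =
      D.indices.map (fun p => [D.lit p 0, D.lit p 1, D.lit p 2]) := by
    rw [formula, List.map_map]
    conv_rhs => rw [← List.attach_map_subtype_val D.indices, List.map_map]
    refine List.map_congr_left fun p _ => ?_
    have key : ∀ c (hc : c < 2 * D.V),
        2 * (D.toLiteral c hc).1.val + (D.toLiteral c hc).2.toNat = c := by
      intro c hc
      simp only [toLiteral]
      rcases Nat.mod_two_eq_zero_or_one c with h | h <;> simp [h] <;> omega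
    simp only [Function.comp_apply, List.range_succ, List.range_zero, List.nil_append, List.map_cons, List.map_nil, key, List.cons_append]
  have h2 : D.decomp.bags.map (List.map (fun x => x.val)) =
      (List.range D.N).map (fun q => (List.range D.V).filter (fun v => D.alive q v)) := by
    simp only [decomp, PathDecomposition.ofAlive, List.map_map]
    refine List.map_congr_left fun q _ => ?_
    exact map_val_filter_finRange D.V (D.alive q)
  simp only [ThreeSatInstance.encode, toInstance]
  rw [h1, h2]
  rfl

open Classical in
theorem width_le {K : ℕ}
    (h : ∀ q < D.N, ((Finset.range D.V).filter (D.alive q)).card ≤ K + 1) :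
    D.toInstance.decomp.width ≤ K := by
  show D.decomp.width ≤ K
  rw [PathDecomposition.width_le_iff]
  intro b hb
  obtain ⟨q, hq, rfl⟩ := List.mem_map.1 (show b ∈ (List.range D.N).map _ from hb)
  rw [← List.length_map (f := fun i : Fin D.V => i.val),
    map_val_filter_finRange D.V (D.alive q), length_filter_range]
  exact h q (List.mem_range.1 hq)

end SatData

/-- A set system with a path decomposition; the vertices are the elements and after them the
sets. -/
structure CoverData where
  E : ℕ
  S : ℕ
  N : ℕ
  inc : ℕ → ℕ → Prop
  alive : ℕ → ℕ → Prop
  convex : ∀ v a b c, a ≤ b → b ≤ c → alive a v → alive c v → alive b v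
  vertex : ∀ v < E + S, ∃ q < N, alive q v
  edge : ∀ u < E, ∀ s < S, inc u s → ∃ q < N, alive q u ∧ alive q (E + s)
  new : ∀ q, q + 1 < N → ∃ v < E + S, alive (q + 1) v ∧ ¬ alive q v

namespace CoverData

variable (D : CoverData)

open Classical in
noncomputable def sets : List (List (Fin D.E)) :=
  (List.range D.S).map (fun s => (List.finRange D.E).filter (fun u => D.inc u.val s))

theorem length_sets : D.sets.length = D.S := by simp [sets]

open Classical in
theorem mem_sets_get (u : Fin D.E) (j : Fin D.sets.length) :
    u ∈ D.sets.get j ↔ D.inc u.val j.val := by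
  have : D.sets.get j = (List.finRange D.E).filter (fun u => D.inc u.val j.val) := by
    rw [List.get_eq_getElem]
    exact (List.getElem_map _).trans (by rw [List.getElem_range])
  rw [this]
  simp

def code : Fin D.E ⊕ Fin D.sets.length → ℕ := Sum.elim (fun u => u.val) (fun j => D.E + j.val)

open Classical in
noncomputable def decomp : PathDecomposition (incidenceGraph D.sets) :=
  .ofAlive _ D.N (fun q =>
      ((List.finRange D.E).filter (fun u => D.alive q u.val)).map Sum.inl ++
      ((List.finRange D.sets.length).filter (fun j => D.alive q (D.E + j.val))).map Sum.inr)
    (fun q v => D.alive q (D.code v))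
    (fun q v => by cases v <;> simp [code])
    (fun q => by
      refine List.Nodup.append (((List.nodup_finRange _).filter _).map Sum.inl_injective)
        (((List.nodup_finRange _).filter _).map Sum.inr_injective) ?_
      intro a h1 h2
      obtain ⟨x, -, rfl⟩ := List.mem_map.1 h1
      obtain ⟨y, -, h⟩ := List.mem_map.1 h2
      cases h) (fun v => D.convex _)
    (fun v => D.vertex _ (by
      have := D.length_sets
      cases v <;> simp only [code, Sum.elim_inl, Sum.elim_inr] <;> omega))
    (fun x y hxy => by
      have key : ∀ x y, (∃ (u : Fin D.E) (j : Fin D.sets.length),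
          x = Sum.inl u ∧ y = Sum.inr j ∧ u ∈ D.sets.get j) →
          ∃ q < D.N, D.alive q (D.code x) ∧ D.alive q (D.code y) := by
        rintro x y ⟨u, j, rfl, rfl, h⟩
        exact D.edge u.val u.2 j.val (by have := j.2; have := D.length_sets; omega)
          ((D.mem_sets_get u j).1 h)
      rcases (SimpleGraph.fromRel_adj _ _ _).1 hxy |>.2 with h | h
      · exact key x y h
      · obtain ⟨q, hq, h1, h2⟩ := key y x h
        exact ⟨q, hq, h2, h1⟩)
    (fun q hq => by
      obtain ⟨v, hv, h⟩ := D.new q hq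
      by_cases hvE : v < D.E
      · exact ⟨Sum.inl ⟨v, hvE⟩, h⟩
      · refine ⟨Sum.inr ⟨v - D.E, by have := D.length_sets; omega⟩, ?_⟩
        simpa [code, show D.E + (v - D.E) = v by omega] using h)

noncomputable def toInstance : SetCoverInstance where
  numElements := D.E
  sets := D.sets
  sets_nodup S hS := by
    obtain ⟨s, -, rfl⟩ := List.mem_map.1 hS
    exact (List.nodup_finRange _).filter _
  decomp := D.decomp

open Classical in
theorem encode_toInstance : D.toInstance.encode = D.E ::
    (encodeLists ((List.range D.S).map (fun s => (List.range D.E).filter (fun u => D.inc u s))) ++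
    encodeLists ((List.range D.N).map (fun q =>
      (List.range D.E).filter (fun u => D.alive q u) ++
      ((List.range D.S).filter (fun s => D.alive q (D.E + s))).map (fun s => D.E + s)))) := by
  have h1 : D.sets.map (List.map (fun u => u.val)) =
      (List.range D.S).map (fun s => (List.range D.E).filter (fun u => D.inc u s)) := by
    rw [sets, List.map_map]
    exact List.map_congr_left fun s _ => map_val_filter_finRange D.E (fun u => D.inc u s)
  have h2 : D.decomp.bags.map (List.map
      (Sum.elim (fun u => u.val) (fun j => D.E + j.val))) =
      (List.range D.N).map (fun q => (List.range D.E).filter (fun u => D.alive q u) ++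
      ((List.range D.S).filter (fun s => D.alive q (D.E + s))).map (fun s => D.E + s)) := by
    simp only [decomp, PathDecomposition.ofAlive, List.map_map]
    refine List.map_congr_left fun q _ => ?_
    rw [← map_val_filter_finRange D.E (D.alive q),
      ← map_val_filter_finRange D.S (fun s => D.alive q (D.E + s)), ← D.length_sets]
    simp [Function.comp_def]
  simp only [SetCoverInstance.encode, toInstance]
  rw [h1, h2]

open Classical in
theorem width_le {K : ℕ}
    (h : ∀ q < D.N, ((Finset.range (D.E + D.S)).filter (D.alive q)).card ≤ K + 1) :
    D.toInstance.decomp.width ≤ K := by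
  show D.decomp.width ≤ K
  rw [PathDecomposition.width_le_iff]
  intro b hb
  obtain ⟨q, hq, rfl⟩ := List.mem_map.1 (show b ∈ (List.range D.N).map _ from hb)
  refine le_trans ?_ (h q (List.mem_range.1 hq))
  rw [List.length_append, List.length_map, List.length_map,
    ← List.length_map (f := fun i : Fin D.E => i.val),
    map_val_filter_finRange D.E (D.alive q), length_filter_range,
    ← List.length_map (f := fun i : Fin D.sets.length => i.val),
    map_val_filter_finRange D.sets.length (fun s => D.alive q (D.E + s)), length_filter_range,
    D.length_sets]
  rw [← Finset.card_map (addLeftEmbedding D.E) (s := (Finset.range D.S).filter _),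
    ← Finset.card_union_of_disjoint]
  · refine Finset.card_le_card fun v hv => ?_
    simp only [Finset.mem_union, Finset.mem_filter, Finset.mem_range, Finset.mem_map,
      addLeftEmbedding_apply] at hv ⊢
    rcases hv with hv | ⟨s, hs, rfl⟩
    · exact ⟨by omega, hv.2⟩
    · exact ⟨by omega, hs.2⟩
  · rw [Finset.disjoint_left]
    intro v hv hv'
    simp only [Finset.mem_filter, Finset.mem_range, Finset.mem_map, addLeftEmbedding_apply] at hv hv'
    obtain ⟨s, _, rfl⟩ := hv'
    omega

end CoverData

open Classical in
/-- The encoding of the instance that is described by numerical data. -/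
noncomputable def satCode (V P N : ℕ) (lit : ℕ → ℕ → ℕ) (alive : ℕ → ℕ → Prop) : List ℕ :=
  V :: (encodeLists (((List.range P).filter (fun p => ∀ p' < p, ¬ (lit p' 0 = lit p 0 ∧
    lit p' 1 = lit p 1 ∧ lit p' 2 = lit p 2))).map (fun p => [lit p 0, lit p 1, lit p 2])) ++
    encodeLists ((List.range N).map (fun q => (List.range V).filter (fun v => alive q v))))

open Classical in
/-- The encoding of the set system that is described by numerical data. -/
noncomputable def coverCode (E S N : ℕ) (inc alive : ℕ → ℕ → Prop) : List ℕ :=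
  E :: (encodeLists ((List.range S).map (fun s => (List.range E).filter (fun u => inc u s))) ++
    encodeLists ((List.range N).map (fun q => (List.range E).filter (fun u => alive q u) ++
      ((List.range S).filter (fun s => alive q (E + s))).map (fun s => E + s))))

/-- Frees the encoding from the proofs stored in the structure. The right-hand side makes sense for
arbitrary numerical data, so its computability can be stated for all memory contents. -/
theorem SatData.encode_eq (D : SatData) :
    D.toInstance.encode = satCode D.V D.P D.N D.lit D.alive := by
  rw [D.encode_toInstance, satCode]
  congr!

theorem CoverData.encode_eq (D : CoverData) :
    D.toInstance.encode = coverCode D.E D.S D.N D.inc D.alive := D.encode_toInstance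

/-! ### Computability of the encodings of instances -/

namespace RAM

theorem PolyList.satCode {V P N : Fn} {lit : (ℕ → ℕ) → (ℕ → ℕ) → (ℕ → ℕ) → ℕ → ℕ → ℕ}
    {alive : (ℕ → ℕ) → (ℕ → ℕ) → (ℕ → ℕ) → ℕ → ℕ → Prop} (hV : PolyComputable V)
    (hP : PolyComputable P) (hN : PolyComputable N)
    (hlit : PolyComputable (fun w v e => lit w v (fun k => e (k + 2)) (e 0) (e 1)))
    (halive : PolyDecidable (fun w v e => alive w v (fun k => e (k + 2)) (e 0) (e 1))) :
    PolyList (fun w v e => satCode (V w v e) (P w v e) (N w v e) (lit w v e) (alive w v e)) := by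
  classical
  refine .cons hV (.append (.encodeLists_filter hP ?_ ?_) ?_)
  · refine .forall_lt (.var 0) (.not ?_)
    have key : ∀ r, PolyDecidable (fun w v e => lit w v (fun k => e (k + 2)) (e 0) r =
        lit w v (fun k => e (k + 2)) (e 1) r) := by
      intro r
      have h : PolyComputable (fun w v e => lit w v (fun k => e (k + 1)) (e 0) r) :=
        .bind₂ (h := fun w v e a b => lit w v (fun k => e (k + 1)) a b)
          (PolyComputable.rename hlit (fun k => match k with
            | 0 => 0
            | 1 => 1
            | k + 2 => k + 3)) (.var 0) (.const r)
      exact .eq (PolyComputable.rename h (fun k => match k with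
        | 0 => 0
        | k + 1 => k + 2)) (PolyComputable.rename h (fun k => k + 1))
    exact (key 0).and ((key 1).and (key 2))
  · have key : ∀ r, PolyComputable (fun w v e => lit w v (fun k => e (k + 1)) (e 0) r) := fun r =>
      .bind₂ (h := fun w v e a b => lit w v (fun k => e (k + 1)) a b)
        (PolyComputable.rename hlit (fun k => match k with
          | 0 => 0
          | 1 => 1
          | k + 2 => k + 3)) (.var 0) (.const r)
    exact .cons (key 0) (.cons (key 1) (.cons (key 2) .nil))
  · exact .encodeLists hN (.filter_range hV.tail (PolyDecidable.rename halive (fun k => match k with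
      | 0 => 1
      | 1 => 0
      | k + 2 => k + 2)))

theorem PolyList.coverCode {E S N : Fn} {inc alive : (ℕ → ℕ) → (ℕ → ℕ) → (ℕ → ℕ) → ℕ → ℕ → Prop}
    (hE : PolyComputable E) (hS : PolyComputable S) (hN : PolyComputable N)
    (hinc : PolyDecidable (fun w v e => inc w v (fun k => e (k + 2)) (e 0) (e 1)))
    (halive : PolyDecidable (fun w v e => alive w v (fun k => e (k + 2)) (e 0) (e 1))) :
    PolyList (fun w v e => coverCode (E w v e) (S w v e) (N w v e) (inc w v e) (alive w v e)) := by
  classical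
  refine .cons hE (.append (.encodeLists hS (.filter_range hE.tail hinc))
    (.encodeLists hN (.append (.filter_range hE.tail (PolyDecidable.rename halive
      (fun k => match k with
      | 0 => 1
      | 1 => 0
      | k + 2 => k + 2))) ?_)))
  have h : PolyDecidable (fun w v e => alive w v (fun k => e (k + 2)) (e 1)
      (E w v (fun k => e (k + 2)) + e 0)) :=
    .bind₂ (h := fun w v e a b => alive w v (fun k => e (k + 2)) a b)
      (PolyDecidable.rename halive (fun k => match k with
        | 0 => 0
        | 1 => 1
        | k + 2 => k + 4)) (.var 1) (hE.tail.tail.add (.var 0))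
  refine (PolyList.flatMap (H := fun w v e s => if alive w v (fun k => e (k + 1)) (e 0)
    (E w v (fun k => e (k + 1)) + s) then [E w v (fun k => e (k + 1)) + s] else []) hS.tail
    (.ite h (.cons (hE.tail.tail.add (.var 0)) .nil) .nil)).of_eq fun w v e => ?_
  generalize List.range (S w v fun k => e (k + 1)) = l
  induction l with
  | nil => rfl
  | cons a l ih =>
    rw [List.flatMap_cons, ih, List.filter_cons]
    by_cases h : alive w v (fun k => e (k + 1)) (e 0) (E w v (fun k => e (k + 1)) + a) <;> simp [h]

end RAM

theorem Sweep.pos_eq (S : Sweep) (q : ℕ) : S.pos (S.bag q) (S.item q) (S.elt q) = q := by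
  have h1 := Nat.div_add_mod (q / S.X) (S.m + 1)
  have h2 := Nat.div_add_mod q S.X
  rw [Sweep.pos, Sweep.bag, Sweep.item, Sweep.elt, mul_comm (q / S.X / (S.m + 1)), h1, mul_comm, h2]

theorem pick_induction {P : ℕ → Prop} {r a b c : ℕ} (ha : P a) (hb : P b) (hc : P c) :
    P (pick r a b c) := by
  unfold pick; split_ifs <;> assumption

/-- A clause of step `q` contains only variables of the blocks `q` and `q - 1`, the variable `Z`,
and variables of the given literals. -/
theorem Counter.clauseLit_induction (G : Counter) {A : ℕ → Prop} {q s r : ℕ}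
    (hblock : ∀ b w, b ≤ q → q ≤ b + 1 → w < G.W → A (b * G.W + w)) (hZ : A G.Z)
    (hz : A (G.z q / 2)) (h1 : s = 3 * G.L + 3 → A (G.c1 q r / 2))
    (h2 : 3 * G.L + 3 < s → A (G.c2 q r / 2)) :
    A (G.clauseLit q s r / 2) := by
  have hdiv : ∀ v, (2 * v + 1) / 2 = v := fun v => by omega
  have hdiv' : ∀ v, 2 * v / 2 = v := fun v => by omega
  have hW : G.W = 2 * G.L + 2 := rfl
  have hbit : ∀ b l, l < G.L → b ≤ q → q ≤ b + 1 → A (G.bit b l) :=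
    fun b l hl h1 h2 => hblock _ _ h1 h2 (by omega)
  have hcarry : ∀ l ≤ G.L, A (G.carry q l) :=
    fun l hl => hblock _ _ le_rfl (by omega) (by omega)
  have hprev : ∀ l < G.L, A (G.prevBit q l / 2) := by
    intro l hl
    unfold Counter.prevBit
    split_ifs
    · rw [hdiv']; exact hZ
    · rw [hdiv]; exact hZ
    · rw [hdiv]; exact hbit _ _ hl (by omega) (by omega)
  unfold Counter.clauseLit
  split_ifs with e1 e2 e3 e4 e5 e6 e7
  · refine pick_induction (P := fun l => A (l / 2)) ?_ ?_ ?_ <;> try simp only [hdiv, hdiv', negLit_div]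
    exacts [hcarry _ (by omega), hprev _ (by omega), hcarry _ (by omega)]
  · refine pick_induction (P := fun l => A (l / 2)) ?_ ?_ ?_ <;> try simp only [hdiv, hdiv']
    exacts [hcarry _ (by omega), hprev _ (by omega), hbit _ _ (by omega) le_rfl (by omega)]
  · refine pick_induction (P := fun l => A (l / 2)) ?_ ?_ ?_ <;> try simp only [hdiv, negLit_div]
    exacts [hcarry _ (by omega), hprev _ (by omega), hbit _ _ (by omega) le_rfl (by omega)]
  · refine pick_induction (P := fun l => A (l / 2)) ?_ ?_ ?_ <;> try simp only [hdiv, negLit_div]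
    exacts [hz, hcarry _ (by omega), hcarry _ (by omega)]
  · rw [hdiv']; exact hcarry _ le_rfl
  · rw [hdiv']; exact hZ
  · exact h1 e7
  · exact h2 (by omega)

/-! ## A formula that says that there is a small cover -/

/-- A set system whose elements are `0, …, n - 1` and whose sets `0, …, m - 1` are represented in
the bags by `n, …, n + m - 1`, together with a bound for the cardinality of a cover, and some sets
that are required to belong to it. -/
structure CoverSweep extends Sweep where
  inc : ℕ → ℕ → Prop
  k : ℕ
  forced : ℕ → Prop

namespace CoverSweep

/-- There is a cover with at most `k` members to which the sets in `forced` belong. -/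
def Coverable (n m : ℕ) (inc : ℕ → ℕ → Prop) (k : ℕ) (forced : ℕ → Prop) : Prop :=
  ∃ T : Finset ℕ, (∀ j ∈ T, j < m) ∧ (∀ u < n, ∃ j ∈ T, inc u j) ∧ T.card ≤ k ∧
    ∀ j < m, forced j → j ∈ T

variable (C : CoverSweep)

def W : ℕ := 2 * C.m.size + 2
/-- The variable that says that the set `j` is chosen. -/
def chosen (j : ℕ) : ℕ := C.Q * C.W + j
def Z : ℕ := C.chosen C.m
/-- The set that is considered in step `q` lies in the bag. -/
def Here (q : ℕ) : Prop := C.item q < C.m ∧ C.B (C.bag q) (C.n + C.item q)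
-- Selects a single step for every set, so that the counter counts each chosen set once although the
-- set is considered in many steps.
def First (q : ℕ) : Prop := C.Here q ∧ C.elt q = 0 ∧ ∀ i < C.bag q, ¬ C.B i (C.n + C.item q)

open Classical in
/-- The variable `q * W` says that the element `elt q` is covered by a set that was considered in
some step `q' ≤ q`. -/
noncomputable def counter : Counter where
  L := C.m.size
  Q := C.Q
  Z := C.Z
  -- With this start the sum remains below `2 ^ L` exactly if at most `k` of the counted literals
  -- are true. Since `Z` is false, `2 * Z + 1` below is a false literal and `2 * Z` a true one; they
  -- fill the unused places.
  init := 2 ^ C.m.size - 1 - C.k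
  z q := if C.First q then 2 * C.chosen (C.item q) + 1 else 2 * C.Z + 1
  -- Either the element is declared not yet covered, or it was covered at the preceding visit, or
  -- the set considered now covers it. At the last visit there is no link, the first possibility
  -- disappears, and the element has to be covered.
  c1 q r := if C.Live q then
      pick r (if C.Link q then 2 * (q * C.W) else 2 * C.Z + 1)
        (if C.Prev q then 2 * ((q - C.X) * C.W) + 1 else 2 * C.Z + 1)
        (if C.Here q ∧ C.inc (C.elt q) (C.item q) then 2 * C.chosen (C.item q) + 1
          else 2 * C.Z + 1)
    else 2 * C.Z
  c2 q _ := if C.Here q ∧ C.forced (C.item q) then 2 * C.chosen (C.item q) + 1 else 2 * C.Z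

structure Valid : Prop where
  convex : C.Convex
  set : ∀ j < C.m, ∃ i, C.B i (C.n + j)
  elt : ∀ u < C.n, ∃ i, C.B i u
  edge : ∀ u < C.n, ∀ j < C.m, C.inc u j → ∃ i, C.B i u ∧ C.B i (C.n + j)
  k_le : C.k ≤ C.m

variable {C}

theorem W_pos : 0 < C.W := Nat.succ_pos _

theorem exists_here {i j x : ℕ} (hj : j < C.m) (hx : x ≤ C.n) (h : C.B i (C.n + j)) :
    ∃ q < C.Q, C.bag q = i ∧ C.item q = j ∧ C.elt q = x ∧ C.Here q := by
  have h1 := C.bag_pos (i := i) hj.le hx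
  have h2 := C.item_pos (i := i) hj.le hx
  exact ⟨C.pos i j x, C.pos_lt (C.lt_of_mem _ _ h).le hj.le hx, h1, h2,
    C.elt_pos hx, by rw [Here, h1, h2]; exact ⟨hj, h⟩⟩

open Classical in
theorem Valid.exists_first (hC : C.Valid) {j : ℕ} (hj : j < C.m) :
    ∃ q < C.Q, C.item q = j ∧ C.First q := by
  have h := hC.set j hj
  obtain ⟨q, h1, h2, h3, h4, h5⟩ := exists_here (x := 0) hj (Nat.zero_le _) (Nat.find_spec h)
  exact ⟨q, h1, h3, h5, h4, fun i hi => by rw [h3]; exact Nat.find_min h (by omega)⟩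

theorem First.inj {q q' : ℕ} (h : C.First q) (h' : C.First q') (he : C.item q = C.item q') :
    q = q' := by
  have hb : C.bag q = C.bag q' := by
    rcases lt_trichotomy (C.bag q) (C.bag q') with hlt | h1 | hlt
    · exact (h'.2.2 _ hlt (by rw [← he]; exact h.1.2)).elim
    · exact h1
    · exact (h.2.2 _ hlt (by rw [he]; exact h'.1.2)).elim
  rw [← C.pos_eq q, ← C.pos_eq q', hb, he, h.2.1, h'.2.1]

-- The chosen sets form the cover. If an element stayed uncovered, the clause of its first visit
-- would require a link and make its variable false, the next visit would do the same, and so on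
-- forever, while links never leave the range of the steps.
open Classical in
theorem Valid.coverable_of_sat (hC : C.Valid) {α : ℕ → Bool} (h : C.counter.Sat α) :
    Coverable C.n C.m C.inc C.k C.forced := by
  have hm : C.m < 2 ^ C.m.size := Nat.lt_size_self _
  have hcount := h.count_lt (by show 2 ^ C.m.size - 1 - C.k < 2 ^ C.m.size; omega)
  rw [Counter.sat_iff'] at h
  have hQ : 0 < C.Q := by
    rw [Sweep.Q, Sweep.X]; positivity
  have hZ : α C.Z = false := (h 0 hQ).2.2.2.1
  have hz : ¬ LitTrue α (2 * C.Z + 1) := by rw [litTrue_pos, hZ]; simp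
  refine ⟨(Finset.range C.m).filter (fun j => α (C.chosen j) = true), fun j hj => ?_,
    fun u hu => ?_, ?_, fun j hj hf => ?_⟩
  · exact Finset.mem_range.1 (Finset.mem_filter.1 hj).1
  · by_contra hcon
    push Not at hcon
    have hcon' : ∀ j < C.m, α (C.chosen j) = true → ¬ C.inc u j := fun j hj ha =>
      hcon j (by simp [hj, ha])
    have step : ∀ q, C.Live q → C.elt q = u →
        ¬ (C.Prev q ∧ α ((q - C.X) * C.W) = true) →
        C.Link q ∧ α (q * C.W) = false := by
      intro q hq he hp
      have h1 := (h q (Sweep.Live.lt _ hq)).2.2.2.2.1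
      simp only [counter, if_pos hq, exists_pick] at h1
      rcases h1 with h1 | h1 | h1
      · split_ifs at h1 with h2
        · exact ⟨h2, litTrue_neg.1 h1⟩
        · exact (hz h1).elim
      · split_ifs at h1 with h2
        · exact (hp ⟨h2, litTrue_pos.1 h1⟩).elim
        · exact (hz h1).elim
      · split_ifs at h1 with h2
        · rw [he] at h2
          exact (hcon' _ h2.1.1 (litTrue_pos.1 h1) h2.2).elim
        · exact (hz h1).elim
    have hex : ∃ q, C.Live q ∧ C.elt q = u := by
      obtain ⟨i, hi⟩ := hC.elt u hu
      have e1 := C.bag_pos (i := i) (Nat.zero_le _) hu.le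
      have e2 := C.elt_pos (i := i) (j := 0) hu.le
      exact ⟨C.pos i 0 u, ⟨by rwa [e2], by rwa [e1, e2]⟩, e2⟩
    obtain ⟨hl, he⟩ := Nat.find_spec hex
    set q := Nat.find hex
    have key : ∀ d, C.Link (q + d * C.X) ∧ α ((q + d * C.X) * C.W) = false := by
      intro d
      induction d with
      | zero =>
        rw [zero_mul, add_zero]
        refine step q hl he (fun hp => ?_)
        have hX := C.X_pos
        have h1 := Nat.find_min hex (m := q - C.X) (by have := hp.1.1; omega)
        refine h1 ⟨hp.1.2.1, ?_⟩
        rw [← he, ← C.elt_add, Nat.sub_add_cancel hp.1.1]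
      | succ d ih =>
        rw [show q + (d + 1) * C.X = q + d * C.X + C.X by ring]
        refine step _ ih.1.2 ?_ (fun hp => ?_)
        · rw [C.elt_add, ← he]; exact Nat.add_mul_mod_self_right _ _ _
        · rw [Nat.add_sub_cancel, ih.2] at hp
          simp at hp
    have h1 := Sweep.Link.lt _ (key C.Q).1
    have h2 : C.Q * 1 ≤ C.Q * C.X := Nat.mul_le_mul_left _ C.X_pos
    omega
  · have hle : ((Finset.range C.m).filter (fun j => α (C.chosen j) = true)).card ≤
        ((Finset.range C.Q).filter (fun q => LitTrue α (C.counter.z q))).card := by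
      have : (Finset.range C.m).filter (fun j => α (C.chosen j) = true) ⊆
          ((Finset.range C.Q).filter (fun q => LitTrue α (C.counter.z q))).image C.item := by
        intro j hj
        rw [Finset.mem_filter, Finset.mem_range] at hj
        obtain ⟨q, hq, rfl, hf⟩ := hC.exists_first hj.1
        refine Finset.mem_image_of_mem _ (Finset.mem_filter.2 ⟨Finset.mem_range.2 hq, ?_⟩)
        simp only [counter, if_pos hf, litTrue_pos, hj.2]
      exact (Finset.card_le_card this).trans Finset.card_image_le
    have hk := hC.k_le
    simp only [show C.counter.Q = C.Q from rfl, show C.counter.L = C.m.size from rfl,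
      show C.counter.init = 2 ^ C.m.size - 1 - C.k from rfl] at hcount
    omega
  · obtain ⟨i, hi⟩ := hC.set j hj
    obtain ⟨q, hq, -, rfl, -, hh⟩ := exists_here (x := 0) hj (Nat.zero_le _) hi
    have h1 := (h q hq).2.2.2.2.2
    simp only [counter, if_pos (show C.Here q ∧ C.forced (C.item q) from ⟨hh, hf⟩),
      litTrue_pos] at h1
    obtain ⟨_, _, h1⟩ := h1
    simp [hj, h1]

theorem free_mul (q : ℕ) : C.counter.Free (q * C.W) := fun h => h.2 (Nat.mul_mod_left _ _)

theorem free_chosen (j : ℕ) : C.counter.Free (C.chosen j) := fun h => by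
  have h1 : C.chosen j < C.Q * C.W := h.1
  rw [chosen] at h1; omega

-- The variable of a visit is made true when the element has met, up to that visit, a chosen set
-- containing it. If this has not yet happened, the bag that the element shares with a set covering
-- it provides a later visit, so by convexity the next visit is joined by a link and the first
-- literal of the clause is available.
open Classical in
theorem Valid.sat_of_coverable (hC : C.Valid) (h : Coverable C.n C.m C.inc C.k C.forced) :
    ∃ α, C.counter.Sat α := by
  obtain ⟨T, hT, hcov, hcard, hforced⟩ := h
  have hm : C.m < 2 ^ C.m.size := Nat.lt_size_self _
  have hk := hC.k_le
  let Hit : ℕ → Prop := fun q =>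
    C.Live q ∧ C.Here q ∧ C.item q ∈ T ∧ C.inc (C.elt q) (C.item q)
  let Cov : ℕ → Prop := fun q => ∃ q' ≤ q, C.elt q' = C.elt q ∧ Hit q'
  let α₀ : ℕ → Bool := fun v => if v < C.Q * C.W then decide (Cov (v / C.W))
    else decide (v - C.Q * C.W ∈ T)
  have hcov' : ∀ q < C.Q, (α₀ (q * C.W) = true ↔ Cov q) := by
    intro q hq
    have h1 : q * C.W < C.Q * C.W := Nat.mul_lt_mul_of_pos_right hq W_pos
    simp only [α₀, if_pos h1, Nat.mul_div_cancel _ W_pos, decide_eq_true_eq]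
  have hch : ∀ j, α₀ (C.chosen j) = true ↔ j ∈ T := by
    intro j
    simp [α₀, chosen]
  have hZT : C.m ∉ T := fun h => lt_irrefl _ (hT _ h)
  have hZ : α₀ C.Z = false := by
    rw [← Bool.not_eq_true, Z, hch]; exact hZT
  have hdiv : ∀ v, (2 * v + 1) / 2 = v := fun v => by omega
  have hdiv' : ∀ v, 2 * v / 2 = v := fun v => by omega
  have htrue : ∃ r < 3, C.counter.Free (2 * C.Z / 2) ∧ LitTrue α₀ (2 * C.Z) :=
    ⟨0, by omega, by rw [hdiv']; exact free_chosen _, litTrue_neg.2 hZ⟩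
  refine C.counter.exists_sat (α₀ := α₀) (Nat.le_add_right _ _) hZ ?_ ?_ ?_ ?_
  · intro q _
    simp only [counter]
    split_ifs
    · rw [hdiv]; exact free_chosen _
    · rw [hdiv]; exact free_chosen _
  · intro q hq
    by_cases hl : C.Live q
    swap
    · simpa only [counter, if_neg hl] using htrue
    have hp := exists_pick (P := fun l => C.counter.Free (l / 2) ∧ LitTrue α₀ l)
      (a := if C.Link q then 2 * (q * C.W) else 2 * C.Z + 1)
      (b := if C.Prev q then 2 * ((q - C.X) * C.W) + 1 else 2 * C.Z + 1)
      (c := if C.Here q ∧ C.inc (C.elt q) (C.item q) then 2 * C.chosen (C.item q) + 1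
          else 2 * C.Z + 1)
    simp only [counter, if_pos hl]
    refine hp.2 ?_
    by_cases hhit : Hit q
    · right; right
      rw [if_pos ⟨hhit.2.1, hhit.2.2.2⟩, hdiv]
      exact ⟨free_chosen _, litTrue_pos.2 ((hch _).2 hhit.2.2.1)⟩
    by_cases hc : Cov q
    · right; left
      obtain ⟨q', hle, he, hh⟩ := hc
      obtain ⟨d, rfl⟩ := Sweep.exists_eq_add hle he
      rcases d with _ | d
      · rw [zero_mul, add_zero] at hhit
        exact (hhit hh).elim
      have hX : q' + (d + 1) * C.X = q' + d * C.X + C.X := by ring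
      have h1 := hC.convex.live (Nat.le_succ d) hh.1 hl
      have hprev : C.Prev (q' + (d + 1) * C.X) := by
        refine ⟨by omega, ?_⟩
        rw [hX, Nat.add_sub_cancel]
        exact ⟨h1, by rwa [← hX]⟩
      rw [if_pos hprev, hdiv, hX, Nat.add_sub_cancel]
      refine ⟨free_mul _, litTrue_pos.2 ((hcov' _ (Sweep.Live.lt _ h1)).2 ⟨q', by omega, ?_, hh⟩)⟩
      exact (Nat.add_mul_mod_self_right _ _ _).symm
    · left
      have hlink : C.Link q := by
        refine ⟨hl, ?_⟩
        obtain ⟨j, hj, hinc⟩ := hcov _ hl.1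
        obtain ⟨i, hi, hi'⟩ := hC.edge _ hl.1 _ (hT j hj) hinc
        obtain ⟨q', hq', e1, e2, e3, e4⟩ := exists_here (hT j hj) hl.1.le hi'
        have hh : Hit q' := by
          refine ⟨⟨by rw [e3]; exact hl.1, by rwa [e1, e3]⟩, e4, by rwa [e2], by rwa [e2, e3]⟩
        rcases le_or_gt q' q with hle | hlt
        · exact (hc ⟨q', hle, e3, hh⟩).elim
        · obtain ⟨d, rfl⟩ := Sweep.exists_eq_add hlt.le e3.symm
          have := hC.convex.live (d := 1) (d' := d) (by
            rcases d with _ | d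
            · omega
            · omega) hl hh.1
          rwa [one_mul] at this
      rw [if_pos hlink, hdiv']
      refine ⟨free_mul _, litTrue_neg.2 ?_⟩
      rw [← Bool.not_eq_true, hcov' q hq]
      exact hc
  · intro q _
    by_cases h : C.Here q ∧ C.forced (C.item q)
    · simp only [counter, if_pos h]
      refine ⟨0, by omega, by rw [hdiv]; exact free_chosen _, litTrue_pos.2 ((hch _).2 ?_)⟩
      exact hforced _ h.1.1 h.2
    · simpa only [counter, if_neg h] using htrue
  · have hz : ∀ q, LitTrue α₀ (C.counter.z q) → C.First q ∧ C.item q ∈ T := by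
      intro q h
      simp only [counter] at h
      split_ifs at h with hf
      · exact ⟨hf, (hch _).1 (litTrue_pos.1 h)⟩
      · rw [litTrue_pos, hZ] at h; simp at h
    have hle : ((Finset.range C.Q).filter (fun q => LitTrue α₀ (C.counter.z q))).card ≤ T.card := by
      refine Finset.card_le_card_of_injOn C.item (fun q hq => ?_) (fun q hq q' hq' he => ?_)
      · exact (hz q (Finset.mem_filter.1 hq).2).2
      · exact (hz q (Finset.mem_filter.1 hq).2).1.inj (hz q' (Finset.mem_filter.1 hq').2).1 he
    simp only [show C.counter.Q = C.Q from rfl, show C.counter.L = C.m.size from rfl,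
      show C.counter.init = 2 ^ C.m.size - 1 - C.k from rfl]
    omega

/-- The variable `v` lies in the `q`-th bag. -/
def Alive (q v : ℕ) : Prop :=
  -- A block stays for two steps, because its digits are read in the next step, and its place `0`
  -- stays until the end of the link. The variable of a set stays while the set lies in the bag, and
  -- `Z` stays forever.
  (v < C.Q * C.W ∧ v / C.W ≤ q ∧ (q ≤ v / C.W + 1 ∨
    (v % C.W = 0 ∧ C.Link (v / C.W) ∧ q ≤ v / C.W + C.X))) ∨
  (C.Q * C.W ≤ v ∧ v < C.Z ∧ C.B (C.bag q) (C.n + (v - C.Q * C.W))) ∨ v = C.Z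

theorem alive_block {q b r : ℕ} (hb : b < C.Q) (hr : r < C.W) (h1 : b ≤ q) (h2 : q ≤ b + 1) :
    C.Alive q (b * C.W + r) := by
  have h3 : (b * C.W + r) / C.W = b := by
    rw [mul_comm, Nat.mul_add_div W_pos, Nat.div_eq_of_lt hr, add_zero]
  refine Or.inl ⟨?_, by rw [h3]; exact h1, Or.inl (by rw [h3]; exact h2)⟩
  calc b * C.W + r < b * C.W + C.W := by omega
    _ = (b + 1) * C.W := by ring
    _ ≤ _ := Nat.mul_le_mul_right _ hb

theorem alive_Z {q : ℕ} : C.Alive q C.Z := Or.inr (Or.inr rfl)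

theorem alive_chosen {q j : ℕ} (hj : j < C.m) (h : C.B (C.bag q) (C.n + j)) :
    C.Alive q (C.chosen j) := by
  refine Or.inr (Or.inl ⟨Nat.le_add_right _ _, Nat.add_lt_add_left hj _, ?_⟩)
  rwa [chosen, Nat.add_sub_cancel_left]

theorem Alive.lt {q v : ℕ} (h : C.Alive q v) : v < C.Z + 1 := by
  have : C.Z = C.Q * C.W + C.m := rfl
  rcases h with h | h | h <;> omega

theorem alive_clause {q s r : ℕ} (hq : q < C.Q) : C.Alive q (C.counter.clauseLit q s r / 2) := by
  have hdiv : ∀ v, (2 * v + 1) / 2 = v := fun v => by omega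
  have hdiv' : ∀ v, 2 * v / 2 = v := fun v => by omega
  refine C.counter.clauseLit_induction (fun b w h1 h2 hw =>
    alive_block (by omega) hw h1 h2) alive_Z ?_ (fun _ => ?_) (fun _ => ?_)
  · simp only [counter]
    split_ifs with h
    · rw [hdiv]; exact alive_chosen h.1.1 h.1.2
    · rw [hdiv]; exact alive_Z
  · simp only [counter]
    by_cases hl : C.Live q
    swap
    · rw [if_neg hl, hdiv']; exact alive_Z
    rw [if_pos hl]
    refine pick_induction (P := fun l => C.Alive q (l / 2)) ?_ ?_ ?_
    · split_ifs
      · rw [hdiv']; exact alive_block (r := 0) hq W_pos le_rfl (by omega)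
      · rw [hdiv]; exact alive_Z
    · split_ifs with h
      · have := Nat.mul_lt_mul_of_pos_right (show q - C.X < C.Q by omega) (W_pos (C := C))
        rw [hdiv]
        refine Or.inl ⟨this, ?_⟩
        rw [Nat.mul_div_cancel _ W_pos]
        exact ⟨by omega, Or.inr ⟨Nat.mul_mod_left _ _, h.2, by omega⟩⟩
      · rw [hdiv]; exact alive_Z
    · split_ifs with h
      · rw [hdiv]; exact alive_chosen h.1.1 h.1.2
      · rw [hdiv]; exact alive_Z
  · simp only [counter]
    split_ifs with h
    · rw [hdiv]; exact alive_chosen h.1.1 h.1.2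
    · rw [hdiv']; exact alive_Z

theorem Q_pos : 0 < C.Q := by rw [Sweep.Q, Sweep.X]; positivity

noncomputable def Valid.satData (hC : C.Valid) : SatData where
  V := C.Z + 1
  P := C.Q * C.counter.numClauses
  N := C.Q
  lit := C.counter.lit
  alive := C.Alive
  lit_lt p hp r := by
    have hP : 0 < C.counter.numClauses := Nat.succ_pos _
    have := (alive_clause (s := p % C.counter.numClauses) (r := r)
      ((Nat.div_lt_iff_lt_mul hP).2 hp)).lt
    rw [Counter.lit]
    omega
  convex v a b c hab hbc ha hc := by
    rcases ha with ha | ha | ha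
    · rcases hc with hc | hc | hc
      · left
        refine ⟨ha.1, by omega, ?_⟩
        rcases hc.2.2 with h | h
        · left; omega
        · right; exact ⟨h.1, h.2.1, by omega⟩
      · omega
      · exact Or.inr (Or.inr hc)
    · rcases hc with hc | hc | hc
      · omega
      · exact Or.inr (Or.inl ⟨ha.1, ha.2.1,
          hC.convex _ _ _ _ (C.bag_mono hab) (C.bag_mono hbc) ha.2.2 hc.2.2⟩)
      · exact Or.inr (Or.inr hc)
    · exact Or.inr (Or.inr ha)
  vertex v hv := by
    rcases lt_or_ge v (C.Q * C.W) with h | h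
    · refine ⟨v / C.W, (Nat.div_lt_iff_lt_mul W_pos).2 h, Or.inl ⟨h, le_rfl, Or.inl (by omega)⟩⟩
    · rcases Nat.lt_succ_iff_lt_or_eq.1 hv with h' | rfl
      · have hj : v - C.Q * C.W < C.m := by
          have : C.Z = C.Q * C.W + C.m := rfl
          omega
        obtain ⟨i, hi⟩ := hC.set _ hj
        obtain ⟨q, hq, rfl, -⟩ := exists_here (x := 0) hj (Nat.zero_le _) hi
        exact ⟨q, hq, Or.inr (Or.inl ⟨h, h', hi⟩)⟩
      · exact ⟨0, Q_pos, alive_Z⟩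
  clause p hp := by
    have hP : 0 < C.counter.numClauses := Nat.succ_pos _
    have hq := (Nat.div_lt_iff_lt_mul hP).2 hp
    exact ⟨_, hq, fun r => alive_clause hq⟩
  -- The variable at place `0` of block `q + 1` is new, which makes consecutive bags different.
  new q hq := by
    have h := alive_block (r := 0) hq (W_pos (C := C)) le_rfl (Nat.le_succ _)
    refine ⟨_, h.lt, h, ?_⟩
    have h1 := Nat.mul_lt_mul_of_pos_right hq (W_pos (C := C))
    have h2 := Nat.mul_div_cancel (q + 1) (W_pos (C := C))
    have h3 : C.Z = C.Q * C.W + C.m := rfl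
    rintro (h | h | h)
    · rw [add_zero, h2] at h; omega
    · omega
    · omega

theorem Valid.satisfiable_iff (hC : C.Valid) :
    hC.satData.formula.Satisfiable ↔ Coverable C.n C.m C.inc C.k C.forced :=
  hC.satData.satisfiable_iff.trans
    ⟨fun ⟨_, h⟩ => hC.coverable_of_sat h, fun h => hC.sat_of_coverable h⟩

-- A bag consists of two blocks of `W` variables, one variable for each open link (the elements of
-- the current bag, plus one), one for each set of the current bag, and `Z`. Elements and sets
-- together are at most `K + 1`.
open Classical in
theorem Valid.width_le (hC : C.Valid) {K : ℕ}
    (hK : ∀ i, ((Finset.range (C.n + C.m)).filter (C.B i)).card ≤ K + 1) :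
    hC.satData.toInstance.decomp.width ≤ K + 2 * C.W + 2 := by
  refine hC.satData.width_le fun q hq => ?_
  have hW := W_pos (C := C)
  have hsub : (Finset.range hC.satData.V).filter (hC.satData.alive q) ⊆
      (Finset.Ico ((q - 1) * C.W) ((q + 1) * C.W) ∪
      ((Finset.range C.Q).filter (fun q' => C.Link q' ∧ q' ≤ q ∧ q ≤ q' + C.X)).image (· * C.W)) ∪
      (((Finset.range C.m).filter (fun j => C.B (C.bag q) (C.n + j))).image C.chosen ∪ {C.Z}) := by
    intro v hv
    rw [Finset.mem_filter] at hv
    rw [Finset.mem_union, Finset.mem_union, Finset.mem_union, Finset.mem_image, Finset.mem_image,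
      Finset.mem_singleton, Finset.mem_Ico]
    rcases hv.2 with ⟨h1, h2, h3 | h3⟩ | h | h
    · left; left
      constructor
      · calc (q - 1) * C.W ≤ v / C.W * C.W := Nat.mul_le_mul_right _ (Nat.sub_le_of_le_add h3)
          _ ≤ v := Nat.div_mul_le_self _ _
      · exact (Nat.div_lt_iff_lt_mul hW).1 (Nat.lt_succ_of_le h2)
    · left; right
      refine ⟨v / C.W, Finset.mem_filter.2 ⟨Finset.mem_range.2
        ((Nat.div_lt_iff_lt_mul hW).2 h1), h3.2.1, h2, h3.2.2⟩, ?_⟩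
      exact Nat.div_mul_cancel (Nat.dvd_of_mod_eq_zero h3.1)
    · right; left
      have : C.Z = C.Q * C.W + C.m := rfl
      refine ⟨v - C.Q * C.W, Finset.mem_filter.2 ⟨Finset.mem_range.2 (by omega), h.2.2⟩, ?_⟩
      rw [chosen]; omega
    · right; right; exact h
  have hsum : ((Finset.range C.n).filter (C.B (C.bag q))).card +
      ((Finset.range C.m).filter (fun j => C.B (C.bag q) (C.n + j))).card ≤ K + 1 := by
    refine le_trans ?_ (hK (C.bag q))
    rw [← Finset.card_map (addLeftEmbedding C.n) (s := (Finset.range C.m).filter _),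
      ← Finset.card_union_of_disjoint]
    · refine Finset.card_le_card fun v hv => ?_
      simp only [Finset.mem_union, Finset.mem_filter, Finset.mem_range, Finset.mem_map,
        addLeftEmbedding_apply] at hv ⊢
      rcases hv with hv | ⟨s, hs, rfl⟩
      · exact ⟨by omega, hv.2⟩
      · exact ⟨by omega, hs.2⟩
    · rw [Finset.disjoint_left]
      intro v hv hv'
      simp only [Finset.mem_filter, Finset.mem_range, Finset.mem_map,
        addLeftEmbedding_apply] at hv hv'
      obtain ⟨s, _, rfl⟩ := hv'
      omega
  have h1 := hC.convex.card_links_le q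
  have h2 : (q + 1) * C.W - (q - 1) * C.W ≤ 2 * C.W := by
    rw [← Nat.sub_mul]; exact Nat.mul_le_mul_right _ (by omega)
  refine (Finset.card_le_card hsub).trans ((Finset.card_union_le _ _).trans ?_)
  have h3 := (Finset.card_union_le (Finset.Ico ((q - 1) * C.W) ((q + 1) * C.W))
    (((Finset.range C.Q).filter (fun q' => C.Link q' ∧ q' ≤ q ∧ q ≤ q' + C.X)).image (· * C.W)))
  have h4 := Finset.card_union_le (((Finset.range C.m).filter
    (fun j => C.B (C.bag q) (C.n + j))).image C.chosen) {C.Z}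
  have h5 := Finset.card_image_le (s := (Finset.range C.Q).filter
    (fun q' => C.Link q' ∧ q' ≤ q ∧ q ≤ q' + C.X)) (f := (· * C.W))
  have h6 := Finset.card_image_le (s := (Finset.range C.m).filter
    (fun j => C.B (C.bag q) (C.n + j))) (f := C.chosen)
  rw [Nat.card_Ico] at h3
  rw [Finset.card_singleton] at h4
  omega

end CoverSweep

namespace RAM

/-! ## The sweep of an encoded path decomposition -/

theorem word_le {l : List ℕ} {M : ℕ} (h : ∀ a ∈ l, a ≤ M) (i : ℕ) : word l i ≤ M := by
  rw [word, List.getD_eq_getElem?_getD]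
  rcases hi : l[i]? with _ | a
  · simp
  · exact h a (List.mem_of_getElem? hi)

theorem le_of_mem_encodeLists {L : List (List ℕ)} {M : ℕ} (h0 : L.length ≤ M)
    (h : ∀ l ∈ L, l.length ≤ M ∧ ∀ a ∈ l, a ≤ M) : ∀ a ∈ encodeLists L, a ≤ M := by
  intro a ha
  simp only [encodeLists, List.mem_cons, List.mem_flatMap] at ha
  rcases ha with rfl | ⟨l, hl, rfl | ha⟩
  · exact h0
  · exact (h l hl).1
  · exact (h l hl).2 a ha

section

variable {V : Type} [DecidableEq V] {G : SimpleGraph V} {D : PathDecomposition G} {code : V → ℕ}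
  {w : ℕ → ℕ} {n : ℕ} {A : List (List ℕ)}

theorem Encodes.sweep_B (h : Encodes w n A (D.bags.map (List.map code))) {i y : ℕ} :
    (sweepOf w).B i y ↔ ∃ hi : i < D.bags.length, ∃ v ∈ D.bags[i], code v = y := by
  simp only [sweepOf, h.numBags, List.length_map]
  constructor
  · rintro ⟨hi, hy⟩
    rw [h.inList_snd i (by simpa using hi)] at hy
    exact ⟨hi, by simpa using hy⟩
  · rintro ⟨hi, hy⟩
    refine ⟨hi, ?_⟩
    rw [h.inList_snd i (by simpa using hi)]
    simpa using hy

theorem Encodes.sweep_convex (h : Encodes w n A (D.bags.map (List.map code)))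
    (hc : Function.Injective code) : (sweepOf w).Convex := by
  intro y i j k hij hjk hi hk
  rw [h.sweep_B] at hi hk ⊢
  obtain ⟨hi, v, hv, rfl⟩ := hi
  obtain ⟨hk, v', hv', he⟩ := hk
  obtain rfl := hc he
  refine ⟨by omega, v', ?_, rfl⟩
  have := D.isPathDecomposition.interval v' ⟨i, by simpa using hi⟩
    ⟨j, by simp; omega⟩ ⟨k, by simpa using hk⟩ hij hjk
  simp only [List.get_eq_getElem, List.getElem_map, List.mem_toFinset] at this
  exact this hv hv'

theorem Encodes.sweep_vertex (h : Encodes w n A (D.bags.map (List.map code))) (v : V) :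
    ∃ i, (sweepOf w).B i (code v) := by
  obtain ⟨b, hb, hv⟩ := D.isPathDecomposition.vertex_mem v
  obtain ⟨b, hb', rfl⟩ := List.mem_map.1 hb
  obtain ⟨i, hi, rfl⟩ := List.mem_iff_getElem.1 hb'
  exact ⟨i, h.sweep_B.2 ⟨hi, v, by simpa using hv, rfl⟩⟩

theorem Encodes.sweep_adj (h : Encodes w n A (D.bags.map (List.map code))) {v v' : V}
    (hadj : G.Adj v v') : ∃ i, (sweepOf w).B i (code v) ∧ (sweepOf w).B i (code v') := by
  obtain ⟨b, hb, hv, hv'⟩ := D.isPathDecomposition.edge_mem v v' hadj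
  obtain ⟨b, hb', rfl⟩ := List.mem_map.1 hb
  obtain ⟨i, hi, rfl⟩ := List.mem_iff_getElem.1 hb'
  exact ⟨i, h.sweep_B.2 ⟨hi, v, by simpa using hv, rfl⟩,
    h.sweep_B.2 ⟨hi, v', by simpa using hv', rfl⟩⟩

open Classical in
theorem Encodes.sweep_card_le (h : Encodes w n A (D.bags.map (List.map code))) (N i : ℕ) :
    ((Finset.range N).filter ((sweepOf w).B i)).card ≤ D.width + 1 := by
  by_cases hi : i < D.bags.length
  · have hsub : (Finset.range N).filter ((sweepOf w).B i) ⊆ (D.bags[i].map code).toFinset := by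
      intro y hy
      obtain ⟨_, v, hv, rfl⟩ := h.sweep_B.1 (Finset.mem_filter.1 hy).2
      exact List.mem_toFinset.2 (List.mem_map_of_mem hv)
    refine (Finset.card_le_card hsub).trans ((List.toFinset_card_le _).trans ?_)
    rw [List.length_map]
    exact PathDecomposition.width_le_iff.1 le_rfl _ (List.getElem_mem hi)
  · rw [Finset.card_eq_zero.2]
    · omega
    · exact Finset.filter_eq_empty_iff.2 fun y _ hy => hi (h.sweep_B.1 hy).1

theorem Encodes.sweep_n (h : Encodes w n A (D.bags.map (List.map code))) : (sweepOf w).n = n := h.zero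

theorem Encodes.sweep_m (h : Encodes w n A (D.bags.map (List.map code))) :
    (sweepOf w).m = A.length := h.one

theorem le_of_mem_bags [Fintype V] {M : ℕ} (hM : 2 * Fintype.card V + 1 ≤ M)
    (hcode : ∀ v, code v ≤ M) : ∀ a ∈ encodeLists (D.bags.map (List.map code)), a ≤ M := by
  refine le_of_mem_encodeLists ?_ fun l hl => ?_
  · rw [List.length_map]; exact D.length_bags_le.trans hM
  · obtain ⟨b, hb, rfl⟩ := List.mem_map.1 hl
    refine ⟨?_, fun a ha => ?_⟩
    · have := (D.nodup b hb).length_le_card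
      rw [List.length_map]; omega
    · obtain ⟨v, -, rfl⟩ := List.mem_map.1 ha
      exact hcode v

end

end RAM

/-! ### Set Cover instances as sweeps -/

namespace SetCoverInstance

variable (I : SetCoverInstance)

def code : Fin I.numElements ⊕ Fin I.sets.length → ℕ :=
  Sum.elim (fun u => u.val) (fun j => I.numElements + j.val)

theorem code_injective : Function.Injective I.code := by
  rintro (u | j) (u' | j') h <;> simp only [code, Sum.elim_inl, Sum.elim_inr] at h
  · rw [Fin.ext h]
  · have := u.2; omega
  · have := u'.2; omega
  · rw [Fin.ext (by omega : j.val = j'.val)]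

theorem encodes : RAM.Encodes (RAM.word I.encode) I.numElements
    (I.sets.map (List.map (fun u => u.val))) (I.decomp.bags.map (List.map I.code)) := ⟨rfl⟩

theorem inList_iff {u j : ℕ} (hu : u < I.numElements) (hj : j < I.numSets) :
    RAM.InList (RAM.word I.encode) 1 j u ↔ (⟨u, hu⟩ : Fin _) ∈ I.sets.get ⟨j, hj⟩ := by
  rw [I.encodes.inList_fst j (by rw [List.length_map]; exact hj), List.getElem_map, List.mem_map]
  constructor
  · rintro ⟨a, ha, rfl⟩
    exact ha
  · exact fun h => ⟨_, h, rfl⟩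

theorem word_le (i : ℕ) : RAM.word I.encode i ≤ 2 * (I.numElements + I.numSets) + 1 := by
  refine RAM.word_le (fun a ha => ?_) i
  simp only [encode, List.mem_cons, List.mem_append] at ha
  have hs : I.sets.length = I.numSets := rfl
  rcases ha with rfl | ha | ha
  · omega
  · refine RAM.le_of_mem_encodeLists ?_ (fun l hl => ?_) a ha
    · rw [List.length_map]; omega
    · obtain ⟨S, hS, rfl⟩ := List.mem_map.1 hl
      refine ⟨?_, fun a ha => ?_⟩
      · have := (I.sets_nodup S hS).length_le_card
        rw [Fintype.card_fin] at this
        rw [List.length_map]; omega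
      · obtain ⟨u, -, rfl⟩ := List.mem_map.1 ha
        have := u.2; omega
  · refine RAM.le_of_mem_bags (code := I.code) (D := I.decomp) ?_ (fun v => ?_) a ha
    · rw [Fintype.card_sum, Fintype.card_fin, Fintype.card_fin, hs]
    · rcases v with u | j
      · have := u.2; simp only [code, Sum.elim_inl]; omega
      · have := j.2; simp only [code, Sum.elim_inr]; omega

/-- The sweep over the bags, with requirements on the cover. -/
def toCoverSweep (w : ℕ → ℕ) (k : ℕ) (forced : ℕ → Prop) : CoverSweep where
  toSweep := RAM.sweepOf w
  inc u j := RAM.InList w 1 j u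
  k := k
  forced := forced

theorem sweep_m : (RAM.sweepOf (RAM.word I.encode)).m = I.numSets :=
  I.encodes.sweep_m.trans (List.length_map _)

theorem sweep_n : (RAM.sweepOf (RAM.word I.encode)).n = I.numElements := I.encodes.sweep_n

theorem valid {k : ℕ} (hk : k ≤ I.numSets) (forced : ℕ → Prop) :
    (toCoverSweep (RAM.word I.encode) k forced).Valid where
  convex := I.encodes.sweep_convex I.code_injective
  set j hj := by
    have hj' : j < I.numSets := by rw [← I.sweep_m]; exact hj
    have := I.encodes.sweep_vertex (Sum.inr ⟨j, hj'⟩)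
    show ∃ i, (RAM.sweepOf _).B i ((RAM.sweepOf (RAM.word I.encode)).n + j)
    rw [I.sweep_n]
    exact this
  elt u hu := by
    have hu' : u < I.numElements := by rw [← I.sweep_n]; exact hu
    exact I.encodes.sweep_vertex (Sum.inl ⟨u, hu'⟩)
  edge u hu j hj h := by
    have hj' : j < I.numSets := by rw [← I.sweep_m]; exact hj
    have hu' : u < I.numElements := by rw [← I.sweep_n]; exact hu
    have hadj : (incidenceGraph I.sets).Adj (Sum.inl ⟨u, hu'⟩) (Sum.inr ⟨j, hj'⟩) :=
      (SimpleGraph.fromRel_adj _ _ _).2 ⟨by simp, Or.inl ⟨_, _, rfl, rfl,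
        (I.inList_iff hu' hj').1 h⟩⟩
    have := I.encodes.sweep_adj hadj
    show ∃ i, (RAM.sweepOf _).B i u ∧
      (RAM.sweepOf _).B i ((RAM.sweepOf (RAM.word I.encode)).n + j)
    rw [I.sweep_n]
    exact this
  k_le := by
    show k ≤ _
    rwa [← I.sweep_m] at hk

end SetCoverInstance

/-! ## Finding a minimum cover by queries -/

namespace CoverSweep

theorem Coverable.mono {n m k k' : ℕ} {inc : ℕ → ℕ → Prop} {F F' : ℕ → Prop}
    (h : Coverable n m inc k F) (hk : k ≤ k') (hF : ∀ j < m, F' j → F j) :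
    Coverable n m inc k' F' := by
  obtain ⟨T, h1, h2, h3, h4⟩ := h
  exact ⟨T, h1, h2, h3.trans hk, fun j hj hf => h4 j hj (hF j hj hf)⟩

/-- The bound for the cardinality in query `q`: the first `m + 1` queries determine the minimum. -/
def queryBound (m : ℕ) (v : ℕ → ℕ) (q : ℕ) : ℕ :=
  -- Coverability is monotone in the bound, so the number of negative answers among the first `m +
  -- 1` is the minimum cardinality. The cut-off at `m` takes effect only if there is no cover, where
  -- this number is `m + 1`.
  if q ≤ m then q else min (∑ i ∈ Finset.range (m + 1), (1 - v i)) m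

/-- The query `m + 1 + j` asks if `j` can be added to the sets for which the answer was yes. -/
def queryForced (m : ℕ) (v : ℕ → ℕ) (q j : ℕ) : Prop :=
  m < q ∧ (j + m + 1 = q ∨ (j + m + 1 < q ∧ v (m + 1 + j) ≠ 0))

def queryOutput (m : ℕ) (v : ℕ → ℕ) : List ℕ :=
  if ∀ i < m + 1, v i = 0 then [0]
  else (((List.range m).filter (fun j => v (m + 1 + j) ≠ 0)).length + 1) ::
    (List.range m).filter (fun j => v (m + 1 + j) ≠ 0)

/-- The first `q` answers are right. -/
def Answers (n m : ℕ) (inc : ℕ → ℕ → Prop) (q : ℕ) (v : ℕ → ℕ) : Prop :=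
  ∀ q' < q, (Coverable n m inc (queryBound m v q') (queryForced m v q') ∧ v q' = 1) ∨
    (¬ Coverable n m inc (queryBound m v q') (queryForced m v q') ∧ v q' = 0)

theorem queryBound_le {m : ℕ} (v : ℕ → ℕ) (q : ℕ) : queryBound m v q ≤ m := by
  unfold queryBound; split_ifs
  · assumption
  · exact min_le_right _ _

/-- A query depends only on the answers before it, so recording a new answer does not alter the
questions already asked. -/
theorem queryBound_congr {m q : ℕ} {v v' : ℕ → ℕ} (h : ∀ i < q, v i = v' i) :
    queryBound m v q = queryBound m v' q := by
  unfold queryBound; split_ifs with hq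
  · rfl
  · rw [Finset.sum_congr rfl fun i hi => by rw [h i (by have := Finset.mem_range.1 hi; omega)]]

theorem queryForced_congr {m q : ℕ} {v v' : ℕ → ℕ} (h : ∀ i < q, v i = v' i) :
    queryForced m v q = queryForced m v' q := by
  funext j
  refine propext (and_congr_right fun _ => or_congr_right (and_congr_right fun hj => ?_))
  rw [h _ (by omega)]

variable {n m : ℕ} {inc : ℕ → ℕ → Prop}

theorem Answers.update {q a : ℕ} {v : ℕ → ℕ} (h : Answers n m inc q v)
    (ha : (Coverable n m inc (queryBound m v q) (queryForced m v q) ∧ a = 1) ∨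
      (¬ Coverable n m inc (queryBound m v q) (queryForced m v q) ∧ a = 0)) :
    Answers n m inc (q + 1) (Function.update v q a) := by
  intro q' hq'
  have hc : ∀ i < q', Function.update v q a i = v i := fun i hi =>
    Function.update_of_ne (by omega) _ _
  rw [queryBound_congr hc, queryForced_congr hc]
  rcases Nat.lt_succ_iff_lt_or_eq.1 hq' with h1 | rfl
  · rw [Function.update_of_ne (by omega)]; exact h q' h1
  · rwa [Function.update_self]

-- The bound is frozen at the minimum `k₀`, and a set is accepted if some cover of that size
-- contains it together with all sets accepted before. In the end some `k₀`-cover `T` contains all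
-- accepted sets. A rejected set is not in `T`, since `T` itself would have justified accepting it.
-- Hence `T` consists precisely of the accepted sets.
open Classical in
theorem Answers.output {v : ℕ → ℕ} (h : Answers n m inc (2 * m + 1) v) :
    ((¬ ∃ k ≤ m, Coverable n m inc k (fun _ => False)) ∧ queryOutput m v = [0]) ∨
    ∃ T : Finset ℕ, T = (Finset.range m).filter (fun j => v (m + 1 + j) ≠ 0) ∧
      queryOutput m v = (((List.range m).filter (fun j => v (m + 1 + j) ≠ 0)).length + 1) ::
        (List.range m).filter (fun j => v (m + 1 + j) ≠ 0) ∧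
      (∀ u < n, ∃ j ∈ T, inc u j) ∧
      ∀ k, Coverable n m inc k (fun _ => False) → T.card ≤ k := by
  let P : ℕ → Prop := fun k => Coverable n m inc k (fun _ => False)
  have hP : ∀ q ≤ m, (P q ∧ v q = 1) ∨ (¬ P q ∧ v q = 0) := by
    intro q hq
    have e : queryForced m v q = fun _ => False := by
      funext j; simp [queryForced, show ¬ m < q by omega]
    have := h q (by omega)
    rwa [e, queryBound, if_pos hq] at this
  have hmono : ∀ {k k'}, k ≤ k' → P k → P k' := fun hk h => h.mono hk fun _ _ => id
  by_cases hz : ∀ i < m + 1, v i = 0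
  · left
    refine ⟨fun ⟨k, hk, hc⟩ => ?_, by rw [queryOutput, if_pos hz]⟩
    rcases hP k hk with h1 | h1
    · have := hz k (by omega); omega
    · exact h1.1 hc
  right
  have hex : ∃ k, P k ∧ k ≤ m := by
    push Not at hz
    obtain ⟨i, hi, hv⟩ := hz
    rcases hP i (by omega) with h1 | h1
    · exact ⟨i, h1.1, by omega⟩
    · exact (hv h1.2).elim
  obtain ⟨hk, hkm⟩ := Nat.find_spec hex
  have hmin : ∀ k < Nat.find hex, ¬ P k := fun k hk1 hk2 => Nat.find_min hex hk1 ⟨hk2, by omega⟩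
  set k₀ := Nat.find hex
  have hbound : ∀ q, m < q → queryBound m v q = k₀ := by
    intro q hq
    have : ∑ i ∈ Finset.range (m + 1), (1 - v i) = k₀ := by
      rw [Finset.sum_congr rfl (g := fun i => if i < k₀ then 1 else 0) fun i hi => ?_]
      · rw [← Finset.sum_filter, Finset.sum_const, smul_eq_mul, mul_one]
        have : (Finset.range (m + 1)).filter (fun i => i < k₀) = Finset.range k₀ := by
          ext i; simp; omega
        rw [this, Finset.card_range]
      · have hi := Finset.mem_range.1 hi
        by_cases hik : i < k₀
        · rcases hP i (by omega) with h1 | h1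
          · exact (hmin i hik h1.1).elim
          · rw [if_pos hik, h1.2]
        · rcases hP i (by omega) with h1 | h1
          · rw [if_neg hik, h1.2]
          · exact (h1.1 (hmono (by omega) hk)).elim
    rw [queryBound, if_neg (by omega), this, min_eq_left hkm]
  have hR : ∀ j ≤ m, Coverable n m inc k₀ (fun i => i < j ∧ v (m + 1 + i) ≠ 0) := by
    intro j
    induction j with
    | zero => exact fun _ => hk.mono le_rfl fun _ _ h => by omega
    | succ j ih =>
      intro hj
      have hf : ∀ i, queryForced m v (m + 1 + j) i ↔ i = j ∨ (i < j ∧ v (m + 1 + i) ≠ 0) := by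
        intro i
        have e1 : i + m + 1 = m + 1 + j ↔ i = j := by omega
        have e2 : i + m + 1 < m + 1 + j ↔ i < j := by omega
        rw [queryForced, e1, e2]
        exact and_iff_right (by omega)
      rcases h (m + 1 + j) (by omega) with h1 | h1
      · rw [hbound _ (by omega)] at h1
        refine h1.1.mono le_rfl fun i _ hi => (hf i).2 ?_
        rcases Nat.lt_succ_iff_lt_or_eq.1 hi.1 with h2 | h2
        · exact Or.inr ⟨h2, hi.2⟩
        · exact Or.inl h2
      · refine (ih (by omega)).mono le_rfl fun i _ hi => ⟨?_, hi.2⟩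
        rcases Nat.lt_succ_iff_lt_or_eq.1 hi.1 with h2 | rfl
        · exact h2
        · exact (hi.2 h1.2).elim
  obtain ⟨T, h1, h2, h3, h4⟩ := hR m le_rfl
  have hT : T = (Finset.range m).filter (fun j => v (m + 1 + j) ≠ 0) := by
    ext j
    rw [Finset.mem_filter, Finset.mem_range]
    refine ⟨fun hj => ⟨h1 j hj, ?_⟩, fun hj => h4 j hj.1 hj⟩
    rcases h (m + 1 + j) (by have := h1 j hj; omega) with h5 | h5
    · omega
    · refine (h5.1 ?_).elim
      rw [hbound _ (by omega)]
      refine ⟨T, h1, h2, h3, fun i hi hf => ?_⟩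
      rcases hf.2 with hf | hf
      · obtain rfl : i = j := by omega
        exact hj
      · exact h4 i hi ⟨hi, hf.2⟩
  refine ⟨T, hT, by rw [queryOutput, if_neg hz], h2, fun k hc => h3.trans ?_⟩
  by_contra hlt
  exact hmin k (by omega) hc

end CoverSweep

namespace SetCoverInstance

variable (I : SetCoverInstance)

def Inc (u j : ℕ) : Prop := RAM.InList (RAM.word I.encode) 1 j u

theorem isCover_iff {T : Finset (Fin I.numSets)} :
    I.IsCover T ↔ ∀ u < I.numElements, ∃ j ∈ T, I.Inc u j.val := by
  constructor
  · intro h u hu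
    obtain ⟨j, hj, h⟩ := h ⟨u, hu⟩
    exact ⟨j, hj, (I.inList_iff hu j.2).2 h⟩
  · intro h u
    obtain ⟨j, hj, h⟩ := h u.val u.2
    exact ⟨j, hj, (I.inList_iff u.2 j.2).1 h⟩

theorem IsCover.coverable {T : Finset (Fin I.numSets)} (h : I.IsCover T) :
    CoverSweep.Coverable I.numElements I.numSets I.Inc T.card (fun _ => False) := by
  refine ⟨T.map Fin.valEmbedding, fun j hj => ?_, fun u hu => ?_, (Finset.card_map _).le,
    fun _ _ h => h.elim⟩
  · obtain ⟨j, -, rfl⟩ := Finset.mem_map.1 hj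
    exact j.2
  · obtain ⟨j, hj, h⟩ := I.isCover_iff.1 h u hu
    exact ⟨j.val, Finset.mem_map_of_mem Fin.valEmbedding hj, h⟩

theorem correct_of_answers {v : ℕ → ℕ}
    (h : CoverSweep.Answers I.numElements I.numSets I.Inc (2 * I.numSets + 1) v) :
    I.Correct (RAM.word (CoverSweep.queryOutput I.numSets v)) := by
  classical
  rcases h.output with ⟨h1, h2⟩ | ⟨T, hT, h1, h2, h3⟩
  · left
    refine ⟨fun ⟨T, hT⟩ => h1 ⟨T.card, ?_, hT.coverable⟩, by rw [h2]; rfl⟩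
    simpa using T.card_le_univ
  · right
    set l := (List.finRange I.numSets).filter (fun j => v (I.numSets + 1 + j.val) ≠ 0) with hl
    have hmap : (List.range I.numSets).filter (fun j => v (I.numSets + 1 + j) ≠ 0) =
        l.map (fun j => j.val) := by
      convert (map_val_filter_finRange I.numSets (fun j => v (I.numSets + 1 + j) ≠ 0)).symm
    have hnodup : l.Nodup := (List.nodup_finRange _).filter _
    have hmem : ∀ j : Fin I.numSets, j ∈ l ↔ j.val ∈ T := by
      intro j
      simp [hl, hT]
    have hcard : l.toFinset.card = T.card := by
      rw [← Finset.card_map Fin.valEmbedding]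
      congr 1
      ext j
      simp only [Finset.mem_map, List.mem_toFinset, hmem, Fin.valEmbedding_apply]
      constructor
      · rintro ⟨j, hj, rfl⟩; exact hj
      · intro hj
        have hj' := hj
        rw [hT, Finset.mem_filter, Finset.mem_range] at hj'
        exact ⟨⟨j, hj'.1⟩, hj, rfl⟩
    rw [h1, hmap]
    refine ⟨l, hnodup, ⟨I.isCover_iff.2 fun u hu => ?_, fun T' hT' => ?_⟩, ?_, fun i => ?_⟩
    · obtain ⟨j, hj, h⟩ := h2 u hu
      have hj' := hj
      rw [hT, Finset.mem_filter, Finset.mem_range] at hj'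
      exact ⟨⟨j, hj'.1⟩, by rwa [List.mem_toFinset, hmem], h⟩
    · rw [hcard]; exact h3 _ hT'.coverable
    · simp [RAM.word]
    · simp [RAM.word]

end SetCoverInstance

/-! ### Time bounds -/

namespace RAM

theorem SolvableInTime.mono {X : Type} {enc : X → List ℕ} {corr : X → (ℕ → ℕ) → Prop}
    {b b' : X → ℝ} (h : SolvableInTime enc corr b) (hb : ∀ x, b x ≤ b' x) :
    SolvableInTime enc corr b' := by
  obtain ⟨p, hp⟩ := h
  refine ⟨p, fun x => ?_⟩
  obtain ⟨s, t, h1, h2, h3⟩ := hp x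
  exact ⟨s, t, h1, h2.trans (hb x), h3⟩

/-- Brings the time of an adaptive reduction into the required form: the query time `T` carries the
factor `β ^ pw` once, and everything else is polynomial in `N`. The summand `1` is absorbed because
`1 ≤ β`. -/
theorem SolvableInTime.of_polyBounded {X : Type} {enc : X → List ℕ} {corr : X → (ℕ → ℕ) → Prop}
    {T : X → ℝ} {M N pw : X → ℕ} {β : ℝ} {B B' : ℕ → ℕ} (hβ : 1 ≤ β)
    (h : ∃ c, SolvableInTime enc corr (fun x => (1 + T x) * ((M x : ℝ) + 2) ^ c))
    (hB : PolyBounded B) (hT : ∀ x, T x ≤ β ^ pw x * B (N x)) (hB' : PolyBounded B')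
    (hM : ∀ x, M x ≤ B' (N x)) :
    ∃ C c : ℕ, SolvableInTime enc corr (fun x => C * β ^ pw x * ((N x : ℝ) + 1) ^ c) := by
  obtain ⟨c, h⟩ := h
  obtain ⟨e, he⟩ := ((PolyBounded.const 1).add hB).mul ((hB'.add (.const 2)).pow c)
  refine ⟨2 ^ e, e, h.mono fun x => ?_⟩
  have h1 : (1 : ℝ) ≤ β ^ pw x := one_le_pow₀ hβ
  have h2 : ((M x : ℝ) + 2) ^ c ≤ ((B' (N x) : ℝ) + 2) ^ c :=
    pow_le_pow_left₀ (by positivity) (by have : (M x : ℝ) ≤ B' (N x) := by exact_mod_cast hM x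
                                         linarith) c
  have h3 : (1 + (B (N x) : ℝ)) * ((B' (N x) : ℝ) + 2) ^ c ≤ ((N x : ℝ) + 2) ^ e := by
    exact_mod_cast he (N x)
  have h4 : ((N x : ℝ) + 2) ^ e ≤ 2 ^ e * ((N x : ℝ) + 1) ^ e := by
    rw [← mul_pow]
    exact pow_le_pow_left₀ (by positivity) (by have : (0 : ℝ) ≤ N x := by positivity
                                               linarith) e
  have h5 : 1 + T x ≤ β ^ pw x * (1 + (B (N x) : ℝ)) := by
    have := hT x
    rw [mul_add, mul_one]; linarith
  calc (1 + T x) * ((M x : ℝ) + 2) ^ c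
      ≤ (β ^ pw x * (1 + (B (N x) : ℝ))) * ((M x : ℝ) + 2) ^ c :=
        mul_le_mul_of_nonneg_right h5 (by positivity)
    _ ≤ (β ^ pw x * (1 + (B (N x) : ℝ))) * ((B' (N x) : ℝ) + 2) ^ c :=
        mul_le_mul_of_nonneg_left h2 (by positivity)
    _ = β ^ pw x * ((1 + (B (N x) : ℝ)) * ((B' (N x) : ℝ) + 2) ^ c) := by ring
    _ ≤ β ^ pw x * (2 ^ e * ((N x : ℝ) + 1) ^ e) :=
        mul_le_mul_of_nonneg_left (h3.trans h4) (by positivity)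
    _ = _ := by push_cast; ring

end RAM

/-- An additive surplus `K` in the width costs the factor `β ^ K ≤ 2 ^ K`, which is polynomial if
`K` is logarithmic. -/
theorem query_time_le {β x : ℝ} {C c pw K D Y : ℕ} (h1 : 1 ≤ β) (h2 : β ≤ 2) (hK : 2 ^ K ≤ D)
    (hx : 0 ≤ x) (hxY : x ≤ Y) :
    C * β ^ (pw + K) * x ^ c ≤ β ^ pw * ((C * D * Y ^ c : ℕ) : ℝ) := by
  have e1 : β ^ K ≤ D := (pow_le_pow_left₀ (by linarith) h2 K).trans (by exact_mod_cast hK)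
  have e2 := pow_le_pow_left₀ hx hxY c
  have e3 : (0 : ℝ) ≤ β ^ pw := pow_nonneg (by linarith) _
  calc C * β ^ (pw + K) * x ^ c = β ^ pw * (C * β ^ K * x ^ c) := by rw [pow_add]; ring
    _ ≤ β ^ pw * (C * D * (Y : ℝ) ^ c) := mul_le_mul_of_nonneg_left
        (mul_le_mul (mul_le_mul_of_nonneg_left e1 (Nat.cast_nonneg _)) e2 (pow_nonneg hx _)
          (by positivity)) e3
    _ = _ := by push_cast; ring

/-! ## From 3-SAT to Set Cover -/

namespace RAM

open SetCoverInstance (toCoverSweep)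

variable {k : Fn} {forced : (ℕ → ℕ) → (ℕ → ℕ) → (ℕ → ℕ) → ℕ → Prop} {f g : Fn}

namespace PolyCoverSweep

theorem W : PolyComputable (fun w v e => (toCoverSweep w (k w v e) (forced w v e)).W) :=
  PolySweep.m.size.two_mul.add (.const 2)

theorem chosen (hf : PolyComputable f) :
    PolyComputable (fun w v e => (toCoverSweep w (k w v e) (forced w v e)).chosen (f w v e)) :=
  (PolySweep.Q.mul (W (k := k) (forced := forced))).add hf

theorem Z : PolyComputable (fun w v e => (toCoverSweep w (k w v e) (forced w v e)).Z) :=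
  chosen PolySweep.m

theorem here (hf : PolyComputable f) :
    PolyDecidable (fun w v e => (toCoverSweep w (k w v e) (forced w v e)).Here (f w v e)) :=
  (PolyDecidable.lt (PolySweep.item hf) PolySweep.m).and
    (PolySweep.B (PolySweep.bag hf) (PolySweep.n.add (PolySweep.item hf)))

theorem first (hf : PolyComputable f) :
    PolyDecidable (fun w v e => (toCoverSweep w (k w v e) (forced w v e)).First (f w v e)) :=
  (here hf).and ((PolyDecidable.eq (PolySweep.elt hf) (.const 0)).and
    (.forall_lt (PolySweep.bag hf)
      (PolySweep.B (.var 0) (PolySweep.n.add (PolySweep.item hf.tail))).not))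

open Classical in
theorem counter (hk : PolyComputable k)
    (hforced : PolyDecidable (fun w v e => forced w v (fun k => e (k + 1)) (e 0))) :
    PolyCounter (fun w v e => (toCoverSweep w (k w v e) (forced w v e)).counter) where
  L := PolySweep.m.size
  Q := PolySweep.Q
  Z := Z
  init := (PolySweep.m.two_pow_size.sub (.const 1)).sub hk
  z := .ite (first (.var 0)) (chosen (PolySweep.item (.var 0))).two_mul.succ Z.two_mul.succ
  c1 := by
    refine .ite (PolySweep.live (.var 0)) (.pick (.var 1) ?_ ?_ ?_) Z.two_mul
    · exact .ite (PolySweep.link (.var 0))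
        ((PolyComputable.var 0).mul (W (k := fun _ _ _ => 0) (forced := fun _ _ _ _ => False))).two_mul
        Z.two_mul.succ
    · exact .ite (PolySweep.prev (.var 0))
        (((PolyComputable.var 0).sub PolySweep.X).mul
          (W (k := fun _ _ _ => 0) (forced := fun _ _ _ _ => False))).two_mul.succ Z.two_mul.succ
    · exact .ite ((here (.var 0)).and (.inList (.const 1) (PolySweep.item (.var 0))
        (PolySweep.elt (.var 0)))) (chosen (PolySweep.item (.var 0))).two_mul.succ Z.two_mul.succ
  c2 := .ite ((here (.var 0)).and (PolyDecidable.bind₁ (h := fun w v e j =>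
      forced w v (fun k => e (k + 2)) j) (PolyDecidable.rename hforced (fun k => match k with
        | 0 => 0
        | k + 1 => k + 3)) (PolySweep.item (.var 0))))
    (chosen (PolySweep.item (.var 0))).two_mul.succ Z.two_mul

theorem alive (hf : PolyComputable f) (hg : PolyComputable g) :
    PolyDecidable (fun w v e =>
      (toCoverSweep w (k w v e) (forced w v e)).Alive (f w v e) (g w v e)) := by
  have hW := W (k := k) (forced := forced)
  have hZ := Z (k := k) (forced := forced)
  have hQW := PolySweep.Q.mul hW
  exact (((PolyDecidable.lt hg hQW).and ((PolyDecidable.le (hg.div hW) hf).and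
    ((PolyDecidable.le hf (hg.div hW).succ).or ((PolyDecidable.eq (hg.mod hW) (.const 0)).and
      ((PolySweep.link (hg.div hW)).and (.le hf ((hg.div hW).add PolySweep.X))))))).or
    (((PolyDecidable.le hQW hg).and ((PolyDecidable.lt hg hZ).and
      (PolySweep.B (PolySweep.bag hf) (PolySweep.n.add (hg.sub hQW))))).or (.eq hg hZ)))

theorem code (hk : PolyComputable k)
    (hforced : PolyDecidable (fun w v e => forced w v (fun k => e (k + 1)) (e 0))) :
    PolyList (fun w v e => satCode ((toCoverSweep w (k w v e) (forced w v e)).Z + 1)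
      ((toCoverSweep w (k w v e) (forced w v e)).Q *
        (toCoverSweep w (k w v e) (forced w v e)).counter.numClauses)
      (toCoverSweep w (k w v e) (forced w v e)).Q
      (toCoverSweep w (k w v e) (forced w v e)).counter.lit
      (toCoverSweep w (k w v e) (forced w v e)).Alive) :=
  .satCode Z.succ (PolySweep.Q.mul (counter hk hforced).numClauses) PolySweep.Q
    (((counter hk hforced).rename (fun k => k + 2)).lit (.var 0) (.var 1)) (alive (.var 0) (.var 1))

end PolyCoverSweep

theorem PolyComputable.queryBound {m f : Fn} (hm : PolyComputable m) (hf : PolyComputable f) :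
    PolyComputable (fun w v e => CoverSweep.queryBound (m w v e) v (f w v e)) := by
  have h := PolyComputable.sum (g := fun _ v _ i => 1 - v i) hm.succ
    ((PolyComputable.const 1).sub (.ans (.var 0)))
  exact .ite (.le hf hm) hf ((PolyComputable.ite (.le h hm) h hm).of_eq fun w v e => by
    simp only [min_def])

theorem PolyDecidable.queryForced {m f g : Fn} (hm : PolyComputable m) (hf : PolyComputable f)
    (hg : PolyComputable g) :
    PolyDecidable (fun w v e => CoverSweep.queryForced (m w v e) v (f w v e) (g w v e)) :=
  (PolyDecidable.lt hm hf).and ((PolyDecidable.eq (hg.add hm).succ hf).or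
    ((PolyDecidable.lt (hg.add hm).succ hf).and
      (PolyDecidable.eq (.ans (hm.succ.add hg)) (.const 0)).not))

theorem PolyList.queryOutput {m : Fn} (hm : PolyComputable m) :
    PolyList (fun w v e => CoverSweep.queryOutput (m w v e) v) := by
  have h : PolyList (fun w v e => (List.range (m w v e)).filter
      (fun j => v (m w v e + 1 + j) ≠ 0)) :=
    .filter_range (p := fun w v e j => v (m w v e + 1 + j) ≠ 0) hm
      (PolyDecidable.eq (.ans (hm.tail.succ.add (.var 0))) (.const 0)).not
  exact .ite (.forall_lt hm.succ (.eq (.ans (.var 0)) (.const 0))) (.cons (.const 0) .nil)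
    (.cons h.1.succ h)

end RAM

theorem Nat.two_pow_size_le (m : ℕ) : 2 ^ m.size ≤ 2 * m + 1 := by
  rcases Nat.eq_zero_or_pos m with rfl | h
  · simp
  · have h1 : 0 < m.size := Nat.size_pos.2 h
    have h2 := Nat.lt_size.1 (show m.size - 1 < m.size by omega)
    have h3 : 2 ^ m.size = 2 * 2 ^ (m.size - 1) := by
      rw [← pow_succ']; congr 1; omega
    omega

open RAM SetCoverInstance in
/-- A Set Cover solver that asks a 3-SAT solver. -/
theorem ThreeSatSolvable.setCover {ε : ℝ} (h0 : 0 < ε) (h1 : ε ≤ 1) (h : ThreeSatSolvable ε) :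
    SetCoverSolvable ε := by
  obtain ⟨C, c, h⟩ := h
  have hβ : (1 : ℝ) ≤ 2 - ε := by linarith
  have hm : PolyComputable (fun w _ _ => w 1) := .inp (.const 1)
  have hk : PolyComputable (fun w v e => CoverSweep.queryBound (w 1) v (e 0)) :=
    .queryBound hm (.var 0)
  have hforced : PolyDecidable (fun w v e => CoverSweep.queryForced (w 1) v (e 1) (e 0)) :=
    .queryForced hm (.var 1) (.var 0)
  have hcode := PolyCoverSweep.code
    (forced := fun w v e j => CoverSweep.queryForced (w 1) v (e 0) j) hk hforced
  -- The number of variables depends neither on the bound nor on the forced sets, so trivial ones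
  -- may be inserted.
  obtain ⟨BZ, hBZ, hZ⟩ := (PolyCoverSweep.Z (k := fun _ _ _ => 0)
    (forced := fun _ _ _ _ => False)).exists_bound
  let Z : SetCoverInstance → ℕ := fun I => (toCoverSweep (word I.encode) 0 (fun _ => False)).Z
  let N : SetCoverInstance → ℕ := fun I => I.numElements + I.numSets
  have key := SolvableInTime.of_queries (encX := SetCoverInstance.encode)
    (corrX := SetCoverInstance.Correct) h (n := fun w _ _ => 2 * w 1 + 1) hm.two_mul.succ hcode
    (PolyList.queryOutput hm)
    (fun I => 2 * N I + 1)
    -- The surplus `4 * size + 6` is `2 * W + 2` from `CoverSweep.Valid.width_le`. The formula has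
    -- `Z + 1` variables, and the hypothesis adds one more.
    (fun I => C * (2 - ε) ^ (I.decomp.width + (4 * I.numSets.size + 6)) * ((Z I : ℝ) + 2) ^ c)
    (fun I => I.word_le) (fun I => by positivity)
    (fun I q v => CoverSweep.Answers I.numElements I.numSets I.Inc q v)
    (fun I q hq => by omega)
    (fun I v q hq hist => ?_)
    (fun I v hist => ?_)
  · have := SolvableInTime.of_polyBounded (N := N) (pw := fun I => I.decomp.width) hβ key
      -- The factor `64 * (2 * x + 1) ^ 4` bounds `2 ^ (4 * size + 6)`, by `Nat.two_pow_size_le`.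
      (B := fun x => C * (64 * (2 * x + 1) ^ 4) * (BZ (2 * x + 1) + 2) ^ c)
      (B' := fun x => 2 * x + 1) ?_ (fun I => ?_) ?_ (fun I => le_rfl)
    · obtain ⟨C', c', h'⟩ := this
      refine ⟨C', c', h'.mono fun I => ?_⟩
      simp only [N]
      push_cast
      exact le_rfl
    · have h2 := ((PolyBounded.const 2).mul .id).add (.const 1)
      exact ((PolyBounded.const C).mul ((PolyBounded.const 64).mul (h2.pow 4))).mul
        (((hBZ.comp h2).add (.const 2)).pow c)
    · refine query_time_le hβ (by linarith) ?_ (by positivity) ?_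
      · rw [pow_add, pow_mul', mul_comm]
        refine Nat.mul_le_mul_left _ (Nat.pow_le_pow_left ?_ 4)
        have := I.numSets.two_pow_size_le
        simp only [N]; omega
      · have := hZ (2 * N I + 1) (word I.encode) (fun _ => 0) (fun _ => 0)
          ⟨I.word_le, fun _ => Nat.zero_le _, fun _ => Nat.zero_le _⟩
        exact_mod_cast Nat.add_le_add_right this 2
    · exact ((PolyBounded.const 2).mul .id).add (.const 1)
  · have hw1 : word I.encode 1 = I.numSets := I.sweep_m
    have hC := I.valid (CoverSweep.queryBound_le v q) (CoverSweep.queryForced I.numSets v q)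
    have hsat : hC.satData.formula.Satisfiable ↔
        CoverSweep.Coverable I.numElements I.numSets I.Inc (CoverSweep.queryBound I.numSets v q)
          (CoverSweep.queryForced I.numSets v q) := by
      rw [hC.satisfiable_iff]
      show CoverSweep.Coverable (sweepOf (word I.encode)).n (sweepOf (word I.encode)).m I.Inc _ _ ↔ _
      rw [I.sweep_m, I.sweep_n]
      rfl
    refine ⟨hC.satData.toInstance, ?_, ?_, fun out hout => ?_⟩
    · have hw := hC.width_le (K := I.decomp.width) fun i => I.encodes.sweep_card_le _ i
      have hw' : hC.satData.toInstance.decomp.width ≤ I.decomp.width + (4 * I.numSets.size + 6) := by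
        refine hw.trans ?_
        have : (toCoverSweep (word I.encode) (CoverSweep.queryBound I.numSets v q)
          (CoverSweep.queryForced I.numSets v q)).W = 2 * I.numSets.size + 2 := by
          rw [← I.sweep_m]; rfl
        omega
      have hn : ((hC.satData.toInstance.numVars : ℕ) : ℝ) + 1 = (Z I : ℝ) + 2 := by
        have : hC.satData.toInstance.numVars = Z I + 1 := rfl
        rw [this]; push_cast; ring
      rw [hn]
      exact mul_le_mul_of_nonneg_right (mul_le_mul_of_nonneg_left (pow_le_pow_right₀ hβ hw')
        (by positivity)) (by positivity)
    · rw [hC.satData.encode_eq, hw1]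
      rfl
    · have hout' : (CoverSweep.Coverable I.numElements I.numSets I.Inc
            (CoverSweep.queryBound I.numSets v q) (CoverSweep.queryForced I.numSets v q) ∧ out 0 = 1) ∨
          (¬ CoverSweep.Coverable I.numElements I.numSets I.Inc
            (CoverSweep.queryBound I.numSets v q) (CoverSweep.queryForced I.numSets v q) ∧
              out 0 = 0) := by
        rw [← hsat]; exact hout
      exact ⟨by rcases hout' with h | h <;> omega, hist.update hout'⟩
  · have hw1 : word I.encode 1 = I.numSets := I.sweep_m
    simp only [hw1] at hist ⊢
    exact I.correct_of_answers hist

/-! ## From Set Cover to its decision version -/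

theorem RAM.length_encodeLists_le {L : List (List ℕ)} {M : ℕ} (h0 : L.length ≤ M)
    (h : ∀ l ∈ L, l.length ≤ M) : (encodeLists L).length ≤ 1 + M * (M + 1) := by
  have key : ∀ L : List (List ℕ), (∀ l ∈ L, l.length ≤ M) →
      (L.flatMap (fun l => l.length :: l)).length ≤ L.length * (M + 1) := by
    intro L
    induction L with
    | nil => simp
    | cons l L ih =>
      intro h
      have h1 := ih fun l hl => h l (List.mem_cons_of_mem _ hl)
      have h2 := h l List.mem_cons_self
      rw [List.flatMap_cons, List.length_append, List.length_cons, List.length_cons, add_mul]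
      omega
  have h1 := (key L h).trans (Nat.mul_le_mul_right _ h0)
  rw [encodeLists, List.length_cons]
  omega

namespace SetCoverInstance

variable (I : SetCoverInstance)

/-- Tells how many cells have to be copied when a decision instance is turned into a query. -/
theorem length_encode_le : I.encode.length ≤ 3 + 2 * ((2 * (I.numElements + I.numSets) + 1) *
    (2 * (I.numElements + I.numSets) + 1 + 1)) := by
  have hs : I.sets.length = I.numSets := rfl
  have h1 := RAM.length_encodeLists_le (L := I.sets.map (List.map (fun u => u.val)))
    (M := 2 * (I.numElements + I.numSets) + 1) (by rw [List.length_map]; omega) fun l hl => by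
      obtain ⟨S, hS, rfl⟩ := List.mem_map.1 hl
      have := (I.sets_nodup S hS).length_le_card
      rw [Fintype.card_fin] at this
      rw [List.length_map]; omega
  have hcard : Fintype.card (Fin I.numElements ⊕ Fin I.sets.length) =
      I.numElements + I.numSets := by
    rw [Fintype.card_sum, Fintype.card_fin, Fintype.card_fin, hs]
  have h2 := RAM.length_encodeLists_le (L := I.decomp.bags.map (List.map I.code))
    (M := 2 * (I.numElements + I.numSets) + 1) (by
      have := I.decomp.length_bags_le
      rw [hcard] at this
      rwa [List.length_map]) fun l hl => by
      obtain ⟨b, hb, rfl⟩ := List.mem_map.1 hl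
      have := (I.decomp.nodup b hb).length_le_card
      rw [hcard] at this
      rw [List.length_map]; omega
  have h3 : I.encode = I.numElements :: (encodeLists (I.sets.map (List.map (fun u => u.val))) ++
    encodeLists (I.decomp.bags.map (List.map I.code))) := rfl
  rw [h3, List.length_cons, List.length_append]
  omega

end SetCoverInstance

namespace SetCoverDecisionInstance

variable (I : SetCoverDecisionInstance)

theorem word_le (i : ℕ) : RAM.word I.encode i ≤ 2 * (I.numElements + I.numSets) + 1 := by
  rcases i with _ | i
  · have h := I.target_le
    show I.target ≤ _
    omega
  · exact I.toSetCoverInstance.word_le i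

theorem yes_iff {out : ℕ → ℕ} (h : I.toSetCoverInstance.Correct out) :
    I.Yes ↔ out 0 ≠ 0 ∧ out 0 - 1 ≤ I.target := by
  rcases h with ⟨h1, h2⟩ | ⟨l, h1, h2, h3, -⟩
  · exact ⟨fun ⟨T, hT, _⟩ => (h1 ⟨T, hT⟩).elim, fun h => (h.1 h2).elim⟩
  · have hl : l.toFinset.card = l.length := List.toFinset_card_of_nodup h1
    rw [h3, Nat.add_sub_cancel]
    constructor
    · rintro ⟨T, hT, hc⟩
      exact ⟨by omega, by have := h2.2 T hT; omega⟩
    · exact fun h => ⟨_, h2.1, by omega⟩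

theorem out_le {out : ℕ → ℕ} (h : I.toSetCoverInstance.Correct out) :
    out 0 ≤ 2 * (I.numElements + I.numSets) + 1 := by
  rcases h with ⟨h1, h2⟩ | ⟨l, h1, h2, h3, -⟩
  · omega
  · have := h1.length_le_card
    rw [Fintype.card_fin] at this
    omega

end SetCoverDecisionInstance

open RAM in
/-- A minimum cover answers all decision questions. -/
theorem SetCoverSolvable.decision {ε : ℝ} (h1 : ε ≤ 1) (h : SetCoverSolvable ε) :
    SetCoverDecisionSolvable ε := by
  classical
  obtain ⟨C, c, h⟩ := h
  have hβ : (1 : ℝ) ≤ 2 - ε := by linarith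
  let N : SetCoverDecisionInstance → ℕ := fun I => I.numElements + I.numSets
  have hM : PolyComputable (fun w _ _ => 2 * (w 1 + w 2) + 1) :=
    (PolyComputable.add (.inp (.const 1)) (.inp (.const 2))).two_mul.succ
  have key := SolvableInTime.of_queries (encX := SetCoverDecisionInstance.encode)
    (corrX := SetCoverDecisionInstance.Correct) h (PolyComputable.const 1)
    -- The query is the input without its first cell, the target. Copying beyond the end of the word
    -- is harmless, because a word is continued by zeros.
    (F := fun w _ _ => (List.range (3 + 2 * ((2 * (w 1 + w 2) + 1) *
      (2 * (w 1 + w 2) + 1 + 1)))).map (fun i => w (i + 1)))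
    (G := fun w v _ => [if v 0 ≠ 0 ∧ v 0 - 1 ≤ w 0 then 1 else 0])
    (.map_range (g := fun w _ _ i => w (i + 1))
      ((PolyComputable.const 3).add (hM.mul hM.succ).two_mul) (.inp (PolyComputable.var 0).succ))
    (.cons (.ite ((PolyDecidable.eq (.ans (.const 0)) (.const 0)).not.and
      (.le ((PolyComputable.ans (.const 0)).sub (.const 1)) (.inp (.const 0))))
      (.const 1) (.const 0)) .nil)
    (fun I => 2 * N I + 1)
    (fun I => C * (2 - ε) ^ I.decomp.width *
      ((I.numElements : ℝ) + (I.numSets : ℝ) + 1) ^ c)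
    (fun I => I.word_le) (fun I => by positivity)
    (fun I q v => 0 < q → (I.Yes ↔ v 0 ≠ 0 ∧ v 0 - 1 ≤ I.target))
    (fun I h => absurd h (lt_irrefl 0))
    (fun I v q hq hist => ?_)
    (fun I v hist => ?_)
  · have := SolvableInTime.of_polyBounded (N := N) (pw := fun I => I.decomp.width) hβ key
      (B := fun x => C * (x + 1) ^ c) (B' := fun x => 2 * x + 1) ?_ (fun I => ?_) ?_
      (fun I => le_rfl)
    · obtain ⟨C', c', h'⟩ := this
      refine ⟨C', c', h'.mono fun I => ?_⟩
      simp only [N]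
      push_cast
      exact le_rfl
    · exact (PolyBounded.const C).mul ((PolyBounded.id.add (.const 1)).pow c)
    · simp only [N]
      push_cast
      exact le_of_eq (by ring)
    · exact ((PolyBounded.const 2).mul .id).add (.const 1)
  · obtain rfl : q = 0 := Nat.lt_one_iff.1 hq
    refine ⟨I.toSetCoverInstance, le_rfl, ?_, fun out hout => ⟨I.out_le hout, fun _ => ?_⟩⟩
    · have e1 : word I.encode 1 = I.numElements := rfl
      have e2 : word I.encode 2 = I.numSets := I.toSetCoverInstance.sweep_m
      have hlen := I.toSetCoverInstance.length_encode_le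
      simp only [e1, e2]
      funext i
      simp only [word]
      rcases lt_or_ge i (3 + 2 * ((2 * (I.numElements + I.numSets) + 1) *
        (2 * (I.numElements + I.numSets) + 1 + 1))) with hi | hi
      · rw [List.getD_eq_getElem _ _ (by simpa using hi)]
        simp [SetCoverDecisionInstance.encode]
      · rw [List.getD_eq_default _ _ (by simpa using hi), List.getD_eq_default _ _ (by omega)]
    · rw [Function.update_self]
      exact I.yes_iff hout
  · have hy := hist Nat.one_pos
    have e : word I.encode 0 = I.target := rfl
    simp only [e]
    by_cases hI : I.Yes
    · exact Or.inl ⟨hI, by rw [if_pos (hy.1 hI)]; rfl⟩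
    · exact Or.inr ⟨hI, by rw [if_neg (fun h => hI (hy.2 h))]; rfl⟩

/-! ## A formula in which the counter enforces consistency -/

/-- A formula whose variables are `0, …, n - 1` and whose clauses are `0, …, m - 1`: the literals of
the clause `j` are `entry j 0, …, entry j (len j - 1)`. -/
structure ClauseSweep extends Sweep where
  len : ℕ → ℕ
  entry : ℕ → ℕ → ℕ

namespace ClauseSweep

variable (C : ClauseSweep)

def L : ℕ := C.Q.size
def W : ℕ := 2 * C.L + 2
def Z : ℕ := C.Q * C.W
/-- All variables of the clause that is considered in step `q` lie in the bag. -/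
def Whole (q : ℕ) : Prop := C.item q < C.m ∧ C.elt q = 0 ∧
  ∀ r < C.len (C.item q), C.B (C.bag q) (C.entry (C.item q) r / 2)

def Models (τ : ℕ → Prop) : Prop :=
  ∀ j < C.m, ∃ r < C.len j, (τ (C.entry j r / 2) ↔ C.entry j r % 2 = 1)

open Classical in
/-- The variable `q * W` is the value of `elt q` at time `q`. It may only become true along a link,
and this must not happen, because every link already contributes one to the sum. -/
noncomputable def counter : Counter where
  L := C.L
  Q := C.Q
  Z := C.Z
  -- Leaves room for exactly as many true literals as there are links.
  init := 2 ^ C.L - 1 - ∑ q ∈ Finset.range C.Q, if C.Link q then 1 else 0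
  -- A link from `q` to `q + X` should contribute the negated variable of `q` and the variable of `q
  -- + X`; the latter is booked at step `q + X`. A step at which one link ends and another starts
  -- would thus receive a variable and its negation, which together amount to one, so it gets the
  -- true literal `2 * Z`.
  z q := if C.Link q then (if C.Prev q then 2 * C.Z else 2 * (q * C.W))
    else if C.Prev q then 2 * (q * C.W) + 1 else 2 * C.Z + 1
  c1 q r := if C.Link q then pick r (2 * (q * C.W)) (2 * ((q + C.X) * C.W) + 1) (2 * C.Z + 1)
    else 2 * C.Z
  -- A clause is imposed at a step with element `0`, where the copy of the variable `y` in the same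
  -- visit belongs to step `q + y`.
  c2 q r := if C.Whole q then
      (if r < C.len (C.item q) then
        2 * ((q + C.entry (C.item q) r / 2) * C.W) + C.entry (C.item q) r % 2
      else 2 * C.Z + 1)
    else 2 * C.Z

structure Valid : Prop where
  convex : C.Convex
  len_le : ∀ j < C.m, C.len j ≤ 3
  entry_lt : ∀ j < C.m, ∀ r < C.len j, C.entry j r / 2 < C.n
  -- The dummy bag `t` is admitted because an empty clause may occur when there are no bags at all.
  clause : ∀ j < C.m, ∃ i ≤ C.t, ∀ r < C.len j, C.B i (C.entry j r / 2)

variable {C}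

theorem W_pos : 0 < C.W := Nat.succ_pos _

theorem Q_pos : 0 < C.Q := by rw [Sweep.Q, Sweep.X]; positivity

-- Regroups the counted literals by links: a contribution booked at the end of a link is moved to
-- its start.
open Classical in
theorem card_z {α : ℕ → Bool} (hZ : α C.Z = false) :
    ((Finset.range C.Q).filter (fun q => LitTrue α (C.counter.z q))).card =
      ∑ q ∈ (Finset.range C.Q).filter C.Link,
        ((if α (q * C.W) = true then 0 else 1) +
          if α ((q + C.X) * C.W) = true then 1 else 0) := by
  have h1 : ((Finset.range C.Q).filter (fun q => LitTrue α (C.counter.z q))).card =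
      ∑ q ∈ Finset.range C.Q, ((if C.Link q then (if α (q * C.W) = true then 0 else 1) else 0) +
        if C.Prev q then (if α (q * C.W) = true then 1 else 0) else 0) := by
    rw [Finset.card_filter]
    refine Finset.sum_congr rfl fun q _ => ?_
    simp only [counter]
    by_cases hl : C.Link q <;> by_cases hp : C.Prev q <;> cases h : α (q * C.W) <;>
      simp [hl, hp, litTrue_pos, litTrue_neg, hZ, h]
  have h2 : ∑ q ∈ Finset.range C.Q, (if C.Prev q then (if α (q * C.W) = true then 1 else 0) else 0) =
      ∑ q ∈ (Finset.range C.Q).filter C.Link, if α ((q + C.X) * C.W) = true then 1 else 0 := by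
    rw [← Finset.sum_filter]
    symm
    refine Finset.sum_bij (fun q _ => q + C.X) ?_ ?_ ?_ (fun _ _ => rfl)
    · intro q hq
      rw [Finset.mem_filter] at hq
      rw [Finset.mem_filter, Finset.mem_range]
      exact ⟨Sweep.Link.lt _ hq.2, Nat.le_add_left _ _, by rw [Nat.add_sub_cancel]; exact hq.2⟩
    · intro a _ b _ h
      exact Nat.add_right_cancel h
    · intro q hq
      rw [Finset.mem_filter, Finset.mem_range] at hq
      exact ⟨q - C.X, Finset.mem_filter.2 ⟨Finset.mem_range.2 (by omega), hq.2.2⟩,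
        Nat.sub_add_cancel hq.2.1⟩
  rw [h1, Finset.sum_add_distrib, h2, ← Finset.sum_filter, ← Finset.sum_add_distrib]

open Classical in
theorem sum_links_le : ∑ q ∈ Finset.range C.Q, (if C.Link q then 1 else 0) < 2 ^ C.L := by
  refine lt_of_le_of_lt ?_ (Nat.lt_size_self C.Q)
  rw [← Finset.card_filter]
  exact (Finset.card_filter_le _ _).trans (Finset.card_range _).le

theorem elt_add_of_whole {q y : ℕ} (he : C.elt q = 0) (hy : y < C.n) :
    C.elt (q + y) = y ∧ C.bag (q + y) = C.bag q := by
  have h := C.pos_eq q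
  rw [he] at h
  have h1 : q + y = C.pos (C.bag q) (C.item q) y := by
    conv_lhs => rw [← h]
    simp only [Sweep.pos]; omega
  rw [h1]
  exact ⟨C.elt_pos hy.le, C.bag_pos (C.item_le q) hy.le⟩

-- The clause of a link makes its contribution at least one, and the counter bounds the sum of the
-- contributions by the number of links. So each contribution is exactly one, which means that both
-- ends of the link carry the same value. By convexity all live visits of a variable are chained by
-- links, hence its value is well defined, and it satisfies every clause at a bag containing the
-- whole clause.
open Classical in
theorem Valid.models_of_sat (hC : C.Valid) {α : ℕ → Bool} (h : C.counter.Sat α) :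
    ∃ τ, C.Models τ := by
  have hlinks := sum_links_le (C := C)
  have hcount := h.count_lt (by
    show 2 ^ C.L - 1 - _ < 2 ^ C.L
    have : 0 < 2 ^ C.L := by positivity
    omega)
  rw [Counter.sat_iff'] at h
  have hZ : α C.Z = false := (h 0 Q_pos).2.2.2.1
  have hz : ¬ LitTrue α (2 * C.Z + 1) := by rw [litTrue_pos, hZ]; simp
  have hlink : ∀ q, C.Link q → α (q * C.W) = false ∨ α ((q + C.X) * C.W) = true := by
    intro q hq
    have h1 := (h q (Sweep.Live.lt _ hq.1)).2.2.2.2.1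
    simp only [counter, if_pos hq, exists_pick] at h1
    rcases h1 with h1 | h1 | h1
    · exact Or.inl (litTrue_neg.1 h1)
    · exact Or.inr (litTrue_pos.1 h1)
    · exact (hz h1).elim
  have hterm : ∀ q ∈ (Finset.range C.Q).filter C.Link, 1 ≤
      ((if α (q * C.W) = true then 0 else 1) + if α ((q + C.X) * C.W) = true then 1 else 0) := by
    intro q hq
    rcases hlink q (Finset.mem_filter.1 hq).2 with h1 | h1 <;> simp [h1]
  have hsum : ∑ q ∈ (Finset.range C.Q).filter C.Link, 1 = ∑ q ∈ (Finset.range C.Q).filter C.Link,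
      ((if α (q * C.W) = true then 0 else 1) + if α ((q + C.X) * C.W) = true then 1 else 0) := by
    refine le_antisymm (Finset.sum_le_sum hterm) ?_
    rw [← card_z hZ, Finset.sum_filter]
    simp only [show C.counter.Q = C.Q from rfl, show C.counter.L = C.L from rfl,
      show C.counter.init = 2 ^ C.L - 1 - ∑ q ∈ Finset.range C.Q, (if C.Link q then 1 else 0)
        from rfl] at hcount
    omega
  have heq := (Finset.sum_eq_sum_iff_of_le hterm).1 hsum
  have ho : ∀ q, C.Link q → (α (q * C.W) = true ↔ α ((q + C.X) * C.W) = true) := by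
    intro q hq
    have h1 := heq q (Finset.mem_filter.2 ⟨Finset.mem_range.2 (Sweep.Live.lt _ hq.1), hq⟩)
    by_cases ha : α (q * C.W) = true <;> by_cases hb : α ((q + C.X) * C.W) = true <;>
      simp [ha, hb] at h1 ⊢
  let τ : ℕ → Prop := fun y => ∃ q, C.Live q ∧ C.elt q = y ∧ α (q * C.W) = true
  have hτ : ∀ q, C.Live q → (τ (C.elt q) ↔ α (q * C.W) = true) := by
    intro q hq
    constructor
    · rintro ⟨q', hq', he, ha⟩
      rcases le_total q' q with hle | hle
      · exact (hC.convex.iff_of_link (o := fun q => α (q * C.W) = true) ho hle he hq' hq).1 ha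
      · exact (hC.convex.iff_of_link (o := fun q => α (q * C.W) = true) ho hle he.symm hq hq').2 ha
    · exact fun ha => ⟨q, hq, rfl, ha⟩
  refine ⟨τ, fun j hj => ?_⟩
  obtain ⟨i, hi, hB⟩ := hC.clause j hj
  have e1 := C.bag_pos (i := i) hj.le (Nat.zero_le C.n)
  have e2 := C.item_pos (i := i) hj.le (Nat.zero_le C.n)
  have e3 := C.elt_pos (i := i) (j := j) (Nat.zero_le C.n)
  have hq := C.pos_lt hi hj.le (Nat.zero_le C.n)
  set q := C.pos i j 0
  have hw : C.Whole q := ⟨by rwa [e2], e3, by rwa [e1, e2]⟩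
  obtain ⟨r, -, h1⟩ := (h q hq).2.2.2.2.2
  simp only [counter, if_pos hw, e2] at h1
  split_ifs at h1 with hr
  · refine ⟨r, hr, ?_⟩
    have hy := hC.entry_lt j hj r hr
    obtain ⟨e4, e5⟩ := elt_add_of_whole e3 hy
    have hl : C.Live (q + C.entry j r / 2) := ⟨by rw [e4]; exact hy, by
      rw [e4, e5, e1]; exact hB r hr⟩
    rw [← e4, hτ _ hl]
    rcases Nat.mod_two_eq_zero_or_one (C.entry j r) with hb | hb
    · rw [hb, add_zero, litTrue_neg] at h1
      simp [h1, hb]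
    · rw [hb, litTrue_pos] at h1
      simp [h1, hb]
  · exact (hz h1).elim

theorem free_mul (q : ℕ) : C.counter.Free (q * C.W) := fun h => h.2 (Nat.mul_mod_left _ _)

theorem free_Z : C.counter.Free C.Z := free_mul C.Q

-- When all copies of a variable agree, every link contributes exactly one, and the counter ends at
-- `2 ^ L - 1`, the largest value allowed.
open Classical in
theorem Valid.sat_of_models (hC : C.Valid) {τ : ℕ → Prop} (h : C.Models τ) :
    ∃ α, C.counter.Sat α := by
  let α₀ : ℕ → Bool := fun v => decide (v < C.Q * C.W ∧ τ (C.elt (v / C.W)))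
  have hα : ∀ q < C.Q, (α₀ (q * C.W) = true ↔ τ (C.elt q)) := by
    intro q hq
    have h1 : q * C.W < C.Q * C.W := Nat.mul_lt_mul_of_pos_right hq W_pos
    simp only [α₀, Nat.mul_div_cancel _ W_pos, decide_eq_true_eq, h1, true_and]
  have hZ : α₀ C.Z = false := by simp [α₀, Z]
  have hdiv : ∀ v, (2 * v + 1) / 2 = v := fun v => by omega
  have hdiv' : ∀ v, 2 * v / 2 = v := fun v => by omega
  have htrue : ∃ r < 3, C.counter.Free (2 * C.Z / 2) ∧ LitTrue α₀ (2 * C.Z) :=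
    ⟨0, by omega, by rw [hdiv']; exact free_Z, litTrue_neg.2 hZ⟩
  refine C.counter.exists_sat (α₀ := α₀) le_rfl hZ ?_ ?_ ?_ ?_
  · intro q _
    simp only [counter]
    split_ifs <;> simp only [hdiv, hdiv'] <;> first | exact free_Z | exact free_mul _
  · intro q hq
    by_cases hl : C.Link q
    swap
    · simpa only [counter, if_neg hl] using htrue
    have hp := exists_pick (P := fun l => C.counter.Free (l / 2) ∧ LitTrue α₀ l)
      (a := 2 * (q * C.W)) (b := 2 * ((q + C.X) * C.W) + 1) (c := 2 * C.Z + 1)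
    simp only [counter, if_pos hl]
    refine hp.2 ?_
    have h2 := hα _ (Sweep.Link.lt _ hl)
    rw [C.elt_add] at h2
    by_cases h1 : τ (C.elt q)
    · right; left
      rw [hdiv, litTrue_pos]
      exact ⟨free_mul _, h2.2 h1⟩
    · left
      rw [hdiv', litTrue_neg, ← Bool.not_eq_true, hα q hq]
      exact ⟨free_mul _, h1⟩
  · intro q hq
    by_cases hw : C.Whole q
    swap
    · simpa only [counter, if_neg hw] using htrue
    obtain ⟨r, hr, h1⟩ := h _ hw.1
    have hy := hC.entry_lt _ hw.1 r hr
    obtain ⟨e4, e5⟩ := elt_add_of_whole hw.2.1 hy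
    have hlive : C.Live (q + C.entry (C.item q) r / 2) := ⟨by rw [e4]; exact hy, by
      rw [e4, e5]; exact hw.2.2 r hr⟩
    have h2 := hα _ (Sweep.Live.lt _ hlive)
    rw [e4] at h2
    refine ⟨r, lt_of_lt_of_le hr (hC.len_le _ hw.1), ?_⟩
    simp only [counter, if_pos hw, if_pos hr]
    rcases Nat.mod_two_eq_zero_or_one (C.entry (C.item q) r) with hb | hb
    · rw [hb, add_zero, hdiv', litTrue_neg, ← Bool.not_eq_true, h2, h1, hb]
      exact ⟨free_mul _, by simp⟩
    · rw [hb, hdiv, litTrue_pos, h2, h1, hb]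
      exact ⟨free_mul _, rfl⟩
  · have hlinks := sum_links_le (C := C)
    have hsum : ((Finset.range C.Q).filter (fun q => LitTrue α₀ (C.counter.z q))).card =
        ∑ q ∈ Finset.range C.Q, if C.Link q then 1 else 0 := by
      rw [card_z hZ, ← Finset.sum_filter]
      refine Finset.sum_congr rfl fun q hq => ?_
      have hl := (Finset.mem_filter.1 hq).2
      have h2 := hα _ (Sweep.Link.lt _ hl)
      rw [C.elt_add, ← hα q (Sweep.Live.lt _ hl.1)] at h2
      by_cases h1 : α₀ (q * C.W) = true
      · simp [h1, h2.2 h1]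
      · have h3 : α₀ ((q + C.X) * C.W) = false := Bool.eq_false_iff.2 fun h => h1 (h2.1 h)
        simp [h1, h3]
    simp only [show C.counter.Q = C.Q from rfl, show C.counter.L = C.L from rfl,
      show C.counter.init = 2 ^ C.L - 1 - ∑ q ∈ Finset.range C.Q, (if C.Link q then 1 else 0)
        from rfl]
    rw [hsum]
    omega

theorem Valid.exists_sat_iff (hC : C.Valid) : (∃ α, C.counter.Sat α) ↔ ∃ τ, C.Models τ :=
  ⟨fun ⟨_, h⟩ => hC.models_of_sat h, fun ⟨_, h⟩ => hC.sat_of_models h⟩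

end ClauseSweep

/-! ## The set system of a formula -/

/-- The elements are the variables and after them the clauses, and the sets are the literals. -/
def FormulaInc (V : ℕ) (lit : ℕ → ℕ → ℕ) (u s : ℕ) : Prop :=
  (u < V ∧ s / 2 = u) ∨ (V ≤ u ∧ ∃ r < 3, lit (u - V) r = s)

/-- A cover with `V` sets contains exactly one of the literals of every variable. -/
theorem exists_assignment_iff {V P : ℕ} {lit : ℕ → ℕ → ℕ} (hlit : ∀ p < P, ∀ r < 3, lit p r < 2 * V) :
    (∃ T : Finset ℕ, (∀ s ∈ T, s < 2 * V) ∧ (∀ u < V + P, ∃ s ∈ T, FormulaInc V lit u s) ∧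
      T.card ≤ V) ↔ ∃ α : ℕ → Bool, ∀ p < P, ∃ r < 3, LitTrue α (lit p r) := by
  constructor
  · rintro ⟨T, hT, hcov, hcard⟩
    have hvar : ∀ v < V, ∃ s ∈ T, s / 2 = v := by
      intro v hv
      obtain ⟨s, hs, h | h⟩ := hcov v (by omega)
      · exact ⟨s, hs, h.2⟩
      · omega
    have hinj : Set.InjOn (· / 2) (T : Set ℕ) := by
      refine Finset.injOn_of_surjOn_of_card_le (t := Finset.range V) _ ?_ ?_ (by simpa using hcard)
      · intro s hs
        have := hT s hs
        simp only [Finset.coe_range, Set.mem_Iio]; omega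
      · intro v hv
        obtain ⟨s, hs, h⟩ := hvar v (by simpa using hv)
        exact ⟨s, hs, h⟩
    refine ⟨fun v => decide (2 * v + 1 ∈ T), fun p hp => ?_⟩
    obtain ⟨s, hs, h | ⟨h, r, hr, rfl⟩⟩ := hcov (V + p) (by omega)
    · omega
    · rw [Nat.add_sub_cancel_left] at hs
      refine ⟨r, hr, ?_⟩
      simp only [LitTrue, decide_eq_true_eq]
      set s := lit p r
      rcases Nat.mod_two_eq_zero_or_one s with hb | hb
      · simp only [hb, zero_ne_one, iff_false]
        intro h2
        have := hinj hs h2 (show s / 2 = (2 * (s / 2) + 1) / 2 by omega)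
        omega
      · rw [show 2 * (s / 2) + 1 = s by omega]
        simp [hs, hb]
  · rintro ⟨α, h⟩
    have hlt : ∀ s, LitTrue α s ↔ s = 2 * (s / 2) + (α (s / 2)).toNat := by
      intro s
      unfold LitTrue
      cases α (s / 2) <;> simp <;> omega
    refine ⟨(Finset.range V).image (fun v => 2 * v + (α v).toNat), fun s hs => ?_, fun u hu => ?_,
      Finset.card_image_le.trans (Finset.card_range V).le⟩
    · obtain ⟨v, hv, rfl⟩ := Finset.mem_image.1 hs
      have := Finset.mem_range.1 hv
      have := Bool.toNat_le (α v)
      omega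
    · rcases lt_or_ge u V with hu' | hu'
      · refine ⟨_, Finset.mem_image_of_mem _ (Finset.mem_range.2 hu'), Or.inl ⟨hu', ?_⟩⟩
        have := Bool.toNat_le (α u)
        omega
      · obtain ⟨r, hr, h⟩ := h (u - V) (by omega)
        have := hlit (u - V) (by omega) r hr
        refine ⟨lit (u - V) r, Finset.mem_image.2 ⟨lit (u - V) r / 2, Finset.mem_range.2 (by omega),
          ((hlt _).1 h).symm⟩, Or.inr ⟨hu', r, hr, rfl⟩⟩

/-! ### The path decomposition of the set system -/

namespace ClauseSweep

variable (C : ClauseSweep)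

/-- The variable `x` is present at time `q`. -/
def VarAlive (q x : ℕ) : Prop := (x < C.Z ∧ x / C.W ≤ q ∧ q ≤ x / C.W + 1) ∨ x = C.Z

/-- The clause `s` of step `b` refers to later steps. -/
def Long (b s : ℕ) : Prop :=
  -- These are the implication along a link, which refers to step `b + X`, and a clause of the given
  -- formula, which refers to the copies in the visit starting at `b`. All other clauses are content
  -- with the current and the preceding block.
  (s = 3 * C.L + 3 ∧ C.Link b) ∨ (s = 3 * C.L + 4 ∧ C.elt b = 0)

/-- The clause `p` is present at time `q`. -/
def ClauseAlive (q p : ℕ) : Prop :=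
  p / (3 * C.L + 5) ≤ q ∧ (q ≤ p / (3 * C.L + 5) ∨
    (C.Long (p / (3 * C.L + 5)) (p % (3 * C.L + 5)) ∧ q ≤ p / (3 * C.L + 5) + C.X))

def numVars : ℕ := C.Z + 1
def numClauses : ℕ := C.Q * (3 * C.L + 5)
def numElements : ℕ := C.numVars + C.numClauses

/-- The vertex `v` lies in the `q`-th bag; the vertices are the variables, the clauses, and the
literals. -/
def Alive (q v : ℕ) : Prop :=
  (v < C.numVars ∧ C.VarAlive q v) ∨
  (C.numVars ≤ v ∧ v < C.numElements ∧ C.ClauseAlive q (v - C.numVars)) ∨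
  (C.numElements ≤ v ∧ C.VarAlive q ((v - C.numElements) / 2))

variable {C}

theorem varAlive_block {q b r : ℕ} (hb : b < C.Q) (hr : r < C.W) (h1 : b ≤ q) (h2 : q ≤ b + 1) :
    C.VarAlive q (b * C.W + r) := by
  have h3 : (b * C.W + r) / C.W = b := by
    rw [mul_comm, Nat.mul_add_div W_pos, Nat.div_eq_of_lt hr, add_zero]
  refine Or.inl ⟨?_, by rw [h3]; exact h1, by rw [h3]; exact h2⟩
  calc b * C.W + r < b * C.W + C.W := by omega
    _ = (b + 1) * C.W := by ring
    _ ≤ _ := Nat.mul_le_mul_right _ hb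

theorem varAlive_Z {q : ℕ} : C.VarAlive q C.Z := Or.inr rfl

theorem VarAlive.lt {q x : ℕ} (h : C.VarAlive q x) : x < C.numVars := by
  have : C.numVars = C.Z + 1 := rfl
  rcases h with h | h <;> omega

/-- An incidence graph only asks for a common bag of the clause and each of its literals separately.
So the copies need not wait for each other: the clause alone, a single vertex, waits for the later
ones. This is what keeps the cost of a link at one vertex. -/
theorem Valid.exists_alive_lit (hC : C.Valid) {p : ℕ} (hp : p < C.numClauses) (r : ℕ) :
    ∃ q < C.Q, C.ClauseAlive q p ∧ C.VarAlive q (C.counter.lit p r / 2) := by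
  have hP : 0 < 3 * C.L + 5 := Nat.succ_pos _
  have hb : p / (3 * C.L + 5) < C.Q := (Nat.div_lt_iff_lt_mul hP).2 hp
  have hnum : C.counter.numClauses = 3 * C.L + 5 := rfl
  rw [Counter.lit, hnum]
  have hdiv : ∀ v, (2 * v + 1) / 2 = v := fun v => by omega
  have hdiv' : ∀ v, 2 * v / 2 = v := fun v => by omega
  have hs : p % (3 * C.L + 5) < 3 * C.L + 5 := Nat.mod_lt _ hP
  have hself : ∀ x, C.VarAlive (p / (3 * C.L + 5)) x → ∃ q < C.Q, C.ClauseAlive q p ∧ C.VarAlive q x :=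
    fun x hx => ⟨_, hb, ⟨le_rfl, Or.inl le_rfl⟩, hx⟩
  have hZ := hself _ varAlive_Z
  have hlong : ∀ q' < C.Q, p / (3 * C.L + 5) ≤ q' → q' ≤ p / (3 * C.L + 5) + C.X →
      C.Long (p / (3 * C.L + 5)) (p % (3 * C.L + 5)) →
      ∃ q < C.Q, C.ClauseAlive q p ∧ C.VarAlive q (q' * C.W) := fun q' h1 h2 h3 h4 =>
    ⟨q', h1, ⟨h2, Or.inr ⟨h4, h3⟩⟩, varAlive_block (r := 0) h1 W_pos le_rfl (by omega)⟩
  have hblock := hself _ (varAlive_block (r := 0) hb W_pos le_rfl (by omega))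
  unfold ClauseAlive at hself hlong
  generalize hbe : p / (3 * C.L + 5) = b at *
  generalize hse : p % (3 * C.L + 5) = s at *
  refine C.counter.clauseLit_induction (A := fun x => ∃ q < C.Q, C.ClauseAlive q p ∧ C.VarAlive q x)
    (fun b' w h1 h2 hw => ?_) hZ ?_ (fun h => ?_) (fun h => ?_)
  · have := hself _ (varAlive_block (show b' < C.Q by omega) hw h1 h2)
    simp only [ClauseAlive, hbe, hse]
    exact this
  · simp only [counter]
    split_ifs <;> simp only [hdiv, hdiv'] <;> first | exact hZ | exact hblock
  · simp only [counter]
    by_cases hl : C.Link b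
    swap
    · rw [if_neg hl, hdiv']; exact hZ
    rw [if_pos hl]
    refine pick_induction (P := fun l => ∃ q < C.Q, C.ClauseAlive q p ∧ C.VarAlive q (l / 2)) ?_ ?_ ?_
    · rw [hdiv']; exact hblock
    · rw [hdiv]
      have := hlong (b + C.X) (Sweep.Link.lt _ hl) (by omega) le_rfl (Or.inl ⟨h, hl⟩)
      simpa only [ClauseAlive, hbe, hse] using this
    · rw [hdiv]; exact hZ
  · simp only [counter]
    by_cases hw : C.Whole b
    swap
    · rw [if_neg hw, hdiv']; exact hZ
    rw [if_pos hw]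
    by_cases hr : r < C.len (C.item b)
    swap
    · rw [if_neg hr, hdiv]; exact hZ
    have hy := hC.entry_lt _ hw.1 r hr
    obtain ⟨e4, e5⟩ := elt_add_of_whole hw.2.1 hy
    have hlive : C.Live (b + C.entry (C.item b) r / 2) := ⟨by rw [e4]; exact hy, by
      rw [e4, e5]; exact hw.2.2 r hr⟩
    have hX : C.X = C.n + 1 := rfl
    have hL : C.counter.L = C.L := rfl
    have := hlong _ (Sweep.Live.lt _ hlive) (by omega) (by omega) (Or.inr ⟨by omega, hw.2.1⟩)
    rw [if_pos hr, show ∀ a c, (2 * a + c % 2) / 2 = a by intro a c; omega]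
    simpa only [ClauseAlive, hbe, hse] using this

noncomputable def Valid.coverData (hC : C.Valid) : CoverData where
  E := C.numElements
  S := 2 * C.numVars
  N := C.Q
  inc := FormulaInc C.numVars C.counter.lit
  alive := C.Alive
  convex v a b c hab hbc ha hc := by
    have hvar : ∀ x, C.VarAlive a x → C.VarAlive c x → C.VarAlive b x := by
      rintro x (h1 | h1) (h2 | h2)
      · exact Or.inl ⟨h1.1, by omega, by omega⟩
      all_goals exact Or.inr (by assumption)
    have hE : C.numVars ≤ C.numElements := Nat.le_add_right _ _
    rcases ha with ha | ha | ha
    · rcases hc with hc | hc | hc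
      · exact Or.inl ⟨ha.1, hvar _ ha.2 hc.2⟩
      · omega
      · omega
    · rcases hc with hc | hc | hc
      · omega
      · refine Or.inr (Or.inl ⟨ha.1, ha.2.1, ha.2.2.1.trans hab, ?_⟩)
        rcases hc.2.2.2 with h | h
        · exact Or.inl (hbc.trans h)
        · exact Or.inr ⟨h.1, hbc.trans h.2⟩
      · omega
    · rcases hc with hc | hc | hc
      · omega
      · omega
      · exact Or.inr (Or.inr ⟨ha.1, hvar _ ha.2 hc.2⟩)
  vertex v hv := by
    have hvar : ∀ x < C.numVars, ∃ q < C.Q, C.VarAlive q x := by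
      intro x hx
      rcases Nat.lt_succ_iff_lt_or_eq.1 hx with h | rfl
      · exact ⟨x / C.W, (Nat.div_lt_iff_lt_mul W_pos).2 h, Or.inl ⟨h, le_rfl, Nat.le_succ _⟩⟩
      · exact ⟨0, Q_pos, varAlive_Z⟩
    rcases lt_or_ge v C.numVars with h1 | h1
    · obtain ⟨q, hq, h⟩ := hvar v h1
      exact ⟨q, hq, Or.inl ⟨h1, h⟩⟩
    rcases lt_or_ge v C.numElements with h2 | h2
    · have hp : v - C.numVars < C.numClauses := by
        have : C.numElements = C.numVars + C.numClauses := rfl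
        omega
      exact ⟨_, (Nat.div_lt_iff_lt_mul (Nat.succ_pos _)).2 hp,
        Or.inr (Or.inl ⟨h1, h2, le_rfl, Or.inl le_rfl⟩)⟩
    · obtain ⟨q, hq, h⟩ := hvar ((v - C.numElements) / 2) (by omega)
      exact ⟨q, hq, Or.inr (Or.inr ⟨h2, h⟩)⟩
  edge u hu s hs h := by
    have hE : C.numElements = C.numVars + C.numClauses := rfl
    have hset : ∀ q, C.VarAlive q (s / 2) → C.Alive q (C.numElements + s) := fun q h =>
      Or.inr (Or.inr ⟨Nat.le_add_right _ _, by rwa [Nat.add_sub_cancel_left]⟩)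
    rcases h with ⟨h1, rfl⟩ | ⟨h1, r, hr, rfl⟩
    · rcases Nat.lt_succ_iff_lt_or_eq.1 h1 with h | h
      · have h2 : C.VarAlive (s / 2 / C.W) (s / 2) := Or.inl ⟨h, le_rfl, Nat.le_succ _⟩
        exact ⟨_, (Nat.div_lt_iff_lt_mul W_pos).2 h, Or.inl ⟨h1, h2⟩, hset _ h2⟩
      · have h2 : C.VarAlive 0 (s / 2) := Or.inr h
        exact ⟨0, Q_pos, Or.inl ⟨h1, h2⟩, hset _ h2⟩
    · obtain ⟨q, hq, h2, h3⟩ := hC.exists_alive_lit (p := u - C.numVars) (by omega) r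
      exact ⟨q, hq, Or.inr (Or.inl ⟨h1, hu, h2⟩), hset _ h3⟩
  new q hq := by
    have h := varAlive_block (r := 0) hq (W_pos (C := C)) le_rfl (Nat.le_succ _)
    have hE : C.numElements = C.numVars + C.numClauses := rfl
    have hlt := h.lt
    have h1 := Nat.mul_lt_mul_of_pos_right hq (W_pos (C := C))
    have h2 := Nat.mul_div_cancel (q + 1) (W_pos (C := C))
    have h3 : C.Z = C.Q * C.W := rfl
    refine ⟨_, by omega, Or.inl ⟨hlt, h⟩, ?_⟩
    rintro (⟨-, h | h⟩ | h | h)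
    · rw [add_zero, h2] at h; omega
    · omega
    · omega
    · omega

theorem Valid.lit_lt (hC : C.Valid) {p : ℕ} (hp : p < C.numClauses) (r : ℕ) :
    C.counter.lit p r < 2 * C.numVars := by
  obtain ⟨q, -, -, h⟩ := hC.exists_alive_lit hp r
  have := h.lt
  omega

theorem Valid.exists_cover_iff (hC : C.Valid) :
    (∃ T, hC.coverData.toInstance.IsCover T ∧ T.card ≤ C.numVars) ↔ ∃ τ, C.Models τ := by
  have hsets : hC.coverData.toInstance.numSets = 2 * C.numVars := hC.coverData.length_sets
  have hmem : ∀ (u : Fin hC.coverData.toInstance.numElements)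
      (j : Fin hC.coverData.toInstance.numSets), u ∈ hC.coverData.toInstance.sets.get j ↔
      FormulaInc C.numVars C.counter.lit u.val j.val := fun u j => hC.coverData.mem_sets_get u j
  rw [← hC.exists_sat_iff]
  refine Iff.trans ?_ (exists_assignment_iff (P := C.numClauses) fun p hp r _ => hC.lit_lt hp r)
  constructor
  · rintro ⟨T, hT, hc⟩
    refine ⟨T.map Fin.valEmbedding, fun s hs => ?_, fun u hu => ?_, (Finset.card_map _).trans_le hc⟩
    · obtain ⟨j, -, rfl⟩ := Finset.mem_map.1 hs
      exact hsets ▸ j.2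
    · obtain ⟨j, hj, h⟩ := hT ⟨u, hu⟩
      exact ⟨j.val, Finset.mem_map_of_mem Fin.valEmbedding hj, (hmem _ _).1 h⟩
  · rintro ⟨T, h1, h2, h3⟩
    have hlt : ∀ s ∈ T, s < hC.coverData.toInstance.numSets := fun s hs => by
      rw [hsets]; exact h1 s hs
    refine ⟨T.attachFin hlt, fun u => ?_, (Finset.card_attachFin T hlt).trans_le h3⟩
    obtain ⟨s, hs, h⟩ := h2 u.val u.2
    exact ⟨⟨s, hlt s hs⟩, Finset.mem_attachFin hlt |>.2 hs, (hmem _ _).2 h⟩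

open Classical in
theorem card_varAlive_le (q N : ℕ) :
    ((Finset.range N).filter (C.VarAlive q)).card ≤ 2 * C.W + 1 := by
  have hW := W_pos (C := C)
  have hsub : (Finset.range N).filter (C.VarAlive q) ⊆
      Finset.Ico ((q - 1) * C.W) ((q + 1) * C.W) ∪ {C.Z} := by
    intro v hv
    rw [Finset.mem_union, Finset.mem_Ico, Finset.mem_singleton]
    rcases (Finset.mem_filter.1 hv).2 with ⟨h1, h2, h3⟩ | h
    · left
      refine ⟨?_, (Nat.div_lt_iff_lt_mul hW).1 (Nat.lt_succ_of_le h2)⟩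
      exact (Nat.mul_le_mul_right _ (Nat.sub_le_of_le_add h3)).trans (Nat.div_mul_le_self _ _)
    · exact Or.inr h
  have h2 : (q + 1) * C.W - (q - 1) * C.W ≤ 2 * C.W := by
    rw [← Nat.sub_mul]; exact Nat.mul_le_mul_right _ (by omega)
  have h3 := (Finset.card_le_card hsub).trans (Finset.card_union_le _ _)
  rw [Nat.card_Ico, Finset.card_singleton] at h3
  omega

-- The clauses present are those of step `q`, one for each open link, and clauses of the given
-- formula imposed at most `X` steps earlier. The latter belong to steps that are multiples of `X`,
-- and at most two of these lie between `q - X` and `q`.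
open Classical in
theorem card_clauseAlive_le (hC : C.Convex) (q N : ℕ) :
    ((Finset.range N).filter (C.ClauseAlive q)).card ≤
      3 * C.L + 5 + (((Finset.range C.n).filter (C.B (C.bag q))).card + 1) + 2 := by
  have hP : 0 < 3 * C.L + 5 := Nat.succ_pos _
  have hX : 0 < C.X := C.X_pos
  have hsub : (Finset.range N).filter (C.ClauseAlive q) ⊆
      (Finset.Ico (q * (3 * C.L + 5)) ((q + 1) * (3 * C.L + 5)) ∪
      ((Finset.range C.Q).filter (fun q' => C.Link q' ∧ q' ≤ q ∧ q ≤ q' + C.X)).image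
        (fun b => b * (3 * C.L + 5) + (3 * C.L + 3))) ∪
      ({(q - C.elt q) * (3 * C.L + 5) + (3 * C.L + 4),
        (q - C.elt q - C.X) * (3 * C.L + 5) + (3 * C.L + 4)} : Finset ℕ) := by
    intro p hp
    have hdm : p / (3 * C.L + 5) * (3 * C.L + 5) + p % (3 * C.L + 5) = p := Nat.div_add_mod' _ _
    rw [Finset.mem_union, Finset.mem_union, Finset.mem_Ico, Finset.mem_image, Finset.mem_insert,
      Finset.mem_singleton]
    obtain ⟨h1, h2 | ⟨h2 | h2, h3⟩⟩ := (Finset.mem_filter.1 hp).2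
    · left; left
      exact ⟨(Nat.mul_le_mul_right _ h2).trans (Nat.div_mul_le_self _ _),
        (Nat.div_lt_iff_lt_mul hP).1 (Nat.lt_succ_of_le h1)⟩
    · left; right
      refine ⟨p / (3 * C.L + 5), Finset.mem_filter.2 ⟨Finset.mem_range.2
        (Sweep.Live.lt _ h2.2.1), h2.2, h1, h3⟩, ?_⟩
      rw [← h2.1]; exact hdm
    · right
      generalize p / (3 * C.L + 5) = b at *
      rw [h2.1] at hdm
      have hb : b = q - C.elt q ∨ b = q - C.elt q - C.X := by
        have e1 := Nat.div_add_mod q C.X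
        have e2 := Nat.div_add_mod b C.X
        have e3 : b % C.X = 0 := h2.2
        have e4 : q - C.elt q = C.X * (q / C.X) := by
          have : C.elt q = q % C.X := rfl
          omega
        rw [e4]
        rw [e3, add_zero] at e2
        have e5 : b / C.X ≤ q / C.X := Nat.div_le_div_right h1
        have e6 : q / C.X ≤ b / C.X + 1 := by
          rw [← Nat.add_div_right _ hX]; exact Nat.div_le_div_right h3
        rcases Nat.lt_or_ge (b / C.X) (q / C.X) with h | h
        · right
          rw [show q / C.X = b / C.X + 1 by omega, Nat.mul_succ, e2]
          omega
        · left
          rw [show q / C.X = b / C.X by omega, e2]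
      rcases hb with hb | hb
      · left; rw [← hb]; exact hdm.symm
      · right; rw [← hb]; exact hdm.symm
  have h1 := hC.card_links_le q
  refine (Finset.card_le_card hsub).trans ((Finset.card_union_le _ _).trans
    (add_le_add ((Finset.card_union_le _ _).trans (add_le_add ?_ ?_)) Finset.card_le_two))
  · rw [Nat.card_Ico, ← Nat.sub_mul]; simp
  · exact Finset.card_image_le.trans h1

-- A variable brings three vertices, itself and its two literals, but only two blocks and `Z` are
-- present, which makes `3 * (2 * W + 1)`. The only part growing with `K` consists of the link
-- clauses, one vertex for each. With the bound for clauses the total is `K + 15 * L + 24`.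
open Classical in
theorem Valid.width_le (hC : C.Valid) {K : ℕ}
    (hK : ∀ i, ((Finset.range C.n).filter (C.B i)).card ≤ K + 1) :
    hC.coverData.toInstance.decomp.width ≤ K + (15 * C.L + 23) := by
  refine hC.coverData.width_le fun q hq => ?_
  have hsub : (Finset.range (hC.coverData.E + hC.coverData.S)).filter (hC.coverData.alive q) ⊆
      ((Finset.range C.numVars).filter (C.VarAlive q) ∪
      ((Finset.range C.numClauses).filter (C.ClauseAlive q)).image (C.numVars + ·)) ∪
      (((Finset.range C.numVars).filter (C.VarAlive q)).image (C.numElements + 2 * ·) ∪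
        ((Finset.range C.numVars).filter (C.VarAlive q)).image (C.numElements + 2 * · + 1)) := by
    intro v hv
    have hE : C.numElements = C.numVars + C.numClauses := rfl
    simp only [Finset.mem_union, Finset.mem_image, Finset.mem_filter, Finset.mem_range]
    rw [Finset.mem_filter, Finset.mem_range] at hv
    rcases hv.2 with h | h | h
    · exact Or.inl (Or.inl h)
    · exact Or.inl (Or.inr ⟨v - C.numVars, ⟨by omega, h.2.2⟩, by omega⟩)
    · right
      rcases Nat.mod_two_eq_zero_or_one (v - C.numElements) with hb | hb
      · exact Or.inl ⟨_, ⟨h.2.lt, h.2⟩, by omega⟩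
      · exact Or.inr ⟨_, ⟨h.2.lt, h.2⟩, by omega⟩
  have h1 := card_varAlive_le (C := C) q C.numVars
  have h2 := card_clauseAlive_le hC.convex q C.numClauses
  have h3 := hK (C.bag q)
  have hW : C.W = 2 * C.L + 2 := rfl
  have h4 := Finset.card_le_card hsub
  have h5 := h4.trans ((Finset.card_union_le _ _).trans (add_le_add ((Finset.card_union_le _ _).trans
    (add_le_add_right Finset.card_image_le _)) ((Finset.card_union_le _ _).trans
    (add_le_add Finset.card_image_le Finset.card_image_le))))
  omega

end ClauseSweep

/-! ## From the decision version of Set Cover to 3-SAT -/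

/-- Finitely many intervals that intersect pairwise have a common point. -/
theorem exists_common_of_pairwise {B : ℕ → ℕ → Prop} {s : Finset ℕ} (hs : s.Nonempty)
    (hconv : ∀ y i j k, i ≤ j → j ≤ k → B i y → B k y → B j y)
    (hpair : ∀ y ∈ s, ∀ y' ∈ s, ∃ i, B i y ∧ B i y') : ∃ i, ∀ y ∈ s, B i y := by
  classical
  have hex : ∀ y ∈ s, ∃ i, B i y := fun y hy => (hpair y hy y hy).imp fun _ h => h.1
  let start : ℕ → ℕ := fun y => if h : ∃ i, B i y then Nat.find h else 0
  have hstart : ∀ y ∈ s, B (start y) y := by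
    intro y hy
    simp only [start, dif_pos (hex y hy)]
    exact Nat.find_spec (hex y hy)
  have hmin : ∀ y i, B i y → start y ≤ i := by
    intro y i h
    simp only [start, dif_pos (⟨i, h⟩ : ∃ i, B i y)]
    exact Nat.find_min' _ h
  -- The latest of the left endpoints is a common point.
  obtain ⟨y₀, h0, hmax⟩ := s.exists_max_image start hs
  refine ⟨start y₀, fun y hy => ?_⟩
  obtain ⟨i, h1, h2⟩ := hpair y hy y₀ h0
  exact hconv y _ _ _ (hmax y hy) (hmin _ _ h2) (hstart y hy) h1

namespace ThreeSatInstance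

variable (I : ThreeSatInstance)

def code : Literal I.numVars → ℕ := fun l => 2 * l.1.val + l.2.toNat

theorem encodes : RAM.Encodes (RAM.word I.encode) I.numVars (I.formula.map (List.map I.code))
    (I.decomp.bags.map (List.map (fun x => x.val))) := ⟨rfl⟩

theorem code_div (l : Literal I.numVars) : I.code l / 2 = l.1.val := by
  have := Bool.toNat_lt l.2
  simp only [code]; omega

theorem code_mod (l : Literal I.numVars) : I.code l % 2 = 1 ↔ l.2 = true := by
  rcases l with ⟨x, b⟩
  cases b <;> simp [code]

/-- The sweep over the bags, with the clauses. -/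
def toClauseSweep (w : ℕ → ℕ) : ClauseSweep where
  toSweep := RAM.sweepOf w
  len j := w (RAM.listPos w 1 j)
  entry j r := w (RAM.listPos w 1 j + 1 + r)

abbrev sweep : ClauseSweep := toClauseSweep (RAM.word I.encode)

theorem sweep_m : I.sweep.m = I.formula.length := I.encodes.sweep_m.trans (List.length_map _)

theorem sweep_n : I.sweep.n = I.numVars := I.encodes.sweep_n

theorem sweep_len {j : ℕ} (hj : j < I.formula.length) : I.sweep.len j = (I.formula[j]).length := by
  have := (I.encodes.entry_fst j (by simpa using hj)).1
  rw [List.getElem_map, List.length_map] at this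
  exact this

theorem sweep_entry {j r : ℕ} (hj : j < I.formula.length) (hr : r < (I.formula[j]).length) :
    I.sweep.entry j r = I.code (I.formula[j])[r] := by
  have := (I.encodes.entry_fst j (by simpa using hj)).2 r (by simpa using hr)
  simp only [List.getElem_map] at this
  exact this

theorem valid : I.sweep.Valid where
  convex := I.encodes.sweep_convex Fin.val_injective
  len_le j hj := by
    rw [I.sweep_m] at hj
    rw [I.sweep_len hj]
    exact I.arity_le _ (List.getElem_mem hj)
  entry_lt j hj r hr := by
    rw [I.sweep_m] at hj
    rw [I.sweep_len hj] at hr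
    rw [I.sweep_entry hj hr, I.code_div, I.sweep_n]
    exact Fin.is_lt _
  clause j hj := by
    have hm := hj
    rw [I.sweep_m] at hj
    rcases Nat.eq_zero_or_pos (I.sweep.len j) with h0 | h0
    · exact ⟨0, Nat.zero_le _, fun r hr => by omega⟩
    -- The primal graph only guarantees a common bag for any two variables of the clause; the Helly
    -- property of intervals gives one for all of them.
    obtain ⟨i, hi⟩ := exists_common_of_pairwise (B := I.sweep.B)
      (s := (Finset.range (I.sweep.len j)).image (fun r => I.sweep.entry j r / 2))
      ⟨_, Finset.mem_image_of_mem _ (Finset.mem_range.2 h0)⟩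
      (I.encodes.sweep_convex Fin.val_injective) (by
        have key : ∀ r < I.sweep.len j, ∃ l ∈ I.formula[j], l.1.val = I.sweep.entry j r / 2 := by
          intro r hr
          rw [I.sweep_len hj] at hr
          exact ⟨_, List.getElem_mem hr, by rw [I.sweep_entry hj hr, I.code_div]⟩
        intro y hy y' hy'
        obtain ⟨r, hr, rfl⟩ := Finset.mem_image.1 hy
        obtain ⟨r', hr', rfl⟩ := Finset.mem_image.1 hy'
        obtain ⟨l, hl, h1⟩ := key r (Finset.mem_range.1 hr)
        obtain ⟨l', hl', h2⟩ := key r' (Finset.mem_range.1 hr')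
        rw [← h1, ← h2]
        by_cases he : l.1 = l'.1
        · obtain ⟨i, hi⟩ := I.encodes.sweep_vertex l.1
          exact ⟨i, hi, he ▸ hi⟩
        · exact I.encodes.sweep_adj ((SimpleGraph.fromRel_adj _ _ _).2 ⟨he, Or.inl
            ⟨_, List.getElem_mem hj, ⟨l, hl, rfl⟩, ⟨l', hl', rfl⟩⟩⟩))
    have hB : ∀ r < I.sweep.len j, I.sweep.B i (I.sweep.entry j r / 2) := fun r hr =>
      hi _ (Finset.mem_image_of_mem _ (Finset.mem_range.2 hr))
    exact ⟨i, (I.sweep.lt_of_mem _ _ (hB 0 h0)).le, hB⟩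

theorem exists_models_iff : (∃ τ, I.sweep.Models τ) ↔ I.formula.Satisfiable := by
  classical
  constructor
  · rintro ⟨τ, h⟩
    refine ⟨fun x => decide (τ x.val), fun c hc => ?_⟩
    obtain ⟨j, hj, rfl⟩ := List.mem_iff_getElem.1 hc
    obtain ⟨r, hr, h⟩ := h j (by rwa [I.sweep_m])
    rw [I.sweep_len hj] at hr
    rw [I.sweep_entry hj hr, I.code_div, I.code_mod] at h
    refine ⟨_, List.getElem_mem hr, ?_⟩
    rw [Bool.eq_iff_iff, decide_eq_true_eq, h]
  · rintro ⟨τ, h⟩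
    refine ⟨fun y => ∃ hy : y < I.numVars, τ ⟨y, hy⟩ = true, fun j hj => ?_⟩
    rw [I.sweep_m] at hj
    obtain ⟨l, hl, h⟩ := h _ (List.getElem_mem hj)
    obtain ⟨r, hr, rfl⟩ := List.mem_iff_getElem.1 hl
    refine ⟨r, by rwa [I.sweep_len hj], ?_⟩
    rw [I.sweep_entry hj hr, I.code_div, I.code_mod, ← h]
    exact ⟨fun ⟨_, h⟩ => h, fun h => ⟨Fin.is_lt _, h⟩⟩

/-- Distinct clauses with at most three literals give distinct maps from three places to optional
literals. This bounds the length of the formula by a polynomial in the number of variables, the only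
parameter allowed in the time bound besides the width. -/
theorem length_formula_le : I.formula.length ≤ (2 * I.numVars + 1) ^ 3 := by
  let f : Clause I.numVars → Fin 3 → Option (Literal I.numVars) := fun d i => d[i.val]?
  have h1 : (I.formula.map f).Nodup := by
    refine List.Nodup.map_on (fun c hc c' hc' h => ?_) I.formula_nodup
    refine List.ext_getElem? fun i => ?_
    by_cases hi : i < 3
    · exact congrFun h ⟨i, hi⟩
    · have e1 := I.arity_le c hc
      have e2 := I.arity_le c' hc'
      rw [List.getElem?_eq_none (by omega), List.getElem?_eq_none (by omega)]
  have h2 := h1.length_le_card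
  rw [List.length_map] at h2
  refine h2.trans (le_of_eq ?_)
  simp [mul_comm]

theorem word_le (i : ℕ) : RAM.word I.encode i ≤ (2 * I.numVars + 1) ^ 3 + 2 * I.numVars + 3 := by
  refine RAM.word_le (fun a ha => ?_) i
  have h : I.encode = I.numVars :: (encodeLists (I.formula.map (List.map I.code)) ++
    encodeLists (I.decomp.bags.map (List.map (fun x => x.val)))) := rfl
  rw [h] at ha
  simp only [List.mem_cons, List.mem_append] at ha
  rcases ha with rfl | ha | ha
  · omega
  · refine RAM.le_of_mem_encodeLists ?_ (fun l hl => ?_) a ha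
    · have := I.length_formula_le
      rw [List.length_map]; omega
    · obtain ⟨c, hc, rfl⟩ := List.mem_map.1 hl
      refine ⟨?_, fun a ha => ?_⟩
      · have := I.arity_le c hc
        rw [List.length_map]; omega
      · obtain ⟨l, -, rfl⟩ := List.mem_map.1 ha
        have := l.1.2
        have := Bool.toNat_lt l.2
        simp only [code]; omega
  · refine RAM.le_of_mem_bags (D := I.decomp) ?_ (fun v => ?_) a ha
    · rw [Fintype.card_fin]; omega
    · have := v.2; omega

end ThreeSatInstance

/-! ### Computability of the reduction from 3-SAT -/

namespace RAM

open ThreeSatInstance (toClauseSweep)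

variable {f g : Fn}

namespace PolyClauseSweep

theorem L : PolyComputable (fun w _ _ => (toClauseSweep w).L) := PolySweep.Q.size

theorem W : PolyComputable (fun w _ _ => (toClauseSweep w).W) := L.two_mul.add (.const 2)

theorem Z : PolyComputable (fun w _ _ => (toClauseSweep w).Z) := PolySweep.Q.mul W

theorem len (hf : PolyComputable f) :
    PolyComputable (fun w v e => (toClauseSweep w).len (f w v e)) :=
  .inp (.listPos (.const 1) hf)

theorem entry (hf : PolyComputable f) (hg : PolyComputable g) :
    PolyComputable (fun w v e => (toClauseSweep w).entry (f w v e) (g w v e)) :=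
  .inp ((PolyComputable.listPos (.const 1) hf).succ.add hg)

theorem whole (hf : PolyComputable f) :
    PolyDecidable (fun w v e => (toClauseSweep w).Whole (f w v e)) :=
  (PolyDecidable.lt (PolySweep.item hf) PolySweep.m).and
    ((PolyDecidable.eq (PolySweep.elt hf) (.const 0)).and
      (.forall_lt (len (PolySweep.item hf)) (PolySweep.B (PolySweep.bag hf.tail)
        ((entry (PolySweep.item hf.tail) (.var 0)).div (.const 2)))))

open Classical in
theorem counter : PolyCounter (fun w _ _ => (toClauseSweep w).counter) where
  L := L
  Q := PolySweep.Q
  Z := Z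
  init := ((PolySweep.Q.two_pow_size).sub (.const 1)).sub
    (.sum (g := fun w _ _ q => if (sweepOf w).Link q then 1 else 0) PolySweep.Q
      (.ite (PolySweep.link (.var 0)) (.const 1) (.const 0)))
  z := .ite (PolySweep.link (.var 0))
    (.ite (PolySweep.prev (.var 0)) Z.two_mul ((PolyComputable.var 0).mul W).two_mul)
    (.ite (PolySweep.prev (.var 0)) ((PolyComputable.var 0).mul W).two_mul.succ Z.two_mul.succ)
  c1 := .ite (PolySweep.link (.var 0)) (.pick (.var 1) ((PolyComputable.var 0).mul W).two_mul
    (((PolyComputable.var 0).add PolySweep.X).mul W).two_mul.succ Z.two_mul.succ) Z.two_mul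
  c2 := by
    have he := entry (PolySweep.item (.var 0)) (.var 1)
    exact .ite (whole (.var 0)) (.ite (.lt (.var 1) (len (PolySweep.item (.var 0))))
      ((((PolyComputable.var 0).add (he.div (.const 2))).mul W).two_mul.add (he.mod (.const 2)))
      Z.two_mul.succ) Z.two_mul

theorem numVars : PolyComputable (fun w _ _ => (toClauseSweep w).numVars) := Z.succ

theorem stepClauses : PolyComputable (fun w _ _ => 3 * (toClauseSweep w).L + 5) :=
  ((PolyComputable.const 3).mul L).add (.const 5)

theorem numElements : PolyComputable (fun w _ _ => (toClauseSweep w).numElements) :=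
  numVars.add (PolySweep.Q.mul stepClauses)

theorem varAlive (hf : PolyComputable f) (hg : PolyComputable g) :
    PolyDecidable (fun w v e => (toClauseSweep w).VarAlive (f w v e) (g w v e)) :=
  ((PolyDecidable.lt hg Z).and ((PolyDecidable.le (hg.div W) hf).and
    (.le hf (hg.div W).succ))).or (.eq hg Z)

theorem long (hf : PolyComputable f) (hg : PolyComputable g) :
    PolyDecidable (fun w v e => (toClauseSweep w).Long (f w v e) (g w v e)) := by
  have h3 := (PolyComputable.const 3).mul L
  exact ((PolyDecidable.eq hg (h3.add (.const 3))).and (PolySweep.link hf)).or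
    ((PolyDecidable.eq hg (h3.add (.const 4))).and (.eq (PolySweep.elt hf) (.const 0)))

theorem clauseAlive (hf : PolyComputable f) (hg : PolyComputable g) :
    PolyDecidable (fun w v e => (toClauseSweep w).ClauseAlive (f w v e) (g w v e)) := by
  have hb := hg.div stepClauses
  exact (PolyDecidable.le hb hf).and ((PolyDecidable.le hf hb).or
    ((long hb (hg.mod stepClauses)).and (.le hf (hb.add PolySweep.X))))

theorem alive (hf : PolyComputable f) (hg : PolyComputable g) :
    PolyDecidable (fun w v e => (toClauseSweep w).Alive (f w v e) (g w v e)) :=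
  ((PolyDecidable.lt hg numVars).and (varAlive hf hg)).or
    (((PolyDecidable.le numVars hg).and ((PolyDecidable.lt hg numElements).and
      (clauseAlive hf (hg.sub numVars)))).or
    ((PolyDecidable.le numElements hg).and (varAlive hf ((hg.sub numElements).div (.const 2)))))

theorem code : PolyList (fun w _ _ => coverCode (toClauseSweep w).numElements
    (2 * (toClauseSweep w).numVars) (toClauseSweep w).Q
    (FormulaInc (toClauseSweep w).numVars (toClauseSweep w).counter.lit) (toClauseSweep w).Alive) := by
  refine .coverCode numElements numVars.two_mul PolySweep.Q ?_ (alive (.var 0) (.var 1))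
  exact ((PolyDecidable.lt (.var 0) numVars).and
    (.eq ((PolyComputable.var 1).div (.const 2)) (.var 0))).or
    ((PolyDecidable.le numVars (.var 0)).and (.exists_lt (.const 3)
      (.eq (counter.lit ((PolyComputable.var 1).sub numVars) (.var 0)) (.var 2))))

end PolyClauseSweep

end RAM

open RAM ThreeSatInstance in
/-- Satisfiability is a question about a set cover. -/
theorem SetCoverDecisionSolvable.threeSat {ε : ℝ} (h0 : 0 < ε) (h1 : ε ≤ 1)
    (h : SetCoverDecisionSolvable ε) : ThreeSatSolvable ε := by
  obtain ⟨C, c, h⟩ := h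
  have hβ : (1 : ℝ) ≤ 2 - ε := by linarith
  let V : ThreeSatInstance → ℕ := fun I => I.sweep.numVars
  let E : ThreeSatInstance → ℕ := fun I => I.sweep.numElements
  let m : ℕ → ℕ := fun x => (2 * x + 1) ^ 3 + 2 * x + 3
  have hm : PolyBounded m := by
    have h2 := (PolyBounded.const 2).mul .id
    exact (((h2.add (.const 1)).pow 3).add h2).add (.const 3)
  obtain ⟨BV, hBV, hV⟩ := PolyClauseSweep.numVars.exists_bound
  obtain ⟨BE, hBE, hE⟩ := PolyClauseSweep.numElements.exists_bound
  obtain ⟨BQ, hBQ, hQ⟩ := PolySweep.Q.exists_bound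
  have key := SolvableInTime.of_queries (encX := ThreeSatInstance.encode)
    (corrX := ThreeSatInstance.Correct) h (PolyComputable.const 1)
    (F := fun w _ _ => (toClauseSweep w).numVars ::
      coverCode (toClauseSweep w).numElements (2 * (toClauseSweep w).numVars) (toClauseSweep w).Q
        (FormulaInc (toClauseSweep w).numVars (toClauseSweep w).counter.lit) (toClauseSweep w).Alive)
    (G := fun _ v _ => [v 0]) (.cons PolyClauseSweep.numVars PolyClauseSweep.code)
    (.cons (.ans (.const 0)) .nil) (fun I => m I.numVars)
    (fun I => C * (2 - ε) ^ (I.decomp.width + (15 * I.sweep.L + 23)) *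
      ((E I : ℝ) + (2 * V I : ℕ) + 1) ^ c)
    (fun I => I.word_le) (fun I => by positivity)
    (fun I q v => 0 < q → (I.formula.Satisfiable ∧ v 0 = 1) ∨ (¬ I.formula.Satisfiable ∧ v 0 = 0))
    (fun I h => absurd h (lt_irrefl 0))
    (fun I v q hq hist => ?_)
    (fun I v hist => hist Nat.one_pos)
  · refine SolvableInTime.of_polyBounded (N := fun I => I.numVars) (pw := fun I => I.decomp.width) hβ key
      -- Since `2 ^ L ≤ 2 * Q + 1`, the surplus `15 * L + 23` of the width costs at most the factor
      -- `2 ^ 23 * (2 * Q + 1) ^ 15`.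
      (B := fun x => C * (2 ^ 23 * (2 * BQ (m x) + 1) ^ 15) * (BE (m x) + 2 * BV (m x) + 1) ^ c)
      (B' := m) ?_ (fun I => ?_) hm (fun I => le_rfl)
    · exact ((PolyBounded.const C).mul ((PolyBounded.const (2 ^ 23)).mul
        ((((PolyBounded.const 2).mul (hBQ.comp hm)).add (.const 1)).pow 15))).mul
        ((((hBE.comp hm).add ((PolyBounded.const 2).mul (hBV.comp hm))).add (.const 1)).pow c)
    · have hbelow : Below (m I.numVars) (word I.encode) (fun _ => 0) (fun _ => 0) :=
        ⟨I.word_le, fun _ => Nat.zero_le _, fun _ => Nat.zero_le _⟩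
      refine query_time_le hβ (by linarith) ?_ (by positivity) ?_
      · rw [pow_add, pow_mul', mul_comm]
        refine Nat.mul_le_mul_left _ (Nat.pow_le_pow_left ?_ 15)
        have h2 := I.sweep.Q.two_pow_size_le
        have h3 : I.sweep.Q ≤ BQ (m I.numVars) := hQ _ _ _ _ hbelow
        have h4 : I.sweep.L = I.sweep.Q.size := rfl
        rw [h4]; omega
      · have h2 : E I ≤ BE (m I.numVars) := hE _ _ _ _ hbelow
        have h3 : V I ≤ BV (m I.numVars) := hV _ _ _ _ hbelow
        have h4 : E I + 2 * V I + 1 ≤ BE (m I.numVars) + 2 * BV (m I.numVars) + 1 := by omega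
        exact_mod_cast h4
  · obtain rfl : q = 0 := Nat.lt_one_iff.1 hq
    have hC := I.valid
    have hsets : hC.coverData.toInstance.numSets = 2 * I.sweep.numVars := hC.coverData.length_sets
    -- With as many sets allowed as there are variables, a cover contains exactly one literal of
    -- each variable.
    let J : SetCoverDecisionInstance :=
      { hC.coverData.toInstance with
        target := I.sweep.numVars
        target_le := by
          show _ ≤ hC.coverData.toInstance.numSets
          omega }
    have hyes : J.Yes ↔ I.formula.Satisfiable := hC.exists_cover_iff.trans I.exists_models_iff
    refine ⟨J, ?_, ?_, fun out hout => ?_⟩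
    · have hw : J.decomp.width ≤ I.decomp.width + (15 * I.sweep.L + 23) :=
        hC.width_le fun i => I.encodes.sweep_card_le _ i
      have hn : ((J.numElements : ℝ)) + (J.toSetCoverInstance.numSets : ℝ) + 1 =
          (E I : ℝ) + (2 * V I : ℕ) + 1 := by
        have h2 : J.numElements = E I := rfl
        have h3 : J.toSetCoverInstance.numSets = 2 * V I := hsets
        rw [h2, h3]
      rw [hn]
      exact mul_le_mul_of_nonneg_right (mul_le_mul_of_nonneg_left (pow_le_pow_right₀ hβ hw)
        (by positivity)) (by positivity)
    · have : J.encode = I.sweep.numVars :: hC.coverData.toInstance.encode := rfl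
      rw [this, hC.coverData.encode_eq]
      rfl
    · have hout' : (I.formula.Satisfiable ∧ out 0 = 1) ∨
          (¬ I.formula.Satisfiable ∧ out 0 = 0) := by
        rw [← hyes]; exact hout
      refine ⟨?_, fun _ => by rwa [Function.update_self]⟩
      rcases hout' with h | h <;> simp only [m] <;> omega

/-! ### The cycle of reductions -/

/-- Shrinking `ε` to at most one makes the base at least one, so that the time bound is monotone in
the width. The reductions need this because they control the new width only from above. -/
theorem time_mono {ε : ℝ} (h2 : ε < 2) {C : ℕ} {pw c : ℕ} {x : ℝ} (hx : 0 ≤ x) :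
    C * (2 - ε) ^ pw * x ^ c ≤ C * (2 - min ε 1) ^ pw * x ^ c :=
  mul_le_mul_of_nonneg_right (mul_le_mul_of_nonneg_left
    (pow_le_pow_left₀ (by linarith) (by linarith [min_le_left ε 1]) _) (Nat.cast_nonneg _))
    (pow_nonneg hx _)

theorem ThreeSatSolvable.min_one {ε : ℝ} (h2 : ε < 2) :
    ThreeSatSolvable ε → ThreeSatSolvable (min ε 1) := fun ⟨C, c, h⟩ =>
  ⟨C, c, h.mono fun _ => time_mono h2 (by positivity)⟩

theorem SetCoverSolvable.min_one {ε : ℝ} (h2 : ε < 2) :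
    SetCoverSolvable ε → SetCoverSolvable (min ε 1) := fun ⟨C, c, h⟩ =>
  ⟨C, c, h.mono fun _ => time_mono h2 (by positivity)⟩

theorem SetCoverDecisionSolvable.min_one {ε : ℝ} (h2 : ε < 2) :
    SetCoverDecisionSolvable ε → SetCoverDecisionSolvable (min ε 1) := fun ⟨C, c, h⟩ =>
  ⟨C, c, h.mono fun _ => time_mono h2 (by positivity)⟩

theorem mainTheorem12 :
    ((∃ ε : ℝ, 0 < ε ∧ ε < 2 ∧ SetCoverSolvable ε) ↔ ¬ PPSETH) ∧
    ((∃ ε : ℝ, 0 < ε ∧ ε < 2 ∧ SetCoverDecisionSolvable ε) ↔ ¬ PPSETH) := by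
  have hpp : ¬ PPSETH ↔ ∃ ε : ℝ, 0 < ε ∧ ε < 2 ∧ ThreeSatSolvable ε := by
    simp only [PPSETH, not_forall, not_not, exists_prop]
  have hpos : ∀ {ε : ℝ}, 0 < ε → 0 < min ε 1 := fun h => lt_min h one_pos
  have hle : ∀ ε : ℝ, min ε 1 ≤ 1 := fun ε => min_le_right _ _
  have hlt : ∀ ε : ℝ, min ε 1 < 2 := fun ε => (hle ε).trans_lt one_lt_two
  have hcover : (∃ ε : ℝ, 0 < ε ∧ ε < 2 ∧ ThreeSatSolvable ε) →
      ∃ ε : ℝ, 0 < ε ∧ ε < 2 ∧ SetCoverSolvable ε := fun ⟨ε, h0, h2, h⟩ =>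
    ⟨min ε 1, hpos h0, hlt ε, (h.min_one h2).setCover (hpos h0) (hle ε)⟩
  have hdec : (∃ ε : ℝ, 0 < ε ∧ ε < 2 ∧ SetCoverSolvable ε) →
      ∃ ε : ℝ, 0 < ε ∧ ε < 2 ∧ SetCoverDecisionSolvable ε := fun ⟨ε, h0, h2, h⟩ =>
    ⟨min ε 1, hpos h0, hlt ε, (h.min_one h2).decision (hle ε)⟩
  have hsat : (∃ ε : ℝ, 0 < ε ∧ ε < 2 ∧ SetCoverDecisionSolvable ε) →
      ∃ ε : ℝ, 0 < ε ∧ ε < 2 ∧ ThreeSatSolvable ε := fun ⟨ε, h0, h2, h⟩ =>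
    ⟨min ε 1, hpos h0, hlt ε, (h.min_one h2).threeSat (hpos h0) (hle ε)⟩
  rw [hpp]
  exact ⟨⟨fun h => hsat (hdec h), hcover⟩, ⟨hsat, fun h => hdec (hcover h)⟩⟩
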